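/- \textbf{Theorem (Convergence towards a weak solution).} Let $\delta,T>0$. Let $\omega_\delta:\mathbb R\to[0,\infty)$ vanish outside $[0,\delta]$ with $\int_0^\delta\omega_\delta(h)\,dh=1$. Let $g:\mathbb R\times\mathbb R\to\mathbb R$ be Lipschitz continuous, nondecreasing in its first and nonincreasing in its second argument, and put $f(u)=g(u,u)$. Let $u_0\in L^1(\mathbb R)\cap BV(\mathbb R)$. Consider the nonlocal pair-interaction model $$\partial_t u+\int_0^\delta\frac{g(u,\tau_hu)-g(\tau_{-h}u,u)}{h}\,\omega_\delta(h)\,dh=0\quad\text{in }\mathbb R\times(0,T),\qquad u(\cdot,0)=u_0,\qquad(\ast)$$ where $\tau_{\pm h}u(x,t)=u(x\pm h,t)$. \emph{Solutions.} A function $u\in L^\infty(\mathbb R\times(0,T))$ is a \emph{weak solution} of $(\ast)$ if for all $\phi\in C_c^\infty(\mathbb R\times[0,T))$ $$\int_0^T\!\!\int_{\mathbb R}u\,\partial_t\phi\,dx\,dt+\int_{\mathbb R}u_0(x)\phi(x,0)\,dx+\int_0^T\!\!\int_{\mathbb R}\int_0^\delta\frac{\tau_h\phi-\phi}{h}\,g(u,\tau_hu)\,\omega_\delta(h)\,dh\,dx\,dt=0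 .$$ It is an \emph{entropy solution} if for all $c\in\mathbb R$ and all nonnegative $\phi\in C_c^\infty(\mathbb R\times[0,T))$ $$\int_0^T\!\!\int_{\mathbb R}|u-c|\,\partial_t\phi\,dx\,dt+\int_{\mathbb R}|u_0(x)-c|\phi(x,0)\,dx+\int_0^T\!\!\int_{\mathbb R}\int_0^\delta\frac{\tau_h\phi-\phi}{h}\,q(u,\tau_hu;c)\,\omega_\delta(h)\,dh\,dx\,dt\ge0,$$ where $q(a,b;c)=g(a\vee c,b\vee c)-g(a\wedge c,b\wedge c)$. \emph{Scheme.} Fix $\lambda>0$ such that $\lambda\big(\partial_1g(u,v)-\partial_2g(w,v)\big)\le1$ for all $u,v,w\in\mathbb R$ at which these partial derivatives exist (CFL condition). For $\Delta t>0$ let $\Delta x=\Delta t/\lambda$, $r=\lfloor\delta/\Delta x\rfloor$, $\Phi_i(h)=\max\{0,1-|h-i\Delta x|/\Delta x\}$, and $$W_0=\int_0^{\Delta x}\Phi_0\,\omega_\delta\,dh,\qquad W_k=\int_{(k-1)\Delta x}^{(k+1)\Delta x}\Phi_k\,\omega_\delta\,dh\quad(1\le k\le r+1).$$ For $j\in\mathbb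 Z$ and $n\ge0$ let $u_j^0=\frac1{\Delta x}\int_{(j-1/2)\Delta x}^{(j+1/2)\Delta x}u_0\,dx$ and $$u_j^{n+1}=u_j^n-\Delta t\left[\frac{g(u_j^{n,+},u_{j+1}^{n,-})-g(u_{j-1}^{n,+},u_j^{n,-})}{\Delta x}W_0+\sum_{k=1}^{r+1}\frac{g(u_j^n,u_{j+k}^n)-g(u_{j-k}^n,u_j^n)}{k\Delta x}W_k\right],$$ where $u_j^{n,\pm}=u_j^n\pm\frac12\sigma_j^n$ and the slopes $\sigma_j^n$ are any real numbers (they may depend on $\Delta t$) with $|\sigma_{j+1}^n-\sigma_j^n|\le2|u_{j+1}^n-u_j^n|$ for all $j,n$. Let $u_{\Delta t}(x,t)=u_j^n$ for $(j-\frac12)\Delta x\le x<(j+\frac12)\Delta x$ and $n\Delta t\le t<(n+1)\Delta t$. \emph{Conclusion.} Every sequence of time steps $\Delta t_m>0$ with $\Delta t_m\to0$ has a subsequence $(\Delta t_{m_k})_k$ for which there is a function $u\in C([0,T];L^1(\mathbb R))$ such that $u_{\Delta t_{m_k}}(\cdot,t)\to u(\cdot,t)$ in $L^1_{\mathrm{loc}}(\mathbb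 R)$ for every $t\in[0,T]$, and $u$ is a weak solution of $(\ast)$. If in addition $\int_0^\delta\frac{\omega_\delta(h)}h\,dh<\infty$, then $(\ast)$ has an entropy solution $u$, unique up to equality almost everywhere in $\mathbb R\times(0,T)$; it can be chosen in $C([0,T];L^1(\mathbb R))$ and is a weak solution, and the whole family converges to it: $u_{\Delta t}(\cdot,t)\to u(\cdot,t)$ in $L^1_{\mathrm{loc}}(\mathbb R)$ as $\Delta t\to0^+$, for every $t\in[0,T]$. -/

import Mathlib

open MeasureTheory Filter Topology Set
open scoped ENNReal

namespace PairInteraction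

/-- Nonlocal interaction kernels with horizon `δ`: nonnegative, supported in `[0, δ]`, with unit
mass (so in particular integrable, a non-integrable function having Bochner integral `0`). -/
structure IsInteractionKernel (δ : ℝ) (ω : ℝ → ℝ) : Prop where
  nonneg : ∀ h, 0 ≤ ω h
  support_subset : Function.support ω ⊆ Icc 0 δ
  integral_eq_one : ∫ h in (0 : ℝ)..δ, ω h = 1

/-- Two-point numerical fluxes: consistent with `f`, nondecreasing in the first argument,
nonincreasing in the second one, and Lipschitz continuous. -/
structure IsMonotoneFlux (f : ℝ → ℝ) (g : ℝ → ℝ → ℝ) : Prop where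
  consistent : ∀ u, g u u = f u
  monotone_fst : ∀ v, Monotone fun u => g u v
  antitone_snd : ∀ u, Antitone fun v => g u v
  lipschitz : ∃ C : ℝ, ∀ u₁ v₁ u₂ v₂, |g u₁ v₁ - g u₂ v₂| ≤ C * (|u₁ - u₂| + |v₁ - v₂|)

/-- The CFL condition `lam * (∂₁ g (u, v) - ∂₂ g (w, v)) ≤ 1` for all `u v w`. A Lipschitz flux may
fail to be differentiable at some points; the inequality is required wherever the two partial
derivatives exist. -/
def CFLCondition (lam : ℝ) (g : ℝ → ℝ → ℝ) : Prop :=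
  ∀ u v w p q : ℝ, HasDerivAt (fun a => g a v) p u → HasDerivAt (fun b => g w b) q v →
    lam * (p - q) ≤ 1

/-- The space `L¹(ℝ) ∩ BV(ℝ)`; elements of `L¹` are classes modulo equality almost everywhere, so
finiteness of the total variation is asked of a representative. -/
def MemL1BV (u₀ : ℝ → ℝ) : Prop :=
  Integrable u₀ ∧ ∃ w : ℝ → ℝ, u₀ =ᵐ[volume] w ∧ BoundedVariationOn w univ

/-! ### Weak and entropy solutions -/

/-- Test functions in `C_c^∞(ℝ × [0, T))`, as restrictions to `t ≥ 0` of smooth compactly supported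
functions on `ℝ × ℝ`. -/
structure IsTestFunction (T : ℝ) (φ : ℝ → ℝ → ℝ) : Prop where
  smooth : ContDiff ℝ ((⊤ : ℕ∞) : WithTop ℕ∞) (fun p : ℝ × ℝ => φ p.1 p.2)
  compact_support : HasCompactSupport (fun p : ℝ × ℝ => φ p.1 p.2)
  tsupport_subset : tsupport (fun p : ℝ × ℝ => φ p.1 p.2) ⊆ univ ×ˢ Iio T

/-- Membership of `(x, t) ↦ u x t` in `L^∞(ℝ × (0, T))`. -/
def MemLInfty (T : ℝ) (u : ℝ → ℝ → ℝ) : Prop :=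
  MemLp (fun p : ℝ × ℝ => u p.1 p.2) ∞ (volume.restrict (univ ×ˢ Ioo 0 T))

/-- Weak solutions, on `ℝ × (0, T)` and with initial datum `u₀`, of
`∂ₜ u + ∫₀^δ (g (u, τ_h u) - g (τ_{-h} u, u)) / h * ω h dh = 0`. -/
structure IsWeakSolution (g : ℝ → ℝ → ℝ) (ω : ℝ → ℝ) (δ T : ℝ) (u₀ : ℝ → ℝ)
    (u : ℝ → ℝ → ℝ) : Prop where
  memLInfty : MemLInfty T u
  weak_form : ∀ φ : ℝ → ℝ → ℝ, IsTestFunction T φ →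
    (∫ t in (0 : ℝ)..T, ∫ x, u x t * deriv (fun s => φ x s) t) + (∫ x, u₀ x * φ x 0)
      + (∫ t in (0 : ℝ)..T, ∫ x, ∫ h in (0 : ℝ)..δ,
          (φ (x + h) t - φ x t) / h * g (u x t) (u (x + h) t) * ω h) = 0

/-- The nonlocal entropy flux `q (a, b; c)` of the entropy `|u - c|`. -/
def entropyFlux (g : ℝ → ℝ → ℝ) (c a b : ℝ) : ℝ :=
  g (max a c) (max b c) - g (min a c) (min b c)

/-- Kruzhkov entropy solutions of the nonlocal pair-interaction model. -/
structure IsEntropySolution (g : ℝ → ℝ → ℝ) (ω : ℝ → ℝ) (δ T : ℝ) (u₀ : ℝ → ℝ)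
    (u : ℝ → ℝ → ℝ) : Prop where
  memLInfty : MemLInfty T u
  entropy_ineq : ∀ (c : ℝ) (φ : ℝ → ℝ → ℝ), IsTestFunction T φ →
    (∀ x t, 0 ≤ t → 0 ≤ φ x t) →
    0 ≤ (∫ t in (0 : ℝ)..T, ∫ x, |u x t - c| * deriv (fun s => φ x s) t)
      + (∫ x, |u₀ x - c| * φ x 0)
      + (∫ t in (0 : ℝ)..T, ∫ x, ∫ h in (0 : ℝ)..δ,
          (φ (x + h) t - φ x t) / h * entropyFlux g c (u x t) (u (x + h) t) * ω h)

/-- `t ↦ u (·, t)` belongs to `C([0, T]; L¹(ℝ))`. -/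
def ContinuousInL1 (T : ℝ) (u : ℝ → ℝ → ℝ) : Prop :=
  (∀ t ∈ Icc 0 T, Integrable fun x => u x t) ∧
  ∀ s ∈ Icc 0 T,
    Tendsto (fun t => eLpNorm (fun x => u x t - u x s) 1 volume) (𝓝[Icc 0 T] s) (𝓝 0)

/-! ### The numerical scheme -/

/-- The continuous piecewise linear hat function centred at the node `i * dx`. -/
noncomputable def hat (dx : ℝ) (i : ℕ) (h : ℝ) : ℝ :=
  max 0 (1 - |h - i * dx| / dx)

/-- The weights `W₀ = ∫_{I₁} Φ₀ ω` and `W_k = ∫_{I_k ∪ I_{k+1}} Φ_k ω` for `k ≥ 1`, where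
`I_k = ((k - 1) dx, k dx)`. -/
noncomputable def weight (ω : ℝ → ℝ) (dx : ℝ) : ℕ → ℝ
  | 0 => ∫ h in (0 : ℝ)..dx, hat dx 0 h * ω h
  | k + 1 => ∫ h in (k * dx : ℝ)..((k + 2) * dx), hat dx (k + 1) h * ω h

/-- The flux `g (u_j⁺, u_{j+1}⁻)` across the interface `j + 1/2`, with edge values
`u_j^± = u_j ± σ_j / 2`. -/
noncomputable def interfaceFlux (g : ℝ → ℝ → ℝ) (σ u : ℤ → ℝ) (j : ℤ) : ℝ :=
  g (u j + σ j / 2) (u (j + 1) - σ (j + 1) / 2)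

/-- The spatial discretization `L(u)_j`; here `r = ⌊δ / dx⌋`, and the index `k` of the mathematical
formula runs through `1, …, r + 1`. -/
noncomputable def spatialOperator (g : ℝ → ℝ → ℝ) (ω : ℝ → ℝ) (δ dx : ℝ) (σ u : ℤ → ℝ)
    (j : ℤ) : ℝ :=
  (interfaceFlux g σ u j - interfaceFlux g σ u (j - 1)) / dx * weight ω dx 0
    + ∑ k ∈ Finset.Icc 1 (⌊δ / dx⌋₊ + 1),
        (g (u j) (u (j + k)) - g (u (j - k)) (u j)) / (k * dx) * weight ω dx k

/-- `u n j` are the values of the forward Euler scheme with mesh sizes `dx`, `dt`, computed with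
slopes `σ n j` in the TVD region `-2 ≤ (σ_{j+1} - σ_j) / (u_{j+1} - u_j) ≤ 2` (written without
division, so that equal neighbouring values have equal slopes). -/
structure IsSchemeSolution (g : ℝ → ℝ → ℝ) (ω : ℝ → ℝ) (δ dx dt : ℝ) (u₀ : ℝ → ℝ)
    (σ u : ℕ → ℤ → ℝ) : Prop where
  initial : ∀ j : ℤ, u 0 j = 1 / dx * ∫ x in ((j - 1 / 2) * dx : ℝ)..((j + 1 / 2) * dx), u₀ x
  step : ∀ n j, u (n + 1) j = u n j - dt * spatialOperator g ω δ dx (σ n) (u n) j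
  slopes : ∀ n j, |σ n (j + 1) - σ n j| ≤ 2 * |u n (j + 1) - u n j|

/-- The piecewise constant function equal to `u n j` for `x` in the cell
`[(j - 1/2) dx, (j + 1/2) dx)` and `t` in `[n dt, (n + 1) dt)`. -/
noncomputable def piecewiseConstant (dx dt : ℝ) (u : ℕ → ℤ → ℝ) (x t : ℝ) : ℝ :=
  u ⌊t / dt⌋₊ ⌊x / dx + 1 / 2⌋

/-- Convergence in `L¹_loc(ℝ)` of `w i` to `v` along the filter `l`. -/
def TendstoL1Loc {ι : Type*} (w : ι → ℝ → ℝ) (l : Filter ι) (v : ℝ → ℝ) : Prop :=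
  ∀ K : Set ℝ, IsCompact K →
    Tendsto (fun i => eLpNorm (fun x => w i x - v x) 1 (volume.restrict K)) l (𝓝 0)

end PairInteraction

open PairInteraction

/-!
The mathematical reason for the convergence is that the scheme, written as `u_j ↦ u_j - ∑ₖ μₖ
(Fᵏ_j - Fᵏ_{j - max k 1})`, has coefficients `μₖ = λ W_k / max k 1` whose sum tends to zero with
the mesh size (`tendsto_sum_coeff`): the interaction kernel is integrable, so a fixed distance `h`
is only seen by nodes `k` of order `h / Δx`. Harten's incremental argument (`incremental_tsum_le`)
therefore applies to all small time steps. The slope condition says that the increments of the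
reconstructed edge values are dominated by those of the cell values, which makes the scheme total
variation diminishing (`IsSchemeSolution.tvd`). The factor `1 / k` in `μₖ` cancels the variation
over `k` cells, so the scheme is Lipschitz continuous in time with values in `L¹`
(`IsSchemeSolution.time_diff_tsum_le`). The nonlocal part is a monotone update and obeys a
discrete Kruzhkov inequality; the reconstructed local part carries the weight `W₀ → 0` and enters
as an error that vanishes in the limit (`IsSchemeSolution.entropy_step`, `tendsto_weight_zero`).

Compactness (`UniformBounds.exists_subseq_tendsto`) uses primitives in place of Kolmogorov's
criterion. The primitives of the approximations are equicontinuous, so a subsequence of them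
converges at all points. Since the `L¹` modulus of translation is uniform, the functions are close
to their sliding averages, which are difference quotients of the primitives, and hence they
converge themselves. Convergence is measured in `L¹` of a Gaussian measure, which on bounded
sequences amounts to local `L¹` convergence. Summation by parts in the discrete inequality
(`integral_cutoff_residual`) and the convergence of the quadrature
(`tendsto_sum_weight_interaction`) then show that the limits are weak solutions and entropy
solutions (`SchemeLimit.testFunctional_nonneg`).

If `ω h / h` is integrable, the nonlocal operator is Lipschitz continuous in the supremum norm,
and doubling of variables is not needed for uniqueness. The Kruzhkov inequalities with constants
outside the range of an entropy solution give the weak equation (`IsEntropySolution.weak_eq`). In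
integrated form (`ae_eq_backwardAverage`) the difference of two solutions satisfies a Gronwall
inequality, so it vanishes (`ae_eq_zero_of_backwardAverage`, `IsEntropySolution.ae_eq`). All
subsequential limits thus coincide, and the whole family converges
(`SchemeLimit.tendsto_of_unique`).
-/

namespace PairInteraction

/-! ### Discrete contraction and monotonicity -/

/-- `d` lies between `0` and `2 * D`: it has the sign of `D` and at most twice its size. -/
def SignDominated (d D : ℝ) : Prop :=
  (0 ≤ D → 0 ≤ d ∧ d ≤ 2 * D) ∧ (D ≤ 0 → 2 * D ≤ d ∧ d ≤ 0)

lemma signDominated_self (D : ℝ) : SignDominated D D :=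
  ⟨fun h => ⟨h, by linarith⟩, fun h => ⟨by linarith, h⟩⟩

lemma SignDominated.abs_le {d D : ℝ} (h : SignDominated d D) : |d| ≤ 2 * |D| := by
  rcases le_total 0 D with hD | hD
  · rw [abs_of_nonneg hD, abs_of_nonneg (h.1 hD).1]; exact (h.1 hD).2
  · rw [abs_of_nonpos hD, abs_of_nonpos (h.2 hD).2]; linarith [(h.2 hD).1]

lemma summable_comp_add {f : ℤ → ℝ} (hf : Summable f) (s : ℤ) : Summable fun j => f (j + s) :=
  (Equiv.addRight s).summable_iff.2 hf

lemma tsum_comp_add (f : ℤ → ℝ) (s : ℤ) : ∑' j, f (j + s) = ∑' j, f j :=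
  (Equiv.addRight s).tsum_eq f

section Incremental

variable {ι : Type*} {K : Finset ι} {μ : ι → ℝ} {s : ι → ℤ} {D : ℤ → ℝ} {p r : ι → ℤ → ℝ}

/-- The incremental form of the update collects what leaves and what reaches the index `j`. -/
lemma incremental_rearrange (j : ℤ) :
    D j - ∑ k ∈ K, μ k * ((p k j - r k (j + s k)) - (p k (j - s k) - r k j))
      = (D j - ∑ k ∈ K, μ k * (p k j + r k j))
        + ∑ k ∈ K, μ k * (r k (j + s k) + p k (j - s k)) := by
  have : ∑ k ∈ K, μ k * ((p k j - r k (j + s k)) - (p k (j - s k) - r k j))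
      = ∑ k ∈ K, μ k * (p k j + r k j) - ∑ k ∈ K, μ k * (r k (j + s k) + p k (j - s k)) := by
    rw [← Finset.sum_sub_distrib]
    exact Finset.sum_congr rfl fun k _ => by ring
  rw [this]; ring

/-- If the increments are small compared with `D`, the update preserves nonnegativity. -/
lemma incremental_nonneg (hμ : ∀ k ∈ K, 0 ≤ μ k) (hD : ∀ j, 0 ≤ D j)
    (hp : ∀ k ∈ K, ∀ j, 0 ≤ p k j) (hr : ∀ k ∈ K, ∀ j, 0 ≤ r k j)
    (hb : ∀ j, ∑ k ∈ K, μ k * (|p k j| + |r k j|) ≤ |D j|) (j : ℤ) :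
    0 ≤ D j - ∑ k ∈ K, μ k * ((p k j - r k (j + s k)) - (p k (j - s k) - r k j)) := by
  rw [incremental_rearrange]
  have h1 : ∑ k ∈ K, μ k * (p k j + r k j) ≤ D j := by
    have := hb j
    rw [abs_of_nonneg (hD j)] at this
    refine le_trans (Finset.sum_le_sum fun k hk => ?_) this
    exact mul_le_mul_of_nonneg_left (add_le_add (le_abs_self _) (le_abs_self _)) (hμ k hk)
  have h2 : 0 ≤ ∑ k ∈ K, μ k * (r k (j + s k) + p k (j - s k)) :=
    Finset.sum_nonneg fun k hk => mul_nonneg (hμ k hk) (add_nonneg (hr k hk _) (hp k hk _))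
  linarith

/-- Harten's argument: whatever the increments `p`, `r` take away from `|D j|` reappears, by a
shift of the index, at the neighbours of `j`, so that the total mass does not grow. -/
lemma incremental_tsum_le (hμ : ∀ k ∈ K, 0 ≤ μ k) (hD : Summable fun j => |D j|)
    (hp : ∀ k ∈ K, ∀ j, (0 ≤ D j → 0 ≤ p k j) ∧ (D j ≤ 0 → p k j ≤ 0))
    (hr : ∀ k ∈ K, ∀ j, (0 ≤ D j → 0 ≤ r k j) ∧ (D j ≤ 0 → r k j ≤ 0))
    {C : ℝ} (hpC : ∀ k ∈ K, ∀ j, |p k j| ≤ C * |D j|) (hrC : ∀ k ∈ K, ∀ j, |r k j| ≤ C * |D j|)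
    (hC : 2 * C * ∑ k ∈ K, μ k ≤ 1) :
    (Summable fun j =>
      |D j - ∑ k ∈ K, μ k * ((p k j - r k (j + s k)) - (p k (j - s k) - r k j))|) ∧
    ∑' j, |D j - ∑ k ∈ K, μ k * ((p k j - r k (j + s k)) - (p k (j - s k) - r k j))|
      ≤ ∑' j, |D j| := by
  have hb : ∀ j, ∑ k ∈ K, μ k * (|p k j| + |r k j|) ≤ |D j| := fun j => by
    calc ∑ k ∈ K, μ k * (|p k j| + |r k j|) ≤ ∑ k ∈ K, μ k * (2 * C * |D j|) :=
          Finset.sum_le_sum fun k hk => mul_le_mul_of_nonneg_left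
            (by linarith [hpC k hk j, hrC k hk j]) (hμ k hk)
      _ = (2 * C * ∑ k ∈ K, μ k) * |D j| := by rw [← Finset.sum_mul]; ring
      _ ≤ 1 * |D j| := mul_le_mul_of_nonneg_right hC (abs_nonneg _)
      _ = |D j| := one_mul _
  -- `p` and `r` have the sign of `D` and their weighted sum is at most `|D j|`, so subtracting them
  -- reduces the absolute value without changing the sign
  have hQ : ∀ j, |D j - ∑ k ∈ K, μ k * (p k j + r k j)|
      = |D j| - ∑ k ∈ K, μ k * (|p k j| + |r k j|) := fun j => by
    rcases le_total 0 (D j) with h | h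
    · have e : ∑ k ∈ K, μ k * (|p k j| + |r k j|) = ∑ k ∈ K, μ k * (p k j + r k j) :=
        Finset.sum_congr rfl fun k hk => by
          rw [abs_of_nonneg ((hp k hk j).1 h), abs_of_nonneg ((hr k hk j).1 h)]
      have := hb j
      rw [e] at this ⊢
      rw [abs_of_nonneg h] at this ⊢
      exact abs_of_nonneg (by linarith)
    · have e : ∑ k ∈ K, μ k * (|p k j| + |r k j|) = -∑ k ∈ K, μ k * (p k j + r k j) := by
        rw [← Finset.sum_neg_distrib]
        exact Finset.sum_congr rfl fun k hk => by
          rw [abs_of_nonpos ((hp k hk j).2 h), abs_of_nonpos ((hr k hk j).2 h)]; ring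
      have := hb j
      rw [e] at this ⊢
      rw [abs_of_nonpos h] at this ⊢
      rw [abs_of_nonpos (by linarith)]; ring
  have hps : ∀ k ∈ K, Summable fun j => |p k j| := fun k hk =>
    Summable.of_nonneg_of_le (fun _ => abs_nonneg _) (hpC k hk) (hD.mul_left C)
  have hrs : ∀ k ∈ K, Summable fun j => |r k j| := fun k hk =>
    Summable.of_nonneg_of_le (fun _ => abs_nonneg _) (hrC k hk) (hD.mul_left C)
  have hps' : ∀ k ∈ K, Summable fun j => |p k (j - s k)| := fun k hk => by
    simpa [sub_eq_add_neg] using summable_comp_add (hps k hk) (-s k)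
  have hrs' : ∀ k ∈ K, Summable fun j => |r k (j + s k)| := fun k hk =>
    summable_comp_add (hrs k hk) (s k)
  have hs1 : Summable fun j => ∑ k ∈ K, μ k * (|p k j| + |r k j|) :=
    summable_sum fun k hk => ((hps k hk).add (hrs k hk)).mul_left _
  have hs2 : Summable fun j => ∑ k ∈ K, μ k * (|r k (j + s k)| + |p k (j - s k)|) :=
    summable_sum fun k hk => ((hrs' k hk).add (hps' k hk)).mul_left _
  have heq : ∑' j, ∑ k ∈ K, μ k * (|r k (j + s k)| + |p k (j - s k)|)
      = ∑' j, ∑ k ∈ K, μ k * (|p k j| + |r k j|) := by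
    rw [Summable.tsum_finsetSum fun k hk => ((hrs' k hk).add (hps' k hk)).mul_left _,
      Summable.tsum_finsetSum fun k hk => ((hps k hk).add (hrs k hk)).mul_left _]
    refine Finset.sum_congr rfl fun k hk => ?_
    rw [tsum_mul_left, tsum_mul_left, (hrs' k hk).tsum_add (hps' k hk),
      (hps k hk).tsum_add (hrs k hk), tsum_comp_add (fun j => |r k j|) (s k)]
    have := tsum_comp_add (fun j => |p k j|) (-s k)
    simp only [← sub_eq_add_neg] at this
    rw [this, add_comm]
  have hpt : ∀ j, |D j - ∑ k ∈ K, μ k * ((p k j - r k (j + s k)) - (p k (j - s k) - r k j))|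
      ≤ (|D j| - ∑ k ∈ K, μ k * (|p k j| + |r k j|))
        + ∑ k ∈ K, μ k * (|r k (j + s k)| + |p k (j - s k)|) := fun j => by
    rw [incremental_rearrange, ← hQ j]
    refine (abs_add_le _ _).trans (add_le_add_right ?_ _)
    refine (Finset.abs_sum_le_sum_abs _ _).trans (Finset.sum_le_sum fun k hk => ?_)
    rw [abs_mul, abs_of_nonneg (hμ k hk)]
    exact mul_le_mul_of_nonneg_left (abs_add_le _ _) (hμ k hk)
  have hsum := (hD.sub hs1).add hs2
  have hS := Summable.of_nonneg_of_le (fun _ => abs_nonneg _) hpt hsum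
  refine ⟨hS, (hS.tsum_le_tsum hpt hsum).trans (le_of_eq ?_)⟩
  rw [(hD.sub hs1).tsum_add hs2, hD.tsum_sub hs1, heq]; ring

end Incremental

/-! ### Conservative updates with monotone two-point fluxes -/

/-- The conservative update `u_j - ∑ₖ μₖ (Fᵏ_j - Fᵏ_{j - sₖ})` with the monotone fluxes
`Fᵏ_j = g (aᵏ_j, bᵏ_{j + sₖ})`. -/
def conservativeUpdate {ι : Type*} (g : ℝ → ℝ → ℝ) (K : Finset ι) (μ : ι → ℝ) (s : ι → ℤ)
    (u : ℤ → ℝ) (a b : ι → ℤ → ℝ) (j : ℤ) : ℝ :=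
  u j - ∑ k ∈ K, μ k * (g (a k j) (b k (j + s k)) - g (a k (j - s k)) (b k j))

section Update

variable {ι : Type*} {g : ℝ → ℝ → ℝ} {f : ℝ → ℝ} {K : Finset ι} {μ : ι → ℝ} {s : ι → ℤ} {C : ℝ}

/-- The difference of two updates in incremental form: the change of each flux is split into the
change of the first and of the second argument. The shifts `s k` are undone formally in some
arguments, so that both terms of the sum are instances of one expression. -/
lemma conservativeUpdate_sub (u u' : ℤ → ℝ) (a b a' b' : ι → ℤ → ℝ) (j : ℤ) :
    conservativeUpdate g K μ s u' a' b' j - conservativeUpdate g K μ s u a b j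
      = (u' j - u j) - ∑ k ∈ K, μ k *
        (((g (a' k j) (b' k (j + s k)) - g (a k j) (b' k (j + s k)))
            - (g (a k (j + s k - s k)) (b k (j + s k)) - g (a k (j + s k - s k)) (b' k (j + s k))))
          - ((g (a' k (j - s k)) (b' k (j - s k + s k)) - g (a k (j - s k)) (b' k (j - s k + s k)))
            - (g (a k (j - s k)) (b k j) - g (a k (j - s k)) (b' k j)))) := by
  unfold conservativeUpdate
  have e : ∀ x y X Y : ℝ, (x - X) - (y - Y) = (x - y) - (X - Y) := fun x y X Y => by ring
  rw [e, ← Finset.sum_sub_distrib]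
  congr 1
  refine Finset.sum_congr rfl fun k _ => ?_
  rw [add_sub_cancel_right, sub_add_cancel]
  ring

variable {u u' : ℤ → ℝ} {a b a' b' : ι → ℤ → ℝ}

lemma fst_increment (hg : IsMonotoneFlux f g)
    (hC : ∀ u₁ v₁ u₂ v₂, |g u₁ v₁ - g u₂ v₂| ≤ C * (|u₁ - u₂| + |v₁ - v₂|))
    (hC0 : 0 ≤ C) {x x' y D : ℝ} (h : SignDominated (x' - x) D) :
    ((0 ≤ D → 0 ≤ g x' y - g x y) ∧ (D ≤ 0 → g x' y - g x y ≤ 0)) ∧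
      |g x' y - g x y| ≤ 2 * C * |D| := by
  refine ⟨⟨fun hD => ?_, fun hD => ?_⟩, ?_⟩
  · exact sub_nonneg.2 (hg.monotone_fst y (sub_nonneg.1 (h.1 hD).1))
  · exact sub_nonpos.2 (hg.monotone_fst y (sub_nonpos.1 (h.2 hD).2))
  · refine (hC x' y x y).trans ?_
    rw [sub_self, abs_zero, add_zero]
    nlinarith [h.abs_le]

lemma snd_increment (hg : IsMonotoneFlux f g)
    (hC : ∀ u₁ v₁ u₂ v₂, |g u₁ v₁ - g u₂ v₂| ≤ C * (|u₁ - u₂| + |v₁ - v₂|))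
    (hC0 : 0 ≤ C) {x y y' D : ℝ} (h : SignDominated (y' - y) D) :
    ((0 ≤ D → 0 ≤ g x y - g x y') ∧ (D ≤ 0 → g x y - g x y' ≤ 0)) ∧
      |g x y - g x y'| ≤ 2 * C * |D| := by
  refine ⟨⟨fun hD => ?_, fun hD => ?_⟩, ?_⟩
  · exact sub_nonneg.2 (hg.antitone_snd x (sub_nonneg.1 (h.1 hD).1))
  · exact sub_nonpos.2 (hg.antitone_snd x (sub_nonpos.1 (h.2 hD).2))
  · refine (hC x y x y').trans ?_
    rw [sub_self, abs_zero, zero_add, abs_sub_comm]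
    nlinarith [h.abs_le]

/-- `ℓ¹`-contraction of the update. The flux arguments `a`, `b` need not be the values `u`: it
suffices that their increments have the sign of those of `u` and at most twice their size. With
`u' = u (· + 1)` this bounds the total variation of reconstructed schemes. -/
lemma conservativeUpdate_l1 (hg : IsMonotoneFlux f g)
    (hC : ∀ u₁ v₁ u₂ v₂, |g u₁ v₁ - g u₂ v₂| ≤ C * (|u₁ - u₂| + |v₁ - v₂|)) (hC0 : 0 ≤ C)
    (hμ : ∀ k ∈ K, 0 ≤ μ k) (hμC : 4 * C * ∑ k ∈ K, μ k ≤ 1)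
    (ha : ∀ k ∈ K, ∀ j, SignDominated (a' k j - a k j) (u' j - u j))
    (hb : ∀ k ∈ K, ∀ j, SignDominated (b' k j - b k j) (u' j - u j))
    (hu : Summable fun j => |u' j - u j|) :
    (Summable fun j =>
      |conservativeUpdate g K μ s u' a' b' j - conservativeUpdate g K μ s u a b j|) ∧
    ∑' j, |conservativeUpdate g K μ s u' a' b' j - conservativeUpdate g K μ s u a b j|
      ≤ ∑' j, |u' j - u j| := by
  simp only [conservativeUpdate_sub u u' a b a' b']
  exact incremental_tsum_le (D := fun j => u' j - u j)
    (p := fun k j => g (a' k j) (b' k (j + s k)) - g (a k j) (b' k (j + s k)))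
    (r := fun k j => g (a k (j - s k)) (b k j) - g (a k (j - s k)) (b' k j)) hμ hu
    (fun k hk j => (fst_increment hg hC hC0 (ha k hk j)).1)
    (fun k hk j => (snd_increment hg hC hC0 (hb k hk j)).1)
    (fun k hk j => (fst_increment hg hC hC0 (ha k hk j)).2)
    (fun k hk j => (snd_increment hg hC hC0 (hb k hk j)).2) (by linarith)

/-- Without reconstruction the update is monotone. -/
lemma conservativeUpdate_mono (hg : IsMonotoneFlux f g)
    (hC : ∀ u₁ v₁ u₂ v₂, |g u₁ v₁ - g u₂ v₂| ≤ C * (|u₁ - u₂| + |v₁ - v₂|)) (hC0 : 0 ≤ C)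
    (hμ : ∀ k ∈ K, 0 ≤ μ k) (hμC : 4 * C * ∑ k ∈ K, μ k ≤ 1)
    (hu : ∀ j, u j ≤ u' j) (j : ℤ) :
    conservativeUpdate g K μ s u (fun _ => u) (fun _ => u) j
      ≤ conservativeUpdate g K μ s u' (fun _ => u') (fun _ => u') j := by
  have hs : ∀ j, SignDominated (u' j - u j) (u' j - u j) := fun j => signDominated_self _
  have hn : ∀ j, 0 ≤ u' j - u j := fun j => sub_nonneg.2 (hu j)
  rw [← sub_nonneg, conservativeUpdate_sub]
  refine incremental_nonneg (D := fun j => u' j - u j)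
    (p := fun k j => g (u' j) (u' (j + s k)) - g (u j) (u' (j + s k)))
    (r := fun k j => g (u (j - s k)) (u j) - g (u (j - s k)) (u' j)) hμ hn
    (fun k hk j => (fst_increment hg hC hC0 (hs j)).1.1 (hn j))
    (fun k hk j => (snd_increment hg hC hC0 (hs j)).1.1 (hn j)) (fun j => ?_) j
  calc _ ≤ ∑ k ∈ K, μ k * (4 * C * |u' j - u j|) :=
        Finset.sum_le_sum fun k hk => mul_le_mul_of_nonneg_left
          (by linarith [(fst_increment hg hC hC0 (hs j) (y := u' (j + s k))).2,
                (snd_increment hg hC hC0 (hs j) (x := u (j - s k))).2]) (hμ k hk)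
    _ = (4 * C * ∑ k ∈ K, μ k) * |u' j - u j| := by rw [← Finset.sum_mul]; ring
    _ ≤ 1 * |u' j - u j| := mul_le_mul_of_nonneg_right hμC (abs_nonneg _)
    _ = |u' j - u j| := one_mul _

/-- The cell entropy inequality of a monotone conservative update: `|v_j - c|` is bounded by the
difference of the updates of `u ∨ c` and `u ∧ c`. -/
lemma conservativeUpdate_entropy (hg : IsMonotoneFlux f g)
    (hC : ∀ u₁ v₁ u₂ v₂, |g u₁ v₁ - g u₂ v₂| ≤ C * (|u₁ - u₂| + |v₁ - v₂|)) (hC0 : 0 ≤ C)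
    (hμ : ∀ k ∈ K, 0 ≤ μ k) (hμC : 4 * C * ∑ k ∈ K, μ k ≤ 1) (c : ℝ) (j : ℤ) :
    |conservativeUpdate g K μ s u (fun _ => u) (fun _ => u) j - c|
      ≤ |u j - c| - ∑ k ∈ K, μ k *
        (entropyFlux g c (u j) (u (j + s k)) - entropyFlux g c (u (j - s k)) (u j)) := by
  set up : ℤ → ℝ := fun j => max (u j) c with hup
  set lo : ℤ → ℝ := fun j => min (u j) c with hlo
  have hconst : conservativeUpdate g K μ s (fun _ => c) (fun _ _ => c) (fun _ _ => c) j = c := by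
    simp [conservativeUpdate]
  have h1 := conservativeUpdate_mono (s := s) hg hC hC0 hμ hμC (u := u) (u' := up)
    (fun j => le_max_left _ _) j
  have h2 := conservativeUpdate_mono (s := s) hg hC hC0 hμ hμC (u := fun _ => c) (u' := up)
    (fun j => le_max_right _ _) j
  have h3 := conservativeUpdate_mono (s := s) hg hC hC0 hμ hμC (u := lo) (u' := u)
    (fun j => min_le_left _ _) j
  have h4 := conservativeUpdate_mono (s := s) hg hC hC0 hμ hμC (u := lo) (u' := fun _ => c)
    (fun j => min_le_right _ _) j
  rw [hconst] at h2 h4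
  have hle : |conservativeUpdate g K μ s u (fun _ => u) (fun _ => u) j - c|
      ≤ conservativeUpdate g K μ s up (fun _ => up) (fun _ => up) j
        - conservativeUpdate g K μ s lo (fun _ => lo) (fun _ => lo) j := by
    rw [abs_le]; constructor <;> linarith
  refine hle.trans (le_of_eq ?_)
  have habs : |u j - c| = up j - lo j := (max_sub_min_eq_abs' _ _).symm
  rw [habs]
  unfold conservativeUpdate entropyFlux
  have e : ∀ x y X Y : ℝ, (x - X) - (y - Y) = (x - y) - (X - Y) := fun x y X Y => by ring
  rw [e, ← Finset.sum_sub_distrib]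
  congr 1
  refine Finset.sum_congr rfl fun k _ => ?_
  simp only [hup, hlo]; ring

end Update

/-! ### Discrete total variation and `ℓ¹` bounds for the scheme -/

lemma abs_shift_tsum_le {u : ℤ → ℝ} {d : ℤ → ℝ} (hd : Summable d)
    (hu : ∀ j, |u (j + 1) - u j| ≤ d j) (s : ℕ) :
    (Summable fun j => |u (j + s) - u j|) ∧ ∑' j, |u (j + s) - u j| ≤ s * ∑' j, d j := by
  induction s with
  | zero => simp [summable_zero]
  | succ s ih =>
    have hpt : ∀ j : ℤ, |u (j + (s + 1 : ℕ)) - u j| ≤ d (j + s) + |u (j + s) - u j| := fun j => by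
      have := hu (j + s)
      push_cast
      rw [← add_assoc]
      exact (abs_sub_le _ (u (j + s)) _).trans (add_le_add_left this _)
    have hs := (summable_comp_add hd s).add ih.1
    have hS := Summable.of_nonneg_of_le (fun _ => abs_nonneg _) hpt hs
    refine ⟨hS, (hS.tsum_le_tsum hpt hs).trans ?_⟩
    rw [(summable_comp_add hd s).tsum_add ih.1, tsum_comp_add]
    push_cast
    linarith [ih.2]

/-- Flux differences over `s` cells cost at most a factor `s` in `ℓ¹`. -/
lemma flux_diff_tsum_le {g : ℝ → ℝ → ℝ} {C : ℝ} (hC0 : 0 ≤ C)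
    (hC : ∀ u₁ v₁ u₂ v₂, |g u₁ v₁ - g u₂ v₂| ≤ C * (|u₁ - u₂| + |v₁ - v₂|))
    {a b d : ℤ → ℝ} (hd : Summable d) (ha : ∀ j, |a (j + 1) - a j| ≤ d j)
    (hb : ∀ j, |b (j + 1) - b j| ≤ d j) (s : ℕ) :
    (Summable fun j => |g (a j) (b (j + s)) - g (a (j - s)) (b j)|) ∧
    ∑' j, |g (a j) (b (j + s)) - g (a (j - s)) (b j)| ≤ 2 * C * s * ∑' j, d j := by
  obtain ⟨ha1, ha2⟩ := abs_shift_tsum_le hd ha s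
  obtain ⟨hb1, hb2⟩ := abs_shift_tsum_le hd hb s
  have ha1' := summable_comp_add ha1 (-s)
  have ha2' := tsum_comp_add (fun j => |a (j + s) - a j|) (-s)
  simp only [← sub_eq_add_neg, sub_add_cancel] at ha1' ha2'
  have hs := (ha1'.add hb1).mul_left C
  have hpt : ∀ j : ℤ, |g (a j) (b (j + s)) - g (a (j - s)) (b j)|
      ≤ C * (|a j - a (j - s)| + |b (j + s) - b j|) := fun j => hC _ _ _ _
  have hS := Summable.of_nonneg_of_le (fun _ => abs_nonneg _) hpt hs
  refine ⟨hS, (hS.tsum_le_tsum hpt hs).trans ?_⟩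
  rw [tsum_mul_left, ha1'.tsum_add hb1, ha2']
  nlinarith

/-- A summable sequence tends to zero, so it is bounded by its total variation. -/
lemma abs_le_tsum_diff {u : ℤ → ℝ} (hu : Summable fun j => |u j|)
    (hd : Summable fun j => |u (j + 1) - u j|) (j : ℤ) : |u j| ≤ ∑' i, |u (i + 1) - u i| := by
  have key : ∀ n : ℕ, |u j| ≤ ∑' i, |u (i + 1) - u i| + |u (j + n)| := fun n => by
    have h1 : |u (j + n) - u j| ≤ ∑ i ∈ Finset.range n, |u (j + i + 1) - u (j + i)| := by
      have := Finset.sum_range_sub (fun i : ℕ => u (j + i)) n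
      simp only [Nat.cast_zero, add_zero, Nat.cast_add, Nat.cast_one, ← add_assoc] at this
      rw [← this]
      exact Finset.abs_sum_le_sum_abs _ _
    have h2 : ∑ i ∈ Finset.range n, |u (j + i + 1) - u (j + i)| ≤ ∑' i, |u (i + 1) - u i| := by
      have hinj : Function.Injective fun i : ℕ => j + (i : ℤ) := fun x y h => by simpa using h
      have := hd.sum_le_tsum ((Finset.range n).map ⟨_, hinj⟩) (fun _ _ => abs_nonneg _)
      simpa using this
    have h3 : |u j| ≤ |u (j + n) - u j| + |u (j + n)| := by
      have := abs_sub_abs_le_abs_sub (u j) (u (j + n))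
      rw [abs_sub_comm] at this
      linarith
    linarith
  have hlim : Tendsto (fun n : ℕ => |u (j + n)|) atTop (𝓝 0) := by
    have h0 := hu.tendsto_cofinite_zero
    have hinj : Function.Injective fun i : ℕ => j + (i : ℤ) := fun x y h => by simpa using h
    have := h0.comp hinj.tendsto_cofinite
    rwa [Nat.cofinite_eq_atTop] at this
  have := ge_of_tendsto' ((tendsto_const_nhds (x := ∑' i, |u (i + 1) - u i|)).add hlim) key
  simpa using this

/-- The coefficients `lam * W_k / max k 1` of the flux differences. The local term has index `0`
but acts on nearest neighbours, hence `max k 1`. -/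
noncomputable def coeff (ω : ℝ → ℝ) (lam dx : ℝ) (k : ℕ) : ℝ :=
  lam * weight ω dx k / (max k 1 : ℕ)

/-- The first flux arguments: reconstructed edge values for `k = 0`, cell values for `k ≥ 1`. -/
noncomputable def leftState (σ u : ℤ → ℝ) (k : ℕ) (j : ℤ) : ℝ :=
  if k = 0 then u j + σ j / 2 else u j

/-- The second flux arguments, as in `leftState`. -/
noncomputable def rightState (σ u : ℤ → ℝ) (k : ℕ) (j : ℤ) : ℝ :=
  if k = 0 then u j - σ j / 2 else u j

/-- The local part of one time step, with the reconstructed interface fluxes. -/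
noncomputable def localUpdate (g : ℝ → ℝ → ℝ) (ω : ℝ → ℝ) (lam dx : ℝ) (σ u : ℤ → ℝ) (j : ℤ) : ℝ :=
  lam * weight ω dx 0 * (interfaceFlux g σ u j - interfaceFlux g σ u (j - 1))

section Scheme

variable {g : ℝ → ℝ → ℝ} {f : ℝ → ℝ} {ω : ℝ → ℝ} {δ lam dt : ℝ} {u₀ : ℝ → ℝ} {σ u : ℕ → ℤ → ℝ}

lemma IsSchemeSolution.step_eq (h : IsSchemeSolution g ω δ (dt / lam) dt u₀ σ u) (hdt : 0 < dt)
    (hlam : 0 < lam) (n : ℕ) (j : ℤ) :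
    u (n + 1) j = u n j - localUpdate g ω lam (dt / lam) (σ n) (u n) j
      - ∑ k ∈ Finset.Icc 1 (⌊δ / (dt / lam)⌋₊ + 1), coeff ω lam (dt / lam) k *
          (g (u n j) (u n (j + k)) - g (u n (j - k)) (u n j)) := by
  rw [h.step n j, spatialOperator, mul_add, sub_add_eq_sub_sub, localUpdate, Finset.mul_sum]
  congr 1
  · congr 1; field_simp
  · refine Finset.sum_congr rfl fun k hk => ?_
    have hk1 : 1 ≤ k := (Finset.mem_Icc.1 hk).1
    have hk0 : (k : ℝ) ≠ 0 := by positivity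
    rw [coeff, max_eq_left hk1]
    field_simp

/-- The local and the nonlocal terms form a single conservative update. -/
lemma IsSchemeSolution.step_eq_conservativeUpdate
    (h : IsSchemeSolution g ω δ (dt / lam) dt u₀ σ u) (hdt : 0 < dt)
    (hlam : 0 < lam) (n : ℕ) (j : ℤ) :
    u (n + 1) j = conservativeUpdate g (Finset.range (⌊δ / (dt / lam)⌋₊ + 2))
      (coeff ω lam (dt / lam)) (fun k => (max k 1 : ℕ)) (u n)
      (leftState (σ n) (u n)) (rightState (σ n) (u n)) j := by
  rw [h.step_eq hdt hlam, conservativeUpdate, Finset.range_eq_Ico,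
    Finset.sum_eq_sum_Ico_succ_bot (by omega), sub_sub]
  congr 2
  · simp [localUpdate, coeff, leftState, rightState, interfaceFlux]
  · refine Finset.sum_congr rfl fun k hk => ?_
    have hk1 : 1 ≤ k := (Finset.mem_Icc.1 hk).1
    have hk0 : k ≠ 0 := by omega
    simp [leftState, rightState, hk0, max_eq_left hk1]

/-- The slope condition says that the increments of the edge values are dominated by those of the
cell values. -/
lemma IsSchemeSolution.leftState_diff (h : IsSchemeSolution g ω δ (dt / lam) dt u₀ σ u)
    (n k : ℕ) (j : ℤ) :
    SignDominated (leftState (σ n) (u n) k (j + 1) - leftState (σ n) (u n) k j)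
      (u n (j + 1) - u n j) := by
  unfold leftState
  split_ifs
  · have := h.slopes n j
    constructor <;> intro hD
    · rw [abs_of_nonneg hD] at this
      have := abs_le.1 this
      constructor <;> linarith
    · rw [abs_of_nonpos hD] at this
      have := abs_le.1 this
      constructor <;> linarith
  · exact signDominated_self _

lemma IsSchemeSolution.rightState_diff (h : IsSchemeSolution g ω δ (dt / lam) dt u₀ σ u)
    (n k : ℕ) (j : ℤ) :
    SignDominated (rightState (σ n) (u n) k (j + 1) - rightState (σ n) (u n) k j)
      (u n (j + 1) - u n j) := by
  unfold rightState
  split_ifs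
  · have := h.slopes n j
    constructor <;> intro hD
    · rw [abs_of_nonneg hD] at this
      have := abs_le.1 this
      constructor <;> linarith
    · rw [abs_of_nonpos hD] at this
      have := abs_le.1 this
      constructor <;> linarith
  · exact signDominated_self _

variable {C B : ℝ}

/-- The scheme is total variation diminishing. -/
lemma IsSchemeSolution.tvd (h : IsSchemeSolution g ω δ (dt / lam) dt u₀ σ u) (hdt : 0 < dt)
    (hlam : 0 < lam) (hg : IsMonotoneFlux f g)
    (hC : ∀ u₁ v₁ u₂ v₂, |g u₁ v₁ - g u₂ v₂| ≤ C * (|u₁ - u₂| + |v₁ - v₂|)) (hC0 : 0 ≤ C)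
    (hμ : ∀ k, 0 ≤ coeff ω lam (dt / lam) k)
    (hμC : 4 * C * ∑ k ∈ Finset.range (⌊δ / (dt / lam)⌋₊ + 2), coeff ω lam (dt / lam) k ≤ 1)
    (h0 : Summable fun j => |u 0 (j + 1) - u 0 j|) (hB : ∑' j, |u 0 (j + 1) - u 0 j| ≤ B) (n : ℕ) :
    (Summable fun j => |u n (j + 1) - u n j|) ∧ ∑' j, |u n (j + 1) - u n j| ≤ B := by
  induction n with
  | zero => exact ⟨h0, hB⟩
  | succ n ih =>
    -- the translate of the solution by one cell solves the same scheme
    have key := conservativeUpdate_l1 (s := fun k => ((max k 1 : ℕ) : ℤ))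
      (K := Finset.range (⌊δ / (dt / lam)⌋₊ + 2))
      (u := u n) (u' := fun j => u n (j + 1)) (a := leftState (σ n) (u n))
      (a' := fun k j => leftState (σ n) (u n) k (j + 1)) (b := rightState (σ n) (u n))
      (b' := fun k j => rightState (σ n) (u n) k (j + 1)) hg hC hC0 (fun k _ => hμ k) hμC
      (fun k _ j => h.leftState_diff n k j) (fun k _ j => h.rightState_diff n k j) ih.1
    have e : ∀ j, conservativeUpdate g (Finset.range (⌊δ / (dt / lam)⌋₊ + 2))
        (coeff ω lam (dt / lam)) (fun k => (max k 1 : ℕ)) (fun j => u n (j + 1))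
        (fun k j => leftState (σ n) (u n) k (j + 1))
        (fun k j => rightState (σ n) (u n) k (j + 1)) j = u (n + 1) (j + 1) := fun j => by
      rw [h.step_eq_conservativeUpdate hdt hlam, conservativeUpdate, conservativeUpdate]
      congr 1
      refine Finset.sum_congr rfl fun k _ => ?_
      rw [add_right_comm, sub_add_eq_add_sub]
    simp only [e, ← h.step_eq_conservativeUpdate hdt hlam] at key
    exact ⟨key.1, key.2.trans ih.2⟩

/-- The local part is small because it carries the factor `W₀`, which vanishes in the limit. -/
lemma IsSchemeSolution.localUpdate_tsum_le (h : IsSchemeSolution g ω δ (dt / lam) dt u₀ σ u)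
    (hlam : 0 < lam)
    (hC : ∀ u₁ v₁ u₂ v₂, |g u₁ v₁ - g u₂ v₂| ≤ C * (|u₁ - u₂| + |v₁ - v₂|)) (hC0 : 0 ≤ C)
    (hw : 0 ≤ weight ω (dt / lam) 0) (n : ℕ)
    (hs : Summable fun j => |u n (j + 1) - u n j|) (hB : ∑' j, |u n (j + 1) - u n j| ≤ B) :
    (Summable fun j => |localUpdate g ω lam (dt / lam) (σ n) (u n) j|) ∧
    ∑' j, |localUpdate g ω lam (dt / lam) (σ n) (u n) j|
      ≤ 4 * C * lam * B * weight ω (dt / lam) 0 := by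
  obtain ⟨h1, h2⟩ := flux_diff_tsum_le hC0 hC (a := leftState (σ n) (u n) 0)
    (b := rightState (σ n) (u n) 0) (hs.mul_left 2)
    (fun j => (h.leftState_diff n 0 j).abs_le) (fun j => (h.rightState_diff n 0 j).abs_le) 1
  have e : ∀ j, |localUpdate g ω lam (dt / lam) (σ n) (u n) j| = lam * weight ω (dt / lam) 0 *
      |g (leftState (σ n) (u n) 0 j) (rightState (σ n) (u n) 0 (j + (1 : ℕ)))
        - g (leftState (σ n) (u n) 0 (j - (1 : ℕ))) (rightState (σ n) (u n) 0 j)| := fun j => by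
    rw [localUpdate, abs_mul, abs_of_nonneg (mul_nonneg hlam.le hw)]
    simp [interfaceFlux, leftState, rightState]
  simp only [e]
  refine ⟨h1.mul_left _, ?_⟩
  rw [tsum_mul_left]
  rw [tsum_mul_left] at h2
  have : 0 ≤ lam * weight ω (dt / lam) 0 := mul_nonneg hlam.le hw
  calc _ ≤ lam * weight ω (dt / lam) 0 * (2 * C * (1 : ℕ) * (2 * B)) := by
        refine mul_le_mul_of_nonneg_left (h2.trans ?_) this
        gcongr
    _ = _ := by push_cast; ring

/-- One time step moves the solution by `O(dt)` in `L¹`: the factor `k` gained from the shift by `k`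
cells cancels the `k` in the denominator of the coefficients. -/
lemma IsSchemeSolution.time_diff_tsum_le (h : IsSchemeSolution g ω δ (dt / lam) dt u₀ σ u)
    (hdt : 0 < dt) (hlam : 0 < lam)
    (hC : ∀ u₁ v₁ u₂ v₂, |g u₁ v₁ - g u₂ v₂| ≤ C * (|u₁ - u₂| + |v₁ - v₂|)) (hC0 : 0 ≤ C)
    (hw : ∀ k, 0 ≤ weight ω (dt / lam) k)
    (hw1 : ∑ k ∈ Finset.range (⌊δ / (dt / lam)⌋₊ + 2), weight ω (dt / lam) k ≤ 1) (n : ℕ)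
    (hs : Summable fun j => |u n (j + 1) - u n j|) (hB : ∑' j, |u n (j + 1) - u n j| ≤ B) :
    (Summable fun j => |u (n + 1) j - u n j|) ∧
    ∑' j, |u (n + 1) j - u n j| ≤ 4 * C * lam * B := by
  have hB0 : 0 ≤ B := (tsum_nonneg fun _ => abs_nonneg _).trans hB
  have hk := fun k : ℕ => flux_diff_tsum_le hC0 hC (a := leftState (σ n) (u n) k)
    (b := rightState (σ n) (u n) k) (hs.mul_left 2)
    (fun j => (h.leftState_diff n k j).abs_le) (fun j => (h.rightState_diff n k j).abs_le) (max k 1)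
  have hc : ∀ k, 0 ≤ coeff ω lam (dt / lam) k := fun k =>
    div_nonneg (mul_nonneg hlam.le (hw k)) (Nat.cast_nonneg _)
  have hpt : ∀ j, |u (n + 1) j - u n j| ≤ ∑ k ∈ Finset.range (⌊δ / (dt / lam)⌋₊ + 2),
      coeff ω lam (dt / lam) k *
        |g (leftState (σ n) (u n) k j) (rightState (σ n) (u n) k (j + (max k 1 : ℕ)))
        - g (leftState (σ n) (u n) k (j - (max k 1 : ℕ))) (rightState (σ n) (u n) k j)| :=
      fun j => by
    rw [h.step_eq_conservativeUpdate hdt hlam, conservativeUpdate, sub_sub_cancel_left, abs_neg]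
    refine (Finset.abs_sum_le_sum_abs _ _).trans (Finset.sum_le_sum fun k _ => ?_)
    rw [abs_mul, abs_of_nonneg (hc k)]
  have hsum := summable_sum (s := Finset.range (⌊δ / (dt / lam)⌋₊ + 2)) fun k _ =>
    (hk k).1.mul_left (coeff ω lam (dt / lam) k)
  have hS := Summable.of_nonneg_of_le (fun _ => abs_nonneg _) hpt hsum
  refine ⟨hS, (hS.tsum_le_tsum hpt hsum).trans ?_⟩
  rw [Summable.tsum_finsetSum fun k _ => (hk k).1.mul_left _]
  calc _ ≤ ∑ k ∈ Finset.range (⌊δ / (dt / lam)⌋₊ + 2),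
        (4 * C * lam * B) * weight ω (dt / lam) k := by
        refine Finset.sum_le_sum fun k _ => ?_
        rw [tsum_mul_left]
        have h2 := (hk k).2
        rw [tsum_mul_left] at h2
        have hm : (0 : ℝ) < (max k 1 : ℕ) := by
          exact_mod_cast lt_of_lt_of_le one_pos (le_max_right k 1)
        calc _ ≤ coeff ω lam (dt / lam) k * (2 * C * (max k 1 : ℕ) * (2 * B)) := by
              refine mul_le_mul_of_nonneg_left (h2.trans ?_) (hc k)
              gcongr
          _ = _ := by unfold coeff; field_simp; ring
    _ ≤ _ := by
        rw [← Finset.mul_sum]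
        exact mul_le_of_le_one_right (by positivity) hw1

lemma IsSchemeSolution.summable (h : IsSchemeSolution g ω δ (dt / lam) dt u₀ σ u)
    (hdt : 0 < dt) (hlam : 0 < lam)
    (hC : ∀ u₁ v₁ u₂ v₂, |g u₁ v₁ - g u₂ v₂| ≤ C * (|u₁ - u₂| + |v₁ - v₂|)) (hC0 : 0 ≤ C)
    (hw : ∀ k, 0 ≤ weight ω (dt / lam) k)
    (hw1 : ∑ k ∈ Finset.range (⌊δ / (dt / lam)⌋₊ + 2), weight ω (dt / lam) k ≤ 1)
    (hs : ∀ n, (Summable fun j => |u n (j + 1) - u n j|) ∧ ∑' j, |u n (j + 1) - u n j| ≤ B)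
    (h0 : Summable fun j => |u 0 j|) (n : ℕ) : Summable fun j => |u n j| := by
  induction n with
  | zero => exact h0
  | succ n ih =>
    refine Summable.of_nonneg_of_le (fun _ => abs_nonneg _) (fun j => ?_)
      ((h.time_diff_tsum_le hdt hlam hC hC0 hw hw1 n (hs n).1 (hs n).2).1.add ih)
    simpa using abs_add_le (u (n + 1) j - u n j) (u n j)

/-- The discrete Kruzhkov inequality. Only the nonlocal part is a monotone update; the reconstructed
local fluxes enter as an error. -/
lemma IsSchemeSolution.entropy_step (h : IsSchemeSolution g ω δ (dt / lam) dt u₀ σ u)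
    (hdt : 0 < dt) (hlam : 0 < lam) (hg : IsMonotoneFlux f g)
    (hC : ∀ u₁ v₁ u₂ v₂, |g u₁ v₁ - g u₂ v₂| ≤ C * (|u₁ - u₂| + |v₁ - v₂|)) (hC0 : 0 ≤ C)
    (hμ : ∀ k, 0 ≤ coeff ω lam (dt / lam) k)
    (hμC : 4 * C * ∑ k ∈ Finset.range (⌊δ / (dt / lam)⌋₊ + 2), coeff ω lam (dt / lam) k ≤ 1)
    (c : ℝ) (n : ℕ) (j : ℤ) :
    |u (n + 1) j - c| - |u n j - c| + ∑ k ∈ Finset.Icc 1 (⌊δ / (dt / lam)⌋₊ + 1),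
        coeff ω lam (dt / lam) k *
          (entropyFlux g c (u n j) (u n (j + k)) - entropyFlux g c (u n (j - k)) (u n j))
      ≤ |localUpdate g ω lam (dt / lam) (σ n) (u n) j| := by
  have hsub : Finset.Icc 1 (⌊δ / (dt / lam)⌋₊ + 1) ⊆ Finset.range (⌊δ / (dt / lam)⌋₊ + 2) :=
    fun k hk => by
      have := (Finset.mem_Icc.1 hk).2
      exact Finset.mem_range.2 (by omega)
  have key := conservativeUpdate_entropy (K := Finset.Icc 1 (⌊δ / (dt / lam)⌋₊ + 1))
    (s := fun k : ℕ => (k : ℤ)) (u := u n) hg hC hC0 (fun k _ => hμ k)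
    (le_trans (mul_le_mul_of_nonneg_left
      (Finset.sum_le_sum_of_subset_of_nonneg hsub fun k _ _ => hμ k) (by positivity)) hμC) c j
  have e : u (n + 1) j - c = (conservativeUpdate g (Finset.Icc 1 (⌊δ / (dt / lam)⌋₊ + 1))
      (coeff ω lam (dt / lam)) (fun k : ℕ => (k : ℤ)) (u n) (fun _ => u n) (fun _ => u n) j - c)
      - localUpdate g ω lam (dt / lam) (σ n) (u n) j := by
    rw [h.step_eq hdt hlam, conservativeUpdate]; ring
  rw [e]
  linarith [abs_sub (conservativeUpdate g (Finset.Icc 1 (⌊δ / (dt / lam)⌋₊ + 1))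
      (coeff ω lam (dt / lam)) (fun k : ℕ => (k : ℤ)) (u n) (fun _ => u n) (fun _ => u n) j - c)
      (localUpdate g ω lam (dt / lam) (σ n) (u n) j)]

end Scheme

/-! ### The quadrature weights -/

lemma hat_nonneg (dx : ℝ) (i : ℕ) (h : ℝ) : 0 ≤ hat dx i h := le_max_left _ _

lemma continuous_hat (dx : ℝ) (i : ℕ) : Continuous (hat dx i) := by
  unfold hat; fun_prop

lemma hat_le_one {dx : ℝ} (hdx : 0 < dx) (i : ℕ) (h : ℝ) : hat dx i h ≤ 1 :=
  max_le zero_le_one (by linarith [div_nonneg (abs_nonneg (h - i * dx)) hdx.le])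

lemma hat_eq_zero {dx : ℝ} (hdx : 0 < dx) {i : ℕ} {h : ℝ} (hh : dx ≤ |h - i * dx|) :
    hat dx i h = 0 :=
  max_eq_left (by linarith [(one_le_div hdx).2 hh])

/-- The hat functions form a partition of unity on `[0, δ]`. -/
lemma hat_sum {δ dx : ℝ} (hdx : 0 < dx) {h : ℝ} (h0 : 0 ≤ h) (hδ : h ≤ δ) :
    ∑ k ∈ Finset.range (⌊δ / dx⌋₊ + 2), hat dx k h = 1 := by
  set i := ⌊h / dx⌋₊ with hi
  have h1 : (i : ℝ) ≤ h / dx := Nat.floor_le (by positivity)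
  have h2 : h / dx < i + 1 := Nat.lt_floor_add_one _
  have hir : i ≤ ⌊δ / dx⌋₊ := Nat.floor_mono (by gcongr)
  have h1' : i * dx ≤ h := (le_div_iff₀ hdx).1 h1
  have h2' : h < (i + 1) * dx := (div_lt_iff₀ hdx).1 h2
  have hsub : ({i, i + 1} : Finset ℕ) ⊆ Finset.range (⌊δ / dx⌋₊ + 2) := fun k hk => by
    simp only [Finset.mem_insert, Finset.mem_singleton] at hk
    exact Finset.mem_range.2 (by omega)
  rw [← Finset.sum_subset hsub, Finset.sum_pair (by omega)]
  · have e1 : hat dx i h = 1 - (h / dx - i) := by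
      rw [hat, abs_of_nonneg (by linarith), sub_div, mul_div_cancel_right₀ _ hdx.ne',
        max_eq_right (by linarith)]
    have e2 : hat dx (i + 1) h = h / dx - i := by
      rw [hat, abs_of_nonpos (by push_cast; linarith), neg_sub, sub_div,
        mul_div_cancel_right₀ _ hdx.ne']
      push_cast
      rw [max_eq_right (by linarith)]; ring
    rw [e1, e2]; ring
  · intro k _ hk
    simp only [Finset.mem_insert, Finset.mem_singleton, not_or] at hk
    refine hat_eq_zero hdx ?_
    rcases lt_or_gt_of_ne hk.1 with hlt | hgt
    · have : (k : ℝ) + 1 ≤ i := by exact_mod_cast hlt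
      refine le_trans ?_ (le_abs_self _)
      nlinarith
    · have : (i : ℝ) + 2 ≤ k := by exact_mod_cast (by omega : i + 2 ≤ k)
      refine le_trans ?_ (neg_le_abs _)
      nlinarith

section Weights

variable {δ : ℝ} {ω : ℝ → ℝ}

lemma IsInteractionKernel.integrableOn (hω : IsInteractionKernel δ ω) (hδ : 0 < δ) :
    IntegrableOn ω (Ioc 0 δ) := by
  have h := hω.integral_eq_one
  rw [intervalIntegral.integral_of_le hδ.le] at h
  -- the integral of a non-integrable function is `0` by convention
  exact Integrable.of_integral_ne_zero (by rw [h]; exact one_ne_zero)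

lemma IsInteractionKernel.setIntegral_eq_one (hω : IsInteractionKernel δ ω) (hδ : 0 < δ) :
    ∫ h in Ioc 0 δ, ω h = 1 := by
  have h := hω.integral_eq_one
  rwa [intervalIntegral.integral_of_le hδ.le] at h

lemma IsInteractionKernel.eq_zero (hω : IsInteractionKernel δ ω) {h : ℝ} (hh : δ < h) :
    ω h = 0 := by
  by_contra hne
  exact absurd (hω.support_subset (Function.mem_support.2 hne)).2 (not_le.2 hh)

/-- All weights are integrals over the common interval `(0, δ]`: a hat function vanishes outside the
interval of definition of its weight, and `ω` vanishes outside `[0, δ]`. -/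
lemma weight_eq (hω : IsInteractionKernel δ ω) {dx : ℝ} (hdx : 0 < dx) (k : ℕ) :
    weight ω dx k = ∫ h in Ioc 0 δ, hat dx k h * ω h := by
  have e : ∫ h in Ioi 0, hat dx k h * ω h = ∫ h in Ioc 0 δ, hat dx k h * ω h := by
    refine setIntegral_eq_of_subset_of_forall_sdiff_eq_zero measurableSet_Ioi
      (fun x hx => hx.1) fun x hx => ?_
    have : δ < x := by
      by_contra hc
      exact hx.2 ⟨hx.1, not_lt.1 hc⟩
    rw [hω.eq_zero this, mul_zero]
  rw [← e]
  cases k with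
  | zero =>
    rw [weight, intervalIntegral.integral_of_le hdx.le]
    refine (setIntegral_eq_of_subset_of_forall_sdiff_eq_zero measurableSet_Ioi
      (fun x hx => hx.1) fun x hx => ?_).symm
    have : dx < x := by
      by_contra hc
      exact hx.2 ⟨hx.1, not_lt.1 hc⟩
    rw [hat_eq_zero hdx, zero_mul]
    simpa using this.le.trans (le_abs_self x)
  | succ k =>
    have hk0 : (0 : ℝ) ≤ k * dx := by positivity
    rw [weight, intervalIntegral.integral_of_le (by nlinarith)]
    refine (setIntegral_eq_of_subset_of_forall_sdiff_eq_zero measurableSet_Ioi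
      (fun x hx => lt_of_le_of_lt hk0 hx.1) fun x hx => ?_).symm
    rw [hat_eq_zero hdx, zero_mul]
    push_cast
    by_contra hc
    rw [not_le, abs_lt] at hc
    exact hx.2 ⟨by linarith, by linarith⟩

lemma weight_nonneg (hω : IsInteractionKernel δ ω) {dx : ℝ} (hdx : 0 < dx) (k : ℕ) :
    0 ≤ weight ω dx k := by
  rw [weight_eq hω hdx]
  exact integral_nonneg fun h => mul_nonneg (hat_nonneg _ _ _) (hω.nonneg h)

lemma hat_mul_integrableOn (hω : IsInteractionKernel δ ω) (hδ : 0 < δ) {dx : ℝ} (hdx : 0 < dx)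
    (k : ℕ) : IntegrableOn (fun h => hat dx k h * ω h) (Ioc 0 δ) :=
  (hω.integrableOn hδ).bdd_mul (c := 1) (continuous_hat dx k).aestronglyMeasurable
    (ae_of_all _ fun h => by
      rw [Real.norm_of_nonneg (hat_nonneg _ _ _)]; exact hat_le_one hdx k h)

lemma sum_weight_mul (hω : IsInteractionKernel δ ω) (hδ : 0 < δ) {dx : ℝ} (hdx : 0 < dx)
    (K : Finset ℕ) (a : ℕ → ℝ) :
    ∑ k ∈ K, weight ω dx k * a k = ∫ h in Ioc 0 δ, (∑ k ∈ K, hat dx k h * a k) * ω h := by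
  simp_rw [Finset.sum_mul]
  rw [integral_finsetSum]
  · refine Finset.sum_congr rfl fun k _ => ?_
    rw [weight_eq hω hdx, ← integral_mul_const]
    exact integral_congr_ae (ae_of_all _ fun h => by ring)
  · intro k _
    exact ((hat_mul_integrableOn hω hδ hdx k).mul_const (a k)).congr
      (ae_of_all _ fun h => by ring)

lemma sum_weight (hω : IsInteractionKernel δ ω) (hδ : 0 < δ) {dx : ℝ} (hdx : 0 < dx) :
    ∑ k ∈ Finset.range (⌊δ / dx⌋₊ + 2), weight ω dx k = 1 := by
  have := sum_weight_mul hω hδ hdx (Finset.range (⌊δ / dx⌋₊ + 2)) (fun _ => 1)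
  simp only [mul_one] at this
  rw [this, ← hω.setIntegral_eq_one hδ]
  refine setIntegral_congr_fun measurableSet_Ioc fun h hh => ?_
  simp only [hat_sum hdx hh.1.le hh.2, one_mul]

/-- The mass that the hat functions at the nodes `k * dx` put on the interactions, damped by the
factor `1 / k`, disappears in the limit `dx → 0`: at a fixed distance `h` only nodes with
`k ≥ h / dx - 1` contribute. -/
lemma tendsto_sum_weight_div (hω : IsInteractionKernel δ ω) (hδ : 0 < δ) :
    Tendsto (fun dx : ℝ => ∑ k ∈ Finset.range (⌊δ / dx⌋₊ + 2), weight ω dx k / (max k 1 : ℕ))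
      (𝓝[>] 0) (𝓝 0) := by
  have hpos : ∀ᶠ dx : ℝ in 𝓝[>] 0, 0 < dx := eventually_mem_nhdsWithin
  have e : (fun dx : ℝ => ∫ h in Ioc 0 δ, (∑ k ∈ Finset.range (⌊δ / dx⌋₊ + 2),
      hat dx k h * (1 / (max k 1 : ℕ))) * ω h) =ᶠ[𝓝[>] 0] (fun dx : ℝ =>
        ∑ k ∈ Finset.range (⌊δ / dx⌋₊ + 2), weight ω dx k / (max k 1 : ℕ)) := by
    filter_upwards [hpos] with dx hdx
    rw [← sum_weight_mul hω hδ hdx]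
    exact Finset.sum_congr rfl fun k _ => by rw [mul_one_div]
  refine Tendsto.congr' e ?_
  rw [show 𝓝 (0 : ℝ) = 𝓝 (∫ h in Ioc 0 δ, 0 * ω h) by simp]
  have hnn : ∀ (dx h : ℝ), 0 ≤ ∑ k ∈ Finset.range (⌊δ / dx⌋₊ + 2),
      hat dx k h * (1 / (max k 1 : ℕ)) := fun dx h =>
    Finset.sum_nonneg fun k _ => mul_nonneg (hat_nonneg _ _ _) (by positivity)
  refine tendsto_integral_filter_of_dominated_convergence ω ?_ ?_ (hω.integrableOn hδ) ?_
  · filter_upwards with dx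
    refine AEStronglyMeasurable.mul (Continuous.aestronglyMeasurable ?_)
      (hω.integrableOn hδ).aestronglyMeasurable
    exact continuous_finsetSum _ fun k _ => (continuous_hat dx k).mul continuous_const
  · filter_upwards [hpos] with dx hdx
    refine (ae_restrict_iff' measurableSet_Ioc).2 (ae_of_all _ fun h hh => ?_)
    rw [norm_mul, Real.norm_of_nonneg (hnn dx h), Real.norm_of_nonneg (hω.nonneg h)]
    refine mul_le_of_le_one_left (hω.nonneg h) ?_
    refine le_trans (Finset.sum_le_sum fun k _ => ?_) (hat_sum hdx hh.1.le hh.2).le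
    refine mul_le_of_le_one_right (hat_nonneg _ _ _) ?_
    rw [div_le_one (by positivity)]
    exact_mod_cast le_max_right k 1
  · refine (ae_restrict_iff' measurableSet_Ioc).2 (ae_of_all _ fun h hh => ?_)
    refine Tendsto.mul_const _ ?_
    have hb : Tendsto (fun dx : ℝ => dx / (h - dx)) (𝓝[>] 0) (𝓝 0) := by
      have : Tendsto (fun dx : ℝ => dx / (h - dx)) (𝓝 0) (𝓝 (0 / (h - 0))) :=
        tendsto_id.div (tendsto_const_nhds.sub tendsto_id) (by simpa using hh.1.ne')
      simpa using this.mono_left nhdsWithin_le_nhds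
    refine squeeze_zero' (Eventually.of_forall fun dx => hnn dx h) ?_ hb
    have hlt : ∀ᶠ dx : ℝ in 𝓝[>] 0, dx < h :=
      (eventually_lt_nhds hh.1).filter_mono nhdsWithin_le_nhds
    filter_upwards [hpos, hlt] with dx hdx hdxh
    have e1 : dx / (h - dx)
        = ∑ k ∈ Finset.range (⌊δ / dx⌋₊ + 2), hat dx k h * (dx / (h - dx)) := by
      rw [← Finset.sum_mul, hat_sum hdx hh.1.le hh.2, one_mul]
    rw [e1]
    refine Finset.sum_le_sum fun k _ => ?_
    by_cases hk : dx ≤ |h - k * dx|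
    · rw [hat_eq_zero hdx hk]; simp
    · refine mul_le_mul_of_nonneg_left ?_ (hat_nonneg _ _ _)
      have h1 := (abs_lt.1 (not_le.1 hk)).2
      have h2 : (k : ℝ) ≤ (max k 1 : ℕ) := by exact_mod_cast le_max_left k 1
      have h3 : (0 : ℝ) < (max k 1 : ℕ) := by
        exact_mod_cast lt_of_lt_of_le one_pos (le_max_right k 1)
      rw [div_le_div_iff₀ h3 (by linarith)]
      nlinarith

/-- The weight of the local term vanishes in the limit: `ω` is integrable, so that it puts little
mass near `0`. -/
lemma tendsto_weight_zero (hω : IsInteractionKernel δ ω) (hδ : 0 < δ) :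
    Tendsto (fun dx : ℝ => weight ω dx 0) (𝓝[>] 0) (𝓝 0) := by
  refine tendsto_of_tendsto_of_tendsto_of_le_of_le' tendsto_const_nhds
    (tendsto_sum_weight_div hω hδ) ?_ ?_
  · filter_upwards [eventually_mem_nhdsWithin] with dx hdx
    exact weight_nonneg hω hdx 0
  · filter_upwards [eventually_mem_nhdsWithin] with dx hdx
    have := Finset.single_le_sum (s := Finset.range (⌊δ / dx⌋₊ + 2))
      (f := fun k => weight ω dx k / (max k 1 : ℕ))
      (fun k _ => div_nonneg (weight_nonneg hω hdx k) (Nat.cast_nonneg _))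
      (Finset.mem_range.2 (by omega : 0 < ⌊δ / dx⌋₊ + 2))
    simpa using this

/-- The total weight of the flux differences in one time step becomes arbitrarily small, although
`dt / dx` is fixed. -/
lemma tendsto_sum_coeff (hω : IsInteractionKernel δ ω) (hδ : 0 < δ) (lam : ℝ) :
    Tendsto (fun dx : ℝ => ∑ k ∈ Finset.range (⌊δ / dx⌋₊ + 2), coeff ω lam dx k)
      (𝓝[>] 0) (𝓝 0) := by
  have := (tendsto_sum_weight_div hω hδ).const_mul lam
  rw [mul_zero] at this
  refine this.congr fun dx => ?_
  rw [Finset.mul_sum]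
  exact Finset.sum_congr rfl fun k _ => by rw [coeff, mul_div_assoc]

end Weights

/-! ### Piecewise constant functions and `L¹` moduli of translation -/

/-- The `L¹` modulus of translation of `w` is at most `B * |h|`. For integrable `w` this says that
the essential total variation of `w` is at most `B`. -/
def TranslationBound (B : ℝ) (w : ℝ → ℝ) : Prop :=
  ∀ h : ℝ, ∫⁻ x, ‖w (x + h) - w x‖ₑ ≤ ENNReal.ofReal (B * |h|)

lemma TranslationBound.of_nonneg {B : ℝ} {w : ℝ → ℝ}
    (hw : ∀ h : ℝ, 0 ≤ h → ∫⁻ x, ‖w (x + h) - w x‖ₑ ≤ ENNReal.ofReal (B * h)) :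
    TranslationBound B w := fun h => by
  rcases le_total 0 h with h0 | h0
  · rw [abs_of_nonneg h0]; exact hw h h0
  · rw [abs_of_nonpos h0, ← lintegral_add_right_eq_self _ (-h)]
    simp only [neg_add_cancel_right]
    refine le_trans (le_of_eq (lintegral_congr fun x => ?_)) (hw (-h) (by linarith))
    exact enorm_sub_rev _ _

lemma measurable_cellIndex (dx : ℝ) : Measurable fun x : ℝ => ⌊x / dx + 1 / 2⌋ :=
  Int.measurable_floor.comp (by fun_prop)

lemma volume_cell {dx : ℝ} (hdx : 0 < dx) (j : ℤ) :
    volume {x : ℝ | ⌊x / dx + 1 / 2⌋ = j} = ENNReal.ofReal dx := by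
  have : {x : ℝ | ⌊x / dx + 1 / 2⌋ = j} = Ico ((j - 1 / 2) * dx) ((j + 1 / 2) * dx) := by
    ext x
    rw [mem_ofPred_eq, Int.floor_eq_iff, mem_Ico, ← le_div_iff₀ hdx, ← div_lt_iff₀ hdx]
    constructor <;> rintro ⟨h1, h2⟩ <;> constructor <;> linarith
  rw [this, Real.volume_Ico]
  congr 1; ring

lemma lintegral_cell (f : ℤ → ℝ≥0∞) {dx : ℝ} (hdx : 0 < dx) :
    ∫⁻ x : ℝ, f ⌊x / dx + 1 / 2⌋ = ENNReal.ofReal dx * ∑' j, f j := by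
  rw [← lintegral_map (f := f) (measurable_of_countable _) (measurable_cellIndex dx),
    lintegral_countable', ← ENNReal.tsum_mul_left]
  refine tsum_congr fun j => ?_
  rw [Measure.map_apply (measurable_cellIndex dx) (measurableSet_singleton j), mul_comm]
  congr 1
  exact volume_cell hdx j

lemma enorm_sub_le_sum_Ico (a : ℤ → ℝ) {p q : ℤ} (hpq : p ≤ q) :
    ‖a q - a p‖ₑ ≤ ∑ j ∈ Finset.Ico p q, ‖a (j + 1) - a j‖ₑ := by
  induction q, hpq using Int.leInduction with
  | base => simp
  | succ q hpq ih =>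
    rw [← Finset.insert_Ico_right_eq_Ico_add_one hpq, Finset.sum_insert (by simp)]
    calc ‖a (q + 1) - a p‖ₑ = ‖(a (q + 1) - a q) + (a q - a p)‖ₑ := by congr 1; ring
      _ ≤ _ := (enorm_add_le _ _).trans (add_le_add_right ih _)

/-- A step function obeys a translation bound: under a shift by `h` each jump contributes on a set
of measure `h`. -/
lemma translationBound_cell {a : ℤ → ℝ} {B : ℝ}
    (ha : ∑' j, ‖a (j + 1) - a j‖ₑ ≤ ENNReal.ofReal B) {dx : ℝ} (hdx : 0 < dx) :
    TranslationBound B fun x => a ⌊x / dx + 1 / 2⌋ := by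
  refine .of_nonneg fun h hh => ?_
  -- the points that are carried across the right end of cell `j` by the shift
  set S : ℤ → Set ℝ := fun j => Ico ((j + 1 / 2) * dx - h) ((j + 1 / 2) * dx)
  have hmem : ∀ (j : ℤ) (x : ℝ), x ∈ S j ↔
      ⌊x / dx + 1 / 2⌋ ≤ j ∧ j < ⌊(x + h) / dx + 1 / 2⌋ := fun j x => by
    rw [← Int.lt_add_one_iff, Int.floor_lt, ← Int.add_one_le_iff, Int.le_floor]
    push_cast
    rw [mem_Ico, sub_le_iff_le_add, ← le_div_iff₀ hdx, ← div_lt_iff₀ hdx]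
    constructor <;> rintro ⟨h1, h2⟩ <;> constructor <;> linarith
  calc ∫⁻ x, ‖a ⌊(x + h) / dx + 1 / 2⌋ - a ⌊x / dx + 1 / 2⌋‖ₑ
      ≤ ∫⁻ x, ∑' j, (S j).indicator (fun _ => ‖a (j + 1) - a j‖ₑ) x := by
        refine lintegral_mono fun x => ?_
        have hle : ⌊x / dx + 1 / 2⌋ ≤ ⌊(x + h) / dx + 1 / 2⌋ :=
          Int.floor_mono (by gcongr; linarith)
        refine (enorm_sub_le_sum_Ico a hle).trans ?_
        refine le_trans (le_of_eq ?_) (ENNReal.sum_le_tsum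
          (Finset.Ico ⌊x / dx + 1 / 2⌋ ⌊(x + h) / dx + 1 / 2⌋))
        refine Finset.sum_congr rfl fun j hj => ?_
        rw [indicator_of_mem ((hmem j x).2 (Finset.mem_Ico.1 hj))]
    _ = ∑' j, ‖a (j + 1) - a j‖ₑ * ENNReal.ofReal h := by
        rw [lintegral_tsum fun j => (measurable_const.indicator measurableSet_Ico).aemeasurable]
        refine tsum_congr fun j => ?_
        rw [lintegral_indicator_const measurableSet_Ico, Real.volume_Ico]
        congr 2; ring
    _ ≤ ENNReal.ofReal B * ENNReal.ofReal h := by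
        rw [ENNReal.tsum_mul_right]; gcongr
    _ = ENNReal.ofReal (B * h) := (ENNReal.ofReal_mul' hh).symm

lemma lintegral_eq_tsum_Ioc (F : ℝ → ℝ≥0∞) (a : ℝ) {p : ℝ} (hp : 0 < p) :
    ∫⁻ x, F x = ∑' n : ℤ, ∫⁻ x in Ioc (a + n * p) (a + (n + 1) * p), F x := by
  have h1 := iUnion_Ioc_add_zsmul hp a
  have h2 := pairwise_disjoint_Ioc_add_zsmul a p
  rw [← setLIntegral_univ, ← h1, lintegral_iUnion (fun _ => measurableSet_Ioc) h2]
  simp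

lemma setLIntegral_Ioc_add (F : ℝ → ℝ≥0∞) (a b c : ℝ) :
    ∫⁻ x in Ioc (a + c) (b + c), F x = ∫⁻ x in Ioc a b, F (x + c) := by
  have := (measurePreserving_add_right volume c).setLIntegral_comp_preimage_emb
    (measurableEmbedding_addRight c) F (Ioc (a + c) (b + c))
  rw [← this]
  simp

/-- A function of bounded variation obeys a translation bound: splitting the line into intervals of
length `h` turns the integral into an average of sums of increments along arithmetic
progressions, each of which is at most the total variation. -/
lemma BoundedVariationOn.translationBound {w : ℝ → ℝ} (hw : BoundedVariationOn w univ)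
    (hm : AEMeasurable w) : TranslationBound (eVariationOn w univ).toReal w := by
  refine .of_nonneg fun h hh => ?_
  rcases hh.eq_or_lt with rfl | hh
  · simp
  have hm' : ∀ c : ℝ, AEMeasurable fun x => w (x + c) := fun c =>
    hm.comp_quasiMeasurePreserving (measurePreserving_add_right volume c).quasiMeasurePreserving
  have key : ∀ x : ℝ, ∑' n : ℤ, ‖w (x + n * h + h) - w (x + n * h)‖ₑ ≤ eVariationOn w univ := by
    intro x
    rw [ENNReal.tsum_eq_iSup_sum]
    refine iSup_le fun F => ?_
    -- a finite set of integers lies in `[-N, N)`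
    set N : ℕ := F.sup Int.natAbs + 1 with hN
    have hinj : Function.Injective fun i : ℕ => (i : ℤ) - N := fun a b hab => by simpa using hab
    have hsub : F ⊆ (Finset.range (2 * N)).map ⟨_, hinj⟩ := fun j hj => by
      have : j.natAbs ≤ F.sup Int.natAbs := Finset.le_sup hj
      simp only [Finset.mem_map, Finset.mem_range, Function.Embedding.coeFn_mk]
      exact ⟨(j + N).toNat, by omega, by omega⟩
    refine (Finset.sum_le_sum_of_subset hsub).trans ?_
    rw [Finset.sum_map]
    refine le_trans (le_of_eq (Finset.sum_congr rfl fun i _ => ?_))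
      (eVariationOn.sum_le (f := w) (s := univ) (n := 2 * N) (u := fun i : ℕ => x + (i - N) * h)
        (fun a b hab => ?_) fun _ => mem_univ _)
    · rw [edist_eq_enorm_sub]
      simp only [Function.Embedding.coeFn_mk]
      push_cast
      congr 3
      ring
    · have : (a : ℝ) ≤ b := by exact_mod_cast hab
      simp only
      gcongr
  calc ∫⁻ x, ‖w (x + h) - w x‖ₑ
      = ∑' n : ℤ, ∫⁻ x in Ioc 0 h, ‖w (x + n * h + h) - w (x + n * h)‖ₑ := by
        rw [lintegral_eq_tsum_Ioc _ 0 hh]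
        refine tsum_congr fun n => ?_
        rw [← setLIntegral_Ioc_add (fun x => ‖w (x + h) - w x‖ₑ)]
        congr 3; ring
    _ = ∫⁻ x in Ioc 0 h, ∑' n : ℤ, ‖w (x + n * h + h) - w (x + n * h)‖ₑ := by
        refine (lintegral_tsum fun n => ?_).symm
        refine AEMeasurable.restrict ?_
        have := (hm' (n * h + h)).sub (hm' (n * h))
        simp only [← add_assoc] at this
        exact this.enorm
    _ ≤ ∫⁻ x in Ioc 0 h, eVariationOn w univ := lintegral_mono key
    _ = ENNReal.ofReal ((eVariationOn w univ).toReal * h) := by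
        rw [setLIntegral_const, Real.volume_Ioc, sub_zero, ENNReal.ofReal_mul ENNReal.toReal_nonneg,
          ENNReal.ofReal_toReal hw]

lemma MemL1BV.exists_translationBound {u₀ : ℝ → ℝ} (h : MemL1BV u₀) :
    ∃ B : ℝ, 0 ≤ B ∧ TranslationBound B u₀ := by
  obtain ⟨hi, w, hw, hbv⟩ := h
  refine ⟨_, ENNReal.toReal_nonneg, fun t => le_trans (le_of_eq (lintegral_congr_ae ?_))
    (BoundedVariationOn.translationBound hbv (hi.aemeasurable.congr hw) t)⟩
  filter_upwards [hw, (measurePreserving_add_right volume t).quasiMeasurePreserving.ae_eq_comp hw]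
    with x h1 h2
  simp only [Function.comp] at h2
  rw [h1, h2]

/-! ### Cell averages of the initial datum -/

/-- The cell averages of `u₀`. -/
noncomputable def cellAverage (u₀ : ℝ → ℝ) (dx : ℝ) (j : ℤ) : ℝ :=
  1 / dx * ∫ x in ((j - 1 / 2) * dx : ℝ)..((j + 1 / 2) * dx), u₀ x

section CellAverage

variable {u₀ : ℝ → ℝ} {dx B : ℝ}

lemma cell_le (hdx : 0 < dx) (j : ℤ) : ((j : ℝ) - 1 / 2) * dx ≤ (j + 1 / 2) * dx := by nlinarith

lemma tsum_setLIntegral_cell (hdx : 0 < dx) (F : ℝ → ℝ≥0∞) :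
    ∑' j : ℤ, ∫⁻ x in Ioc ((j - 1 / 2) * dx) ((j + 1 / 2) * dx), F x = ∫⁻ x, F x := by
  rw [lintegral_eq_tsum_Ioc F (-(1 / 2) * dx) hdx]
  refine tsum_congr fun j => ?_
  congr 3 <;> ring

lemma tsum_enorm_cellAverage_le (hdx : 0 < dx) :
    ENNReal.ofReal dx * ∑' j, ‖cellAverage u₀ dx j‖ₑ ≤ ∫⁻ x, ‖u₀ x‖ₑ := by
  rw [← ENNReal.tsum_mul_left, ← tsum_setLIntegral_cell hdx]
  refine ENNReal.tsum_le_tsum fun j => ?_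
  rw [cellAverage, enorm_mul, Real.enorm_of_nonneg (by positivity), ← mul_assoc,
    ← ENNReal.ofReal_mul hdx.le, mul_one_div_cancel hdx.ne', ENNReal.ofReal_one, one_mul,
    intervalIntegral.integral_of_le (cell_le hdx j)]
  exact enorm_integral_le_lintegral_enorm _

/-- The variation of the cell averages is controlled by the translation bound for the shift `dx`. -/
lemma tsum_enorm_cellAverage_sub_le (hu : Integrable u₀) (hdx : 0 < dx)
    (hB : TranslationBound B u₀) :
    ∑' j, ‖cellAverage u₀ dx (j + 1) - cellAverage u₀ dx j‖ₑ ≤ ENNReal.ofReal B := by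
  have h : ENNReal.ofReal dx * ∑' j, ‖cellAverage u₀ dx (j + 1) - cellAverage u₀ dx j‖ₑ
      ≤ ENNReal.ofReal dx * ENNReal.ofReal B := by
    rw [← ENNReal.ofReal_mul hdx.le, mul_comm dx B]
    refine le_trans ?_ ((hB dx).trans (by rw [abs_of_pos hdx]))
    rw [← ENNReal.tsum_mul_left, ← tsum_setLIntegral_cell hdx]
    refine ENNReal.tsum_le_tsum fun j => ?_
    have e : cellAverage u₀ dx (j + 1) - cellAverage u₀ dx j
        = 1 / dx * ∫ x in Ioc ((j - 1 / 2) * dx) ((j + 1 / 2) * dx), (u₀ (x + dx) - u₀ x) := by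
      rw [cellAverage, cellAverage, ← mul_sub, ← intervalIntegral.integral_of_le (cell_le hdx j),
        intervalIntegral.integral_sub, intervalIntegral.integral_comp_add_right]
      · push_cast
        congr 4 <;> ring
      · exact (hu.comp_add_right dx).intervalIntegrable
      · exact hu.intervalIntegrable
    rw [e, enorm_mul, Real.enorm_of_nonneg (by positivity), ← mul_assoc,
      ← ENNReal.ofReal_mul hdx.le, mul_one_div_cancel hdx.ne', ENNReal.ofReal_one, one_mul]
    exact enorm_integral_le_lintegral_enorm _
  exact (ENNReal.mul_le_mul_iff_right (by simpa using hdx) ENNReal.ofReal_ne_top).1 h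

/-- Cell averages converge in `L¹`, with a rate: on its cell the average differs from `u₀ x` by the
mean of `u₀ (x + s) - u₀ x` over shifts `|s| ≤ dx`. -/
lemma lintegral_cellAverage_sub_le (hm : Measurable u₀) (hu : Integrable u₀) (hdx : 0 < dx)
    (hB0 : 0 ≤ B) (hB : TranslationBound B u₀) :
    ∫⁻ x, ‖cellAverage u₀ dx ⌊x / dx + 1 / 2⌋ - u₀ x‖ₑ ≤ ENNReal.ofReal (2 * B * dx) := by
  have hpt : ∀ x, ‖cellAverage u₀ dx ⌊x / dx + 1 / 2⌋ - u₀ x‖ₑ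
      ≤ ENNReal.ofReal (1 / dx) * ∫⁻ s in Icc (-dx) dx, ‖u₀ (x + s) - u₀ x‖ₑ := fun x => by
    set j := ⌊x / dx + 1 / 2⌋ with hj
    have h1 : (j - 1 / 2) * dx ≤ x := by
      rw [← le_div_iff₀ hdx]; linarith [Int.floor_le (x / dx + 1 / 2)]
    have h2 : x < (j + 1 / 2) * dx := by
      rw [← div_lt_iff₀ hdx]; linarith [Int.lt_floor_add_one (x / dx + 1 / 2)]
    have e : cellAverage u₀ dx j - u₀ x
        = 1 / dx * ∫ y in Ioc ((j - 1 / 2) * dx) ((j + 1 / 2) * dx), (u₀ y - u₀ x) := by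
      rw [cellAverage, ← intervalIntegral.integral_of_le (cell_le hdx j),
        intervalIntegral.integral_sub hu.intervalIntegrable (by simp),
        intervalIntegral.integral_const, smul_eq_mul]
      field_simp; ring
    rw [e, enorm_mul, Real.enorm_of_nonneg (by positivity)]
    gcongr
    refine (enorm_integral_le_lintegral_enorm _).trans ?_
    have e2 : ∫⁻ y in Ioc ((j - 1 / 2) * dx) ((j + 1 / 2) * dx), ‖u₀ y - u₀ x‖ₑ
        = ∫⁻ s in Ioc ((j - 1 / 2) * dx - x) ((j + 1 / 2) * dx - x), ‖u₀ (s + x) - u₀ x‖ₑ := by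
      rw [← setLIntegral_Ioc_add (fun y => ‖u₀ y - u₀ x‖ₑ)]
      simp
    rw [e2]
    simp_rw [add_comm x]
    refine lintegral_mono_set fun s hs => ⟨?_, ?_⟩ <;> linarith [hs.1, hs.2]
  calc _ ≤ ∫⁻ x, ENNReal.ofReal (1 / dx) * ∫⁻ s in Icc (-dx) dx, ‖u₀ (x + s) - u₀ x‖ₑ :=
        lintegral_mono hpt
    _ = ENNReal.ofReal (1 / dx) * ∫⁻ s in Icc (-dx) dx, ∫⁻ x, ‖u₀ (x + s) - u₀ x‖ₑ := by
        rw [lintegral_const_mul' _ _ ENNReal.ofReal_ne_top, lintegral_lintegral_swap]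
        exact Measurable.aemeasurable (by fun_prop)
    _ ≤ ENNReal.ofReal (1 / dx) * ∫⁻ s in Icc (-dx) dx, ENNReal.ofReal (B * dx) := by
        refine mul_le_mul_right (setLIntegral_mono measurable_const fun s hs => (hB s).trans ?_) _
        exact ENNReal.ofReal_le_ofReal (mul_le_mul_of_nonneg_left (abs_le.2 hs) hB0)
    _ = ENNReal.ofReal (2 * B * dx) := by
        rw [setLIntegral_const, Real.volume_Icc, ← ENNReal.ofReal_mul (by positivity),
          ← ENNReal.ofReal_mul (by positivity)]
        congr 1; field_simp; ring

end CellAverage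

/-! ### A finite reference measure for local convergence -/

/-- The standard Gaussian measure. On bounded sequences, convergence in `L¹` of this finite measure
is the same as local convergence in `L¹(ℝ)`. -/
noncomputable abbrev gauss : Measure ℝ := ProbabilityTheory.gaussianReal 0 1

lemma gauss_le_volume : gauss ≤ volume := by
  rw [gauss, ProbabilityTheory.gaussianReal_of_var_ne_zero _ one_ne_zero]
  conv_rhs => rw [← withDensity_one (μ := (volume : Measure ℝ))]
  refine withDensity_mono (ae_of_all _ fun x => ?_)
  rw [ProbabilityTheory.gaussianPDF, ProbabilityTheory.gaussianPDFReal, Pi.one_apply,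
    ENNReal.ofReal_le_one]
  have h1 : (1 : ℝ) ≤ √(2 * Real.pi * (1 : NNReal)) := by
    rw [Real.one_le_sqrt]; push_cast; nlinarith [Real.pi_gt_three]
  have h2 : Real.exp (-(x - 0) ^ 2 / (2 * (1 : NNReal))) ≤ 1 := by
    rw [Real.exp_le_one_iff]; push_cast
    have := sq_nonneg (x - 0)
    linarith
  exact mul_le_one₀ (inv_le_one_of_one_le₀ h1) (Real.exp_nonneg _) h2

lemma volume_absolutelyContinuous_gauss : (volume : Measure ℝ) ≪ gauss :=
  ProbabilityTheory.gaussianReal_absolutelyContinuous' 0 one_ne_zero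

lemma exists_volume_restrict_le_gauss (R : ℝ) :
    ∃ c : ℝ≥0∞, c ≠ ∞ ∧ (volume : Measure ℝ).restrict (Icc (-R) R) ≤ c • gauss := by
  set m : ℝ := (√(2 * Real.pi * (1 : NNReal)))⁻¹ * Real.exp (-R ^ 2 / (2 * (1 : NNReal))) with hm
  have hm0 : 0 < m := by positivity
  refine ⟨ENNReal.ofReal m⁻¹, ENNReal.ofReal_ne_top, Measure.le_iff.2 fun s hs => ?_⟩
  have hpdf : ∀ x ∈ Icc (-R) R, 1 ≤ ENNReal.ofReal m⁻¹ * ProbabilityTheory.gaussianPDF 0 1 x := by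
    intro x hx
    rw [ProbabilityTheory.gaussianPDF, ← ENNReal.ofReal_mul (by positivity), ENNReal.one_le_ofReal,
      inv_mul_eq_div, one_le_div hm0, hm, ProbabilityTheory.gaussianPDFReal]
    have := sq_le_sq' hx.1 hx.2
    rw [sub_zero]
    refine mul_le_mul_of_nonneg_left (Real.exp_le_exp.2 ?_) (by positivity)
    exact div_le_div_of_nonneg_right (neg_le_neg this) (by positivity)
  rw [Measure.restrict_apply hs, Measure.smul_apply, smul_eq_mul, gauss,
    ProbabilityTheory.gaussianReal_of_var_ne_zero _ one_ne_zero, withDensity_apply _ hs,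
    ← lintegral_const_mul _ (ProbabilityTheory.measurable_gaussianPDF 0 1), ← setLIntegral_one]
  calc ∫⁻ _ in s ∩ Icc (-R) R, 1
      ≤ ∫⁻ x in s ∩ Icc (-R) R, ENNReal.ofReal m⁻¹ * ProbabilityTheory.gaussianPDF 0 1 x :=
        setLIntegral_mono ((ProbabilityTheory.measurable_gaussianPDF 0 1).const_mul _)
          fun x hx => hpdf x hx.2
    _ ≤ _ := lintegral_mono_set inter_subset_left

/-! ### Compactness -/

lemma TranslationBound.sub {B B' : ℝ} {v w : ℝ → ℝ} (hB : 0 ≤ B) (hB' : 0 ≤ B')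
    (hv : Measurable v)
    (h : TranslationBound B v) (h' : TranslationBound B' w) :
    TranslationBound (B + B') fun x => v x - w x := fun t => by
  calc ∫⁻ x, ‖v (x + t) - w (x + t) - (v x - w x)‖ₑ
      ≤ ∫⁻ x, (‖v (x + t) - v x‖ₑ + ‖w (x + t) - w x‖ₑ) := by
        refine lintegral_mono fun x => ?_
        rw [sub_sub_sub_comm]
        exact enorm_sub_le
    _ = (∫⁻ x, ‖v (x + t) - v x‖ₑ) + ∫⁻ x, ‖w (x + t) - w x‖ₑ :=
        lintegral_add_left (by fun_prop) _
    _ ≤ ENNReal.ofReal (B * |t|) + ENNReal.ofReal (B' * |t|) := add_le_add (h t) (h' t)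
    _ = _ := by rw [← ENNReal.ofReal_add (by positivity) (by positivity), add_mul]

lemma intervalIntegrable_of_abs_le {w : ℝ → ℝ} {M : ℝ} (hw : Measurable w) (hM : ∀ x, |w x| ≤ M)
    (a b : ℝ) : IntervalIntegrable w volume a b :=
  (intervalIntegrable_const (c := M)).mono_fun hw.aestronglyMeasurable
    (ae_of_all _ fun x => (hM x).trans (le_abs_self _))

/-- A translation bound controls the distance of a function to its sliding averages. -/
lemma lintegral_gauss_le_sliding_average {B M : ℝ} {w : ℝ → ℝ} (hB : 0 ≤ B) (hw : Measurable w)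
    (hM : ∀ x, |w x| ≤ M) (h : TranslationBound B w) {η : ℝ} (hη : 0 < η) :
    ∫⁻ x, ‖w x‖ₑ ∂gauss
      ≤ ENNReal.ofReal (B * η) + ∫⁻ x, ‖1 / η * ∫ y in x..(x + η), w y‖ₑ ∂gauss := by
  have hint := intervalIntegrable_of_abs_le hw hM
  have hpt : ∀ x, ‖w x‖ₑ ≤ ENNReal.ofReal (1 / η) * (∫⁻ s in Ioc 0 η, ‖w (x + s) - w x‖ₑ)
      + ‖1 / η * ∫ y in x..(x + η), w y‖ₑ := fun x => by
    have e : w x = -(1 / η * ∫ s in (0 : ℝ)..η, (w (x + s) - w x))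
        + 1 / η * ∫ y in x..(x + η), w y := by
      rw [intervalIntegral.integral_sub _ (by simp), intervalIntegral.integral_const,
        intervalIntegral.integral_comp_add_left, add_zero, sub_zero, smul_eq_mul]
      · field_simp; ring
      · have := (hint x (x + η)).comp_add_left x
        simpa using this
    calc ‖w x‖ₑ ≤ ‖-(1 / η * ∫ s in (0 : ℝ)..η, (w (x + s) - w x))‖ₑ
          + ‖1 / η * ∫ y in x..(x + η), w y‖ₑ := by
            conv_lhs => rw [e]
            exact enorm_add_le _ _
      _ ≤ _ := by
        refine add_le_add_left ?_ _
        rw [enorm_neg, enorm_mul, Real.enorm_of_nonneg (by positivity),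
          intervalIntegral.integral_of_le hη.le]
        gcongr
        exact enorm_integral_le_lintegral_enorm _
  calc ∫⁻ x, ‖w x‖ₑ ∂gauss
      ≤ ∫⁻ x, (ENNReal.ofReal (1 / η) * (∫⁻ s in Ioc 0 η, ‖w (x + s) - w x‖ₑ)
      + ‖1 / η * ∫ y in x..(x + η), w y‖ₑ) ∂gauss := lintegral_mono hpt
    _ = (∫⁻ x, (ENNReal.ofReal (1 / η) * ∫⁻ s in Ioc 0 η, ‖w (x + s) - w x‖ₑ) ∂gauss)
        + ∫⁻ x, ‖1 / η * ∫ y in x..(x + η), w y‖ₑ ∂gauss := by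
        refine lintegral_add_left (Measurable.const_mul ?_ _) _
        exact Measurable.lintegral_prod_right' (f := fun p : ℝ × ℝ => ‖w (p.1 + p.2) - w p.1‖ₑ)
          (by fun_prop)
    _ ≤ _ := by
        refine add_le_add_left ?_ _
        calc _ ≤ ∫⁻ x, (ENNReal.ofReal (1 / η) * ∫⁻ s in Ioc 0 η, ‖w (x + s) - w x‖ₑ) :=
              lintegral_mono' gauss_le_volume le_rfl
          _ = ENNReal.ofReal (1 / η) * ∫⁻ s in Ioc 0 η, ∫⁻ x, ‖w (x + s) - w x‖ₑ := by
              rw [lintegral_const_mul' _ _ ENNReal.ofReal_ne_top, lintegral_lintegral_swap]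
              exact Measurable.aemeasurable (by fun_prop)
          _ ≤ ENNReal.ofReal (1 / η) * ∫⁻ s in Ioc 0 η, ENNReal.ofReal (B * η) := by
              refine mul_le_mul_right (setLIntegral_mono measurable_const fun s hs =>
                (h s).trans (ENNReal.ofReal_le_ofReal ?_)) _
              rw [abs_of_pos hs.1]
              exact mul_le_mul_of_nonneg_left hs.2 hB
          _ = ENNReal.ofReal (B * η) := by
              rw [setLIntegral_const, Real.volume_Ioc, ← ENNReal.ofReal_mul (by positivity),
                ← ENNReal.ofReal_mul (by positivity)]
              congr 1; field_simp; ring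

/-- Completeness of `L¹(gauss)`, for bounded sequences of functions. -/
lemma exists_tendsto_of_cauchy {f : ℕ → ℝ → ℝ} {M : ℝ} (hf : ∀ m, Measurable (f m))
    (hM : ∀ m x, |f m x| ≤ M)
    (hc : Tendsto (fun p : ℕ × ℕ => ∫⁻ x, ‖f p.1 x - f p.2 x‖ₑ ∂gauss) (atTop ×ˢ atTop) (𝓝 0)) :
    ∃ F : ℝ → ℝ, Measurable F ∧ Tendsto (fun m => ∫⁻ x, ‖f m x - F x‖ₑ ∂gauss) atTop (𝓝 0) := by
  have hLp : ∀ m, MemLp (f m) 1 gauss := fun m =>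
    MemLp.of_bound (hf m).aestronglyMeasurable M (ae_of_all _ fun x => hM m x)
  have hcs : CauchySeq fun m => (hLp m).toLp (f m) := by
    refine EMetric.cauchySeq_iff.2 fun ε hε => ?_
    have := (ENNReal.tendsto_nhds_zero.1 hc) (ε / 2 ⊓ 1)
      (lt_inf_iff.2 ⟨ENNReal.half_pos hε.ne', one_pos⟩)
    rw [prod_atTop_atTop_eq, eventually_atTop] at this
    obtain ⟨⟨a, b⟩, hab⟩ := this
    refine ⟨max a b, fun m hm n hn => ?_⟩
    have hmn := hab (m, n) ⟨(le_max_left a b).trans hm, (le_max_right a b).trans hn⟩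
    rw [Lp.edist_toLp_toLp, eLpNorm_one_eq_lintegral_enorm]
    refine lt_of_le_of_lt hmn ?_
    rcases eq_or_ne ε ∞ with rfl | hfin
    · exact lt_of_le_of_lt inf_le_right ENNReal.one_lt_top
    · exact lt_of_le_of_lt inf_le_left (ENNReal.half_lt_self hε.ne' hfin)
  obtain ⟨F, hF⟩ := cauchySeq_tendsto_of_complete hcs
  refine ⟨F, (Lp.stronglyMeasurable F).measurable, ?_⟩
  have := (tendsto_iff_edist_tendsto_0.1 hF)
  refine this.congr fun m => ?_
  conv_lhs => rw [← Lp.toLp_coeFn F (Lp.memLp F)]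
  rw [Lp.edist_toLp_toLp, eLpNorm_one_eq_lintegral_enorm]
  rfl

/-- Bounded sequences with a uniform translation bound converge in `L¹(gauss)` as soon as their
primitives converge pointwise. -/
lemma exists_tendsto_of_cauchy_primitive {f : ℕ → ℝ → ℝ} {B M : ℝ} (hB0 : 0 ≤ B)
    (hf : ∀ m, Measurable (f m)) (hM : ∀ m x, |f m x| ≤ M) (hB : ∀ m, TranslationBound B (f m))
    (hP : ∀ x, CauchySeq fun m => ∫ y in (0 : ℝ)..x, f m y) :
    ∃ F : ℝ → ℝ, Measurable F ∧ Tendsto (fun m => ∫⁻ x, ‖f m x - F x‖ₑ ∂gauss) atTop (𝓝 0) := by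
  refine exists_tendsto_of_cauchy hf hM (ENNReal.tendsto_nhds_zero.2 fun ε hε => ?_)
  have hint := fun m => intervalIntegrable_of_abs_le (hf m) (hM m)
  -- for a small width `η` the distance to the averages is small, uniformly in the indices
  obtain ⟨η, hη, hηε⟩ : ∃ η : ℝ, 0 < η ∧ ENNReal.ofReal ((B + B) * η) ≤ ε / 2 := by
    have h1 : Tendsto (fun η : ℝ => ENNReal.ofReal ((B + B) * η)) (𝓝[>] 0) (𝓝 0) := by
      have : Tendsto (fun η : ℝ => ENNReal.ofReal ((B + B) * η)) (𝓝 0)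
          (𝓝 (ENNReal.ofReal ((B + B) * 0))) :=
        (ENNReal.continuous_ofReal.comp (continuous_const.mul continuous_id)).tendsto 0
      rw [mul_zero, ENNReal.ofReal_zero] at this
      exact this.mono_left nhdsWithin_le_nhds
    have h2 := (ENNReal.tendsto_nhds_zero.1 h1) (ε / 2) (ENNReal.half_pos hε.ne')
    obtain ⟨η, h3, h4⟩ := (h2.and eventually_mem_nhdsWithin).exists
    exact ⟨η, h4, h3⟩
  -- at fixed `η` the averages are difference quotients of primitives
  have havg : Tendsto (fun p : ℕ × ℕ =>
      ∫⁻ x, ‖1 / η * ∫ y in x..(x + η), (f p.1 y - f p.2 y)‖ₑ ∂gauss) (atTop ×ˢ atTop) (𝓝 0) := by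
    have h0 : (0 : ℝ≥0∞) = ∫⁻ _ : ℝ, 0 ∂gauss := by simp
    rw [h0]
    have eavg : ∀ (p : ℕ × ℕ) (x : ℝ), (∫ y in x..(x + η), (f p.1 y - f p.2 y))
        = ((∫ y in (0 : ℝ)..(x + η), f p.1 y) - ∫ y in (0 : ℝ)..(x + η), f p.2 y)
          - ((∫ y in (0 : ℝ)..x, f p.1 y) - ∫ y in (0 : ℝ)..x, f p.2 y) := fun p x => by
      rw [intervalIntegral.integral_sub (hint _ _ _) (hint _ _ _),
        ← intervalIntegral.integral_interval_sub_left (hint p.1 0 (x + η)) (hint p.1 0 x),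
        ← intervalIntegral.integral_interval_sub_left (hint p.2 0 (x + η)) (hint p.2 0 x)]
      ring
    have hcont : ∀ m, Continuous fun x => ∫ y in (0 : ℝ)..x, f m y := fun m =>
      intervalIntegral.continuous_primitive (hint m) 0
    refine tendsto_lintegral_filter_of_dominated_convergence (fun _ => ENNReal.ofReal (2 * M))
      (Eventually.of_forall fun p => ?_) (Eventually.of_forall fun p => ae_of_all _ fun x => ?_)
      (by simp [ENNReal.mul_eq_top]) (ae_of_all _ fun x => ?_)
    · simp_rw [eavg]
      have h1 := hcont p.1
      have h2 := hcont p.2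
      have h3 := h1.comp (continuous_id.add (continuous_const (y := η)))
      have h4 := h2.comp (continuous_id.add (continuous_const (y := η)))
      exact (((h3.sub h4).sub (h1.sub h2)).const_mul (1 / η)).measurable.enorm
    · rw [← ofReal_norm]
      refine ENNReal.ofReal_le_ofReal ?_
      rw [norm_mul, Real.norm_of_nonneg (by positivity)]
      have := intervalIntegral.norm_integral_le_of_norm_le_const (C := 2 * M) (a := x) (b := x + η)
        (f := fun y => f p.1 y - f p.2 y) fun y _ => by
          rw [Real.norm_eq_abs]
          linarith [abs_sub (f p.1 y) (f p.2 y), hM p.1 y, hM p.2 y]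
      rw [add_sub_cancel_left, abs_of_pos hη] at this
      calc _ ≤ 1 / η * (2 * M * η) := by gcongr
        _ = 2 * M := by field_simp
    · have hd : ∀ z : ℝ, Tendsto (fun p : ℕ × ℕ =>
          (∫ y in (0 : ℝ)..z, f p.1 y) - ∫ y in (0 : ℝ)..z, f p.2 y) (atTop ×ˢ atTop) (𝓝 0) := by
        intro z
        obtain ⟨l, hl⟩ := cauchySeq_tendsto_of_complete (hP z)
        simpa using (hl.comp tendsto_fst).sub (hl.comp tendsto_snd)
      have := ((hd (x + η)).sub (hd x)).const_mul (1 / η)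
      simp only [sub_zero, mul_zero] at this
      simp_rw [eavg]
      simpa using this.enorm
  filter_upwards [ENNReal.tendsto_nhds_zero.1 havg (ε / 2) (ENNReal.half_pos hε.ne')] with p hp
  refine (lintegral_gauss_le_sliding_average (M := 2 * M) (add_nonneg hB0 hB0)
    ((hf p.1).sub (hf p.2)) (fun x => ?_) ((hB p.1).sub hB0 hB0 (hf p.1) (hB p.2)) hη).trans ?_
  · simp only [Pi.sub_apply]
    linarith [abs_sub (f p.1 x) (f p.2 x), hM p.1 x, hM p.2 x]
  · exact (add_le_add hηε hp).trans (ENNReal.add_halves ε).le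

/-- An `L¹`-Lipschitz curve of functions has a jointly measurable version: the values at the dyadic
times below `t` converge almost everywhere, since the errors are summable. -/
lemma exists_measurable_version {U : ℝ → ℝ → ℝ} (hU : ∀ t, Measurable (U t)) {L : ℝ} (hL0 : 0 ≤ L)
    (hL : ∀ s t, ∫⁻ x, ‖U t x - U s x‖ₑ ∂gauss ≤ ENNReal.ofReal (L * |t - s|)) :
    ∃ u : ℝ × ℝ → ℝ, Measurable u ∧ ∀ t, (fun x => u (x, t)) =ᵐ[gauss] U t := by
  set r : ℕ → ℝ → ℝ := fun k t => ⌊(2 : ℝ) ^ k * t⌋ / (2 : ℝ) ^ k with hr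
  have hr1 : ∀ k t, |r k t - t| ≤ (1 / 2) ^ k := fun k t => by
    have h2 : (0 : ℝ) < 2 ^ k := by positivity
    have e : r k t - t = -(Int.fract ((2 : ℝ) ^ k * t)) / 2 ^ k := by
      rw [hr, Int.fract]; field_simp; ring
    rw [e, abs_div, abs_neg, abs_of_pos h2, abs_of_nonneg (Int.fract_nonneg _), one_div, inv_pow,
      ← one_div]
    gcongr
    exact (Int.fract_lt_one _).le
  have hmeas : ∀ k, Measurable fun p : ℝ × ℝ => U (r k p.2) p.1 := fun k => by
    have h1 : Measurable fun q : ℝ × ℤ => U ((q.2 : ℝ) / 2 ^ k) q.1 :=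
      measurable_from_prod_countable_left fun j => hU (j / 2 ^ k)
    have h2 : Measurable fun p : ℝ × ℝ => (p.1, ⌊(2 : ℝ) ^ k * p.2⌋) :=
      measurable_fst.prodMk (Int.measurable_floor.comp (by fun_prop))
    exact h1.comp h2
  refine ⟨fun p => limsup (fun k => U (r k p.2) p.1) atTop, Measurable.limsup hmeas, fun t => ?_⟩
  have hmk : ∀ k, Measurable fun x => ‖U (r k t) x - U t x‖ₑ := fun k =>
    ((hU _).sub (hU _)).enorm
  have hsum : ∫⁻ x, ∑' k, ‖U (r k t) x - U t x‖ₑ ∂gauss ≠ ∞ := by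
    rw [lintegral_tsum fun k => (hmk k).aemeasurable]
    have hle : ∑' k, ∫⁻ x, ‖U (r k t) x - U t x‖ₑ ∂gauss
        ≤ ∑' k : ℕ, ENNReal.ofReal (L * (1 / 2) ^ k) :=
      ENNReal.tsum_le_tsum fun k => (hL t (r k t)).trans
        (ENNReal.ofReal_le_ofReal (mul_le_mul_of_nonneg_left (hr1 k t) hL0))
    refine ne_top_of_le_ne_top ?_ hle
    rw [← ENNReal.ofReal_tsum_of_nonneg (fun k => by positivity)
      ((summable_geometric_of_lt_one (by norm_num) (by norm_num)).mul_left L)]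
    exact ENNReal.ofReal_ne_top
  have hfin := ae_lt_top (Measurable.tsum hmk) hsum
  filter_upwards [hfin] with x hx
  have h0 := ENNReal.tendsto_atTop_zero_of_tsum_ne_top hx.ne
  refine Tendsto.limsup_eq ?_
  rw [tendsto_iff_edist_tendsto_0]
  simpa [edist_eq_enorm_sub] using h0

/-- Fatou's lemma in the form in which bounds are inherited by limits. -/
lemma lintegral_enorm_le_of_ae_tendsto {F : ℕ → ℝ → ℝ} {G : ℝ → ℝ} (hF : ∀ m, Measurable (F m))
    (h : ∀ᵐ x, Tendsto (fun m => F m x) atTop (𝓝 (G x))) {b : ℕ → ℝ≥0∞} {b₀ : ℝ≥0∞}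
    (hb : ∀ m, ∫⁻ x, ‖F m x‖ₑ ≤ b m) (hb₀ : Tendsto b atTop (𝓝 b₀)) : ∫⁻ x, ‖G x‖ₑ ≤ b₀ := by
  calc ∫⁻ x, ‖G x‖ₑ = ∫⁻ x, liminf (fun m => ‖F m x‖ₑ) atTop := by
        refine lintegral_congr_ae ?_
        filter_upwards [h] with x hx
        exact hx.enorm.liminf_eq.symm
    _ ≤ liminf (fun m => ∫⁻ x, ‖F m x‖ₑ) atTop := lintegral_liminf_le fun m => (hF m).enorm
    _ ≤ liminf b atTop := liminf_le_liminf (Eventually.of_forall hb)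
    _ = b₀ := hb₀.liminf_eq

lemma exists_subseq_ae_tendsto {F : ℕ → ℝ → ℝ} {G : ℝ → ℝ} (hF : ∀ m, Measurable (F m))
    (hG : Measurable G) (h : Tendsto (fun m => ∫⁻ x, ‖F m x - G x‖ₑ ∂gauss) atTop (𝓝 0)) :
    ∃ ns : ℕ → ℕ, StrictMono ns ∧ ∀ᵐ x, Tendsto (fun m => F (ns m) x) atTop (𝓝 (G x)) := by
  have h1 : Tendsto (fun m => eLpNorm (F m - G) 1 gauss) atTop (𝓝 0) := by
    refine h.congr fun m => ?_
    rw [eLpNorm_one_eq_lintegral_enorm]; rfl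
  obtain ⟨ns, hns, hae⟩ := (tendstoInMeasure_of_tendsto_eLpNorm one_ne_zero
    (fun m => (hF m).aestronglyMeasurable) hG.aestronglyMeasurable h1).exists_seq_tendsto_ae
  exact ⟨ns, hns, volume_absolutelyContinuous_gauss.ae_le hae⟩

/-- Uniform bounds in `L^∞`, in `L¹`, on the spatial translations and on the increments in time
(up to a vanishing time-discretization error `τ m`) for a sequence of functions `w m x t`. -/
structure UniformBounds (w : ℕ → ℝ → ℝ → ℝ) (A B L M : ℝ) (τ : ℕ → ℝ) : Prop where
  measurable : ∀ m t, Measurable fun x => w m x t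
  bounded : ∀ m x t, |w m x t| ≤ M
  translation : ∀ m t, TranslationBound B fun x => w m x t
  time : ∀ m s t, ∫⁻ x, ‖w m x t - w m x s‖ₑ ≤ ENNReal.ofReal (L * (|t - s| + τ m))
  l1 : ∀ m, ∫⁻ x, ‖w m x 0‖ₑ ≤ ENNReal.ofReal A
  err_nonneg : ∀ m, 0 ≤ τ m
  err_tendsto : Tendsto τ atTop (𝓝 0)

section Compactness

variable {w : ℕ → ℝ → ℝ → ℝ} {A B L M : ℝ} {τ : ℕ → ℝ}

/-- The primitives are equicontinuous in space and time, up to the discretization error. -/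
lemma UniformBounds.abs_primitive_sub_le (h : UniformBounds w A B L M τ) (hL0 : 0 ≤ L)
    (m : ℕ) (x q t r : ℝ) :
    |(∫ y in (0 : ℝ)..x, w m y t) - ∫ y in (0 : ℝ)..q, w m y r|
      ≤ M * |x - q| + L * (|t - r| + τ m) := by
  have hint := fun t => intervalIntegrable_of_abs_le (h.measurable m t) (fun x => h.bounded m x t)
  have h1 : |∫ y in q..x, w m y t| ≤ M * |x - q| :=
    intervalIntegral.norm_integral_le_of_norm_le_const (f := fun y => w m y t)
      fun y _ => h.bounded m y t
  have h2 : |∫ y in (0 : ℝ)..q, (w m y t - w m y r)| ≤ L * (|t - r| + τ m) := by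
    have h3 : ‖∫ y in (0 : ℝ)..q, (w m y t - w m y r)‖ₑ ≤ ENNReal.ofReal (L * (|t - r| + τ m)) := by
      rw [← enorm_norm, intervalIntegral.norm_intervalIntegral_eq, enorm_norm]
      exact (enorm_integral_le_lintegral_enorm _).trans
        ((setLIntegral_le_lintegral _ _).trans (h.time m r t))
    rw [← ofReal_norm] at h3
    exact (ENNReal.ofReal_le_ofReal_iff
      (mul_nonneg hL0 (add_nonneg (abs_nonneg _) (h.err_nonneg m)))).1 h3
  have e : (∫ y in (0 : ℝ)..x, w m y t) - ∫ y in (0 : ℝ)..q, w m y r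
      = (∫ y in q..x, w m y t) + ∫ y in (0 : ℝ)..q, (w m y t - w m y r) := by
    rw [intervalIntegral.integral_sub (hint _ _ _) (hint _ _ _),
      ← intervalIntegral.integral_interval_sub_left (hint t 0 x) (hint t 0 q)]
    ring
  rw [e]
  exact (abs_add_le _ _).trans (add_le_add h1 h2)

/-- Selection of a subsequence along which all primitives converge. By equicontinuity it suffices to
have convergence at the countably many rational points, which is compactness of a product. -/
lemma UniformBounds.exists_subseq_cauchy_primitive (h : UniformBounds w A B L M τ) (hL0 : 0 ≤ L)
    (hM0 : 0 ≤ M) : ∃ κ : ℕ → ℕ, StrictMono κ ∧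
      ∀ x t, CauchySeq fun m => ∫ y in (0 : ℝ)..x, w (κ m) y t := by
  set P : ℕ → ℚ × ℚ → ℝ := fun m p => ∫ y in (0 : ℝ)..p.1, w m y p.2 with hP
  have hK : IsCompact (univ.pi fun p : ℚ × ℚ => Icc (-(M * |(p.1 : ℝ)|)) (M * |(p.1 : ℝ)|)) :=
    isCompact_univ_pi fun p => isCompact_Icc
  obtain ⟨l, -, κ, hκ, hl⟩ := hK.tendsto_subseq (x := P) fun m p _ => by
    have := intervalIntegral.norm_integral_le_of_norm_le_const (C := M) (a := 0) (b := (p.1 : ℝ))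
      (f := fun y => w m y p.2) fun y _ => h.bounded m y p.2
    rw [sub_zero] at this
    exact abs_le.1 this
  refine ⟨κ, hκ, fun x t => Metric.cauchySeq_iff'.2 fun ε hε => ?_⟩
  obtain ⟨δ, hδ, hδε⟩ : ∃ δ : ℝ, 0 < δ ∧ (M + L + L) * δ ≤ ε / 4 := by
    refine ⟨ε / 4 / (M + L + L + 1), by positivity, ?_⟩
    rw [mul_div_assoc', div_le_iff₀ (by positivity)]
    nlinarith
  obtain ⟨q, hq1, hq2⟩ := exists_rat_btwn (show x < x + δ by linarith)
  obtain ⟨r, hr1, hr2⟩ := exists_rat_btwn (show t < t + δ by linarith)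
  have hc : CauchySeq fun m => P (κ m) (q, r) :=
    ((continuous_apply (q, r)).tendsto l |>.comp hl).cauchySeq
  obtain ⟨N₁, hN₁⟩ := Metric.cauchySeq_iff.1 hc (ε / 4) (by positivity)
  obtain ⟨N₂, hN₂⟩ := eventually_atTop.1
    ((h.err_tendsto.comp hκ.tendsto_atTop).eventually (gt_mem_nhds hδ))
  have hest : ∀ m ≥ N₂, |(∫ y in (0 : ℝ)..x, w (κ m) y t) - P (κ m) (q, r)| ≤ ε / 4 := by
    intro m hm
    refine (h.abs_primitive_sub_le hL0 (κ m) x q t r).trans (le_trans ?_ hδε)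
    have h1 : |x - q| ≤ δ := by rw [abs_le]; constructor <;> linarith
    have h2 : |t - r| ≤ δ := by rw [abs_le]; constructor <;> linarith
    have h3 : τ (κ m) ≤ δ := (hN₂ m hm).le
    nlinarith [mul_le_mul_of_nonneg_left h1 hM0, mul_le_mul_of_nonneg_left h2 hL0,
      mul_le_mul_of_nonneg_left h3 hL0]
  refine ⟨max N₁ N₂, fun n hn => ?_⟩
  have h1 := hest n ((le_max_right _ _).trans hn)
  have h2 := hest (max N₁ N₂) (le_max_right _ _)
  have h3 := hN₁ n ((le_max_left _ _).trans hn) (max N₁ N₂) (le_max_left _ _)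
  rw [Real.dist_eq] at h3 ⊢
  rw [abs_le] at h1 h2
  rw [abs_lt] at h3 ⊢
  constructor <;> linarith

/-- Compactness: uniformly bounded sequences have a subsequence converging at every time. The limit
inherits all bounds, and is Lipschitz continuous in time with values in `L¹`. -/
theorem UniformBounds.exists_subseq_tendsto (h : UniformBounds w A B L M τ) (hB0 : 0 ≤ B)
    (hL0 : 0 ≤ L) (hM0 : 0 ≤ M) :
    ∃ κ : ℕ → ℕ, StrictMono κ ∧ ∃ u : ℝ × ℝ → ℝ, Measurable u ∧ (∀ p, |u p| ≤ M) ∧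
      (∀ t, Tendsto (fun m => ∫⁻ x, ‖w (κ m) x t - u (x, t)‖ₑ ∂gauss) atTop (𝓝 0)) ∧
      (∀ t, Integrable fun x => u (x, t)) ∧ (∀ t, TranslationBound B fun x => u (x, t)) ∧
      ∀ s t, ∫⁻ x, ‖u (x, t) - u (x, s)‖ₑ ≤ ENNReal.ofReal (L * |t - s|) := by
  obtain ⟨κ, hκ, hP⟩ := h.exists_subseq_cauchy_primitive hL0 hM0
  choose U hUm hU using fun t => exists_tendsto_of_cauchy_primitive hB0
    (fun m => h.measurable (κ m) t) (fun m x => h.bounded (κ m) x t)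
    (fun m => h.translation (κ m) t) (fun x => hP x t)
  have hτ : Tendsto (fun m => τ (κ m)) atTop (𝓝 0) := h.err_tendsto.comp hκ.tendsto_atTop
  have hUL : ∀ s t, ∫⁻ x, ‖U t x - U s x‖ₑ ≤ ENNReal.ofReal (L * |t - s|) := fun s t => by
    have hd : Tendsto (fun m => ∫⁻ x, ‖(w (κ m) x t - w (κ m) x s) - (U t x - U s x)‖ₑ ∂gauss)
        atTop (𝓝 0) := by
      refine tendsto_of_tendsto_of_tendsto_of_le_of_le tendsto_const_nhds
        (by simpa using (hU t).add (hU s)) (fun _ => zero_le) fun m => ?_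
      have hm : Measurable fun x => ‖w (κ m) x t - U t x‖ₑ :=
        ((h.measurable (κ m) t).sub (hUm t)).enorm
      rw [← lintegral_add_left hm]
      refine lintegral_mono fun x => ?_
      rw [sub_sub_sub_comm]
      exact enorm_sub_le
    obtain ⟨ns, hns, hae⟩ := exists_subseq_ae_tendsto
      (fun m => (h.measurable (κ m) t).sub (h.measurable (κ m) s)) ((hUm t).sub (hUm s)) hd
    refine lintegral_enorm_le_of_ae_tendsto
      (fun m => (h.measurable (κ (ns m)) t).sub (h.measurable (κ (ns m)) s)) hae
      (b := fun m => ENNReal.ofReal (L * (|t - s| + τ (κ (ns m)))))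
      (fun m => h.time _ s t) ?_
    refine (ENNReal.continuous_ofReal.tendsto _).comp ?_
    have := ((hτ.comp hns.tendsto_atTop).const_add |t - s|).const_mul L
    simpa using this
  obtain ⟨u, hum, hu⟩ := exists_measurable_version hUm hL0
    (fun s t => (lintegral_mono' gauss_le_volume le_rfl).trans (hUL s t))
  -- truncation makes the bound by `M` hold everywhere
  set v : ℝ × ℝ → ℝ := fun p => max (-M) (min M (u p)) with hv
  have hvm : Measurable v := measurable_const.max (measurable_const.min hum)
  have hvM : ∀ p, |v p| ≤ M := fun p =>
    abs_le.2 ⟨le_max_left _ _, max_le (by linarith) (min_le_left _ _)⟩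
  have hvlim : ∀ t, Tendsto (fun m => ∫⁻ x, ‖w (κ m) x t - v (x, t)‖ₑ ∂gauss) atTop (𝓝 0) := by
    intro t
    refine tendsto_of_tendsto_of_tendsto_of_le_of_le tendsto_const_nhds (hU t)
      (fun _ => zero_le) fun m => lintegral_mono_ae ?_
    filter_upwards [hu t] with x hx
    have hwM := abs_le.1 (h.bounded (κ m) x t)
    rw [← ofReal_norm, ← ofReal_norm, Real.norm_eq_abs, Real.norm_eq_abs]
    refine ENNReal.ofReal_le_ofReal ?_
    have e : w (κ m) x t = max (-M) (min M (w (κ m) x t)) := by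
      rw [min_eq_right hwM.2, max_eq_right hwM.1]
    rw [← hx]
    conv_lhs => rw [e]
    refine (abs_max_sub_max_le_max _ _ _ _).trans ?_
    rw [sub_self, abs_zero, max_eq_right (abs_nonneg _)]
    refine (abs_min_sub_min_le_max _ _ _ _).trans ?_
    rw [sub_self, abs_zero, max_eq_right (abs_nonneg _)]
  have hvU : ∀ t, (fun x => v (x, t)) =ᵐ[volume] U t := fun t => by
    obtain ⟨n₁, hn₁, h₁⟩ := exists_subseq_ae_tendsto (fun m => h.measurable (κ m) t)
      (hvm.comp (measurable_id.prodMk measurable_const)) (hvlim t)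
    obtain ⟨n₂, hn₂, h₂⟩ := exists_subseq_ae_tendsto (fun m => h.measurable (κ (n₁ m)) t)
      (hUm t) ((hU t).comp hn₁.tendsto_atTop)
    filter_upwards [h₁, h₂] with x hx₁ hx₂
    exact tendsto_nhds_unique (hx₁.comp hn₂.tendsto_atTop) hx₂
  have hvt : ∀ t, Measurable fun x => v (x, t) := fun t =>
    hvm.comp (measurable_id.prodMk measurable_const)
  refine ⟨κ, hκ, v, hvm, hvM, hvlim, fun t => ⟨(hvt t).aestronglyMeasurable, ?_⟩, fun t y => ?_,
    fun s t => ?_⟩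
  · obtain ⟨ns, hns, hae⟩ := exists_subseq_ae_tendsto (fun m => h.measurable (κ m) t)
      (hvt t) (hvlim t)
    have := lintegral_enorm_le_of_ae_tendsto (fun m => h.measurable (κ (ns m)) t) hae
      (b := fun m => ENNReal.ofReal (L * (|t - 0| + τ (κ (ns m)))) + ENNReal.ofReal A)
      (b₀ := ENNReal.ofReal (L * (|t - 0| + 0)) + ENNReal.ofReal A) (fun m => ?_) ?_
    · exact this.trans_lt (by simp [ENNReal.add_lt_top])
    · refine le_trans ?_ (add_le_add (h.time _ 0 t) (h.l1 (κ (ns m))))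
      have hm' : Measurable fun x => ‖w (κ (ns m)) x t - w (κ (ns m)) x 0‖ₑ :=
        ((h.measurable _ t).sub (h.measurable _ 0)).enorm
      rw [← lintegral_add_left hm']
      refine lintegral_mono fun x => ?_
      simpa using enorm_add_le (w (κ (ns m)) x t - w (κ (ns m)) x 0) (w (κ (ns m)) x 0)
    · refine Tendsto.add_const _ ((ENNReal.continuous_ofReal.tendsto _).comp ?_)
      exact ((hτ.comp hns.tendsto_atTop).const_add _).const_mul L
  · obtain ⟨ns, hns, hae⟩ := exists_subseq_ae_tendsto (fun m => h.measurable (κ m) t)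
      (hvt t) (hvlim t)
    have hae' := (measurePreserving_add_right volume y).quasiMeasurePreserving.ae hae
    refine lintegral_enorm_le_of_ae_tendsto
      (F := fun m x => w (κ (ns m)) (x + y) t - w (κ (ns m)) x t)
      (fun m => ((h.measurable _ t).comp (measurable_add_const y)).sub (h.measurable _ t)) ?_
      (fun m => h.translation _ t y) tendsto_const_nhds
    filter_upwards [hae, hae'] with x h1 h2 using h2.sub h1
  · refine le_trans (le_of_eq (lintegral_congr_ae ?_)) (hUL s t)
    filter_upwards [hvU s, hvU t] with x h1 h2
    rw [h1, h2]

end Compactness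

/-- Integrals that vanish in the limit with respect to `gauss` also do so on every bounded interval
with respect to Lebesgue measure. -/
lemma tendsto_setLIntegral_of_gauss {ι : Type*} {l : Filter ι} {F : ι → ℝ → ℝ≥0∞}
    (h : Tendsto (fun i => ∫⁻ x, F i x ∂gauss) l (𝓝 0)) (R : ℝ) :
    Tendsto (fun i => ∫⁻ x in Icc (-R) R, F i x) l (𝓝 0) := by
  obtain ⟨c, hc, hle⟩ := exists_volume_restrict_le_gauss R
  refine tendsto_of_tendsto_of_tendsto_of_le_of_le tendsto_const_nhds
    (by simpa using ENNReal.Tendsto.const_mul h (Or.inr hc)) (fun _ => zero_le) fun i => ?_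
  refine (lintegral_mono' hle le_rfl).trans (le_of_eq ?_)
  rw [lintegral_smul_measure, smul_eq_mul]

lemma tendstoL1Loc_of_gauss {ι : Type*} {l : Filter ι} {W : ι → ℝ → ℝ} {v : ℝ → ℝ}
    (h : Tendsto (fun i => ∫⁻ x, ‖W i x - v x‖ₑ ∂gauss) l (𝓝 0)) : TendstoL1Loc W l v := by
  intro K hK
  obtain ⟨R, hR⟩ := hK.isBounded.subset_closedBall 0
  rw [Real.closedBall_eq_Icc, zero_sub, zero_add] at hR
  refine tendsto_of_tendsto_of_tendsto_of_le_of_le tendsto_const_nhds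
    (tendsto_setLIntegral_of_gauss h R) (fun _ => zero_le) fun i => ?_
  rw [eLpNorm_one_eq_lintegral_enorm]
  exact lintegral_mono_set hR

/-! ### Uniform bounds for the scheme -/

lemma tsum_enorm_le {f : ℤ → ℝ} {b : ℝ} (hf : Summable fun j => |f j|) (hb : ∑' j, |f j| ≤ b) :
    ∑' j, ‖f j‖ₑ ≤ ENNReal.ofReal b := by
  refine le_trans (le_of_eq ?_) (ENNReal.ofReal_le_ofReal hb)
  rw [ENNReal.ofReal_tsum_of_nonneg (fun _ => abs_nonneg _) hf]
  exact tsum_congr fun j => (ofReal_norm (f j)).symm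

lemma summable_abs_of_tsum_enorm {f : ℤ → ℝ} (hf : ∑' j, ‖f j‖ₑ ≠ ∞) :
    Summable fun j => |f j| := by
  refine (ENNReal.summable_toReal hf).congr fun j => ?_
  simp

lemma tsum_abs_le_of_tsum_enorm_le {f : ℤ → ℝ} {b : ℝ} (hb0 : 0 ≤ b)
    (hf : ∑' j, ‖f j‖ₑ ≤ ENNReal.ofReal b) : ∑' j, |f j| ≤ b := by
  have hs := summable_abs_of_tsum_enorm (ne_top_of_le_ne_top ENNReal.ofReal_ne_top hf)
  rw [← ENNReal.ofReal_le_ofReal_iff hb0, ENNReal.ofReal_tsum_of_nonneg (fun _ => abs_nonneg _) hs]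
  refine le_trans (le_of_eq (tsum_congr fun j => ?_)) hf
  exact ofReal_norm (f j)

lemma measurable_piecewiseConstant (dx dt : ℝ) (u : ℕ → ℤ → ℝ) :
    Measurable fun p : ℝ × ℝ => piecewiseConstant dx dt u p.1 p.2 := by
  have h1 : Measurable fun q : ℕ × ℤ => u q.1 q.2 := measurable_of_countable _
  have h2 : Measurable fun p : ℝ × ℝ => (⌊p.2 / dt⌋₊, ⌊p.1 / dx + 1 / 2⌋) :=
    (Nat.measurable_floor.comp (by fun_prop)).prodMk (Int.measurable_floor.comp (by fun_prop))
  exact h1.comp h2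

lemma abs_natFloor_sub_le {a b : ℝ} (hab : a ≤ b) : (⌊b⌋₊ : ℝ) - ⌊a⌋₊ ≤ |b - a| + 1 := by
  rw [abs_of_nonneg (sub_nonneg.2 hab)]
  rcases le_total 0 b with hb | hb
  · linarith [Nat.floor_le hb, Nat.lt_floor_add_one a]
  · rw [Nat.floor_of_nonpos hb]
    have : (0 : ℝ) ≤ ⌊a⌋₊ := Nat.cast_nonneg _
    push_cast
    linarith

/-- The data of the scheme for one admissible time step: `B` bounds the variation of the initial
datum, `C` is a Lipschitz constant of the flux, and `dt` is so small that the coefficients satisfy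
the smallness condition of the discrete estimates. -/
structure GoodStep (g : ℝ → ℝ → ℝ) (ω : ℝ → ℝ) (δ lam dt C B : ℝ) (u₀ : ℝ → ℝ)
    (σ u : ℕ → ℤ → ℝ) : Prop where
  dt_pos : 0 < dt
  lam_pos : 0 < lam
  lip_nonneg : 0 ≤ C
  lip : ∀ u₁ v₁ u₂ v₂, |g u₁ v₁ - g u₂ v₂| ≤ C * (|u₁ - u₂| + |v₁ - v₂|)
  flux : ∃ f, IsMonotoneFlux f g
  kernel : IsInteractionKernel δ ω
  horizon : 0 < δ
  sol : IsSchemeSolution g ω δ (dt / lam) dt u₀ σ u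
  var_nonneg : 0 ≤ B
  integrable : Integrable u₀
  var : TranslationBound B u₀
  small : 4 * C * ∑ k ∈ Finset.range (⌊δ / (dt / lam)⌋₊ + 2), coeff ω lam (dt / lam) k ≤ 1

namespace GoodStep

variable {g : ℝ → ℝ → ℝ} {ω : ℝ → ℝ} {δ lam dt C B : ℝ} {u₀ : ℝ → ℝ} {σ u : ℕ → ℤ → ℝ}

lemma dx_pos (h : GoodStep g ω δ lam dt C B u₀ σ u) : 0 < dt / lam := div_pos h.dt_pos h.lam_pos

lemma coeff_nonneg (h : GoodStep g ω δ lam dt C B u₀ σ u) (k : ℕ) : 0 ≤ coeff ω lam (dt / lam) k :=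
  div_nonneg (mul_nonneg h.lam_pos.le (weight_nonneg h.kernel h.dx_pos k)) (Nat.cast_nonneg _)

lemma initial_eq (h : GoodStep g ω δ lam dt C B u₀ σ u) : u 0 = cellAverage u₀ (dt / lam) :=
  funext fun j => h.sol.initial j

/-- The total variation never exceeds that of the initial datum. -/
lemma tv_le (h : GoodStep g ω δ lam dt C B u₀ σ u) (n : ℕ) :
    (Summable fun j => |u n (j + 1) - u n j|) ∧ ∑' j, |u n (j + 1) - u n j| ≤ B := by
  obtain ⟨f, hf⟩ := h.flux
  have h0 : ∑' j, ‖u 0 (j + 1) - u 0 j‖ₑ ≤ ENNReal.ofReal B := by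
    rw [h.initial_eq]
    exact tsum_enorm_cellAverage_sub_le h.integrable h.dx_pos h.var
  exact h.sol.tvd h.dt_pos h.lam_pos hf h.lip h.lip_nonneg h.coeff_nonneg h.small
    (summable_abs_of_tsum_enorm (ne_top_of_le_ne_top ENNReal.ofReal_ne_top h0))
    (tsum_abs_le_of_tsum_enorm_le h.var_nonneg h0) n

lemma time_diff_le (h : GoodStep g ω δ lam dt C B u₀ σ u) (n : ℕ) :
    (Summable fun j => |u (n + 1) j - u n j|) ∧
      ∑' j, |u (n + 1) j - u n j| ≤ 4 * C * lam * B :=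
  h.sol.time_diff_tsum_le h.dt_pos h.lam_pos h.lip h.lip_nonneg (weight_nonneg h.kernel h.dx_pos)
    (sum_weight h.kernel h.horizon h.dx_pos).le n (h.tv_le n).1 (h.tv_le n).2

lemma l1_initial (h : GoodStep g ω δ lam dt C B u₀ σ u) :
    ENNReal.ofReal (dt / lam) * ∑' j, ‖u 0 j‖ₑ ≤ ∫⁻ x, ‖u₀ x‖ₑ := by
  rw [h.initial_eq]
  exact tsum_enorm_cellAverage_le h.dx_pos

/-- The scheme is bounded by its variation. No maximum principle is used, as it may fail for the
reconstructed fluxes. -/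
lemma bounded (h : GoodStep g ω δ lam dt C B u₀ σ u) (n : ℕ) (j : ℤ) : |u n j| ≤ B := by
  have h0 : Summable fun j => |u 0 j| := by
    refine summable_abs_of_tsum_enorm fun htop => ?_
    have := h.l1_initial
    rw [htop, ENNReal.mul_top (by simpa using h.dx_pos), top_le_iff] at this
    exact h.integrable.2.ne this
  have hs := h.sol.summable h.dt_pos h.lam_pos h.lip h.lip_nonneg
    (weight_nonneg h.kernel h.dx_pos) (sum_weight h.kernel h.horizon h.dx_pos).le h.tv_le h0 n
  exact (abs_le_tsum_diff hs (h.tv_le n).1 j).trans (h.tv_le n).2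

lemma translationBound (h : GoodStep g ω δ lam dt C B u₀ σ u) (t : ℝ) :
    TranslationBound B fun x => piecewiseConstant (dt / lam) dt u x t :=
  translationBound_cell (tsum_enorm_le (h.tv_le _).1 (h.tv_le _).2) h.dx_pos

lemma lintegral_sub_levels_le (h : GoodStep g ω δ lam dt C B u₀ σ u) (n k : ℕ) :
    ∫⁻ x : ℝ, ‖u (n + k) ⌊x / (dt / lam) + 1 / 2⌋ - u n ⌊x / (dt / lam) + 1 / 2⌋‖ₑ
      ≤ ENNReal.ofReal (4 * C * B * (k * dt)) := by
  have hsum : ∑' j, ‖u (n + k) j - u n j‖ₑ ≤ k * ENNReal.ofReal (4 * C * lam * B) := by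
    induction k with
    | zero => simp
    | succ k ih =>
      calc ∑' j, ‖u (n + (k + 1)) j - u n j‖ₑ
          ≤ ∑' j, (‖u (n + k + 1) j - u (n + k) j‖ₑ + ‖u (n + k) j - u n j‖ₑ) := by
            refine ENNReal.tsum_le_tsum fun j => ?_
            rw [← sub_add_sub_cancel (u (n + (k + 1)) j) (u (n + k) j) (u n j)]
            exact enorm_add_le _ _
        _ ≤ ENNReal.ofReal (4 * C * lam * B) + k * ENNReal.ofReal (4 * C * lam * B) := by
            rw [ENNReal.tsum_add]
            exact add_le_add (tsum_enorm_le (h.time_diff_le _).1 (h.time_diff_le _).2) ih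
        _ = _ := by push_cast; ring
  rw [lintegral_cell (fun j => ‖u (n + k) j - u n j‖ₑ) h.dx_pos]
  refine (mul_le_mul_right hsum _).trans (le_of_eq ?_)
  have hlam := h.lam_pos
  rw [← ENNReal.ofReal_natCast, ← ENNReal.ofReal_mul (Nat.cast_nonneg _),
    ← ENNReal.ofReal_mul h.dx_pos.le]
  congr 1; field_simp

/-- Two times are at most `|t - s| / dt + 1` steps apart, which explains the extra `dt`. -/
lemma time_le (h : GoodStep g ω δ lam dt C B u₀ σ u) (s t : ℝ) :
    ∫⁻ x, ‖piecewiseConstant (dt / lam) dt u x t - piecewiseConstant (dt / lam) dt u x s‖ₑ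
      ≤ ENNReal.ofReal (4 * C * B * (|t - s| + dt)) := by
  have key : ∀ s t : ℝ, s ≤ t →
      ∫⁻ x, ‖piecewiseConstant (dt / lam) dt u x t - piecewiseConstant (dt / lam) dt u x s‖ₑ
      ≤ ENNReal.ofReal (4 * C * B * (|t - s| + dt)) := fun s t hst => by
    have hdt := h.dt_pos
    have hle : s / dt ≤ t / dt := by gcongr
    obtain ⟨k, hk⟩ := Nat.exists_eq_add_of_le (Nat.floor_mono hle)
    have h1 := abs_natFloor_sub_le hle
    rw [hk] at h1
    push_cast at h1
    rw [add_sub_cancel_left, ← sub_div, abs_div, abs_of_pos hdt] at h1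
    have h2 : k * dt ≤ |t - s| + dt := by
      have := mul_le_mul_of_nonneg_right h1 hdt.le
      rwa [add_mul, div_mul_cancel₀ _ hdt.ne', one_mul] at this
    simp only [piecewiseConstant, hk]
    refine (h.lintegral_sub_levels_le ⌊s / dt⌋₊ k).trans (ENNReal.ofReal_le_ofReal ?_)
    exact mul_le_mul_of_nonneg_left h2
      (mul_nonneg (mul_nonneg zero_le_four h.lip_nonneg) h.var_nonneg)
  rcases le_total s t with hst | hst
  · exact key s t hst
  · rw [abs_sub_comm]
    refine le_trans (le_of_eq (lintegral_congr fun x => enorm_sub_rev _ _)) (key t s hst)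

lemma lintegral_initial_sub_le (h : GoodStep g ω δ lam dt C B u₀ σ u) (hm : Measurable u₀) {t : ℝ}
    (ht : t ≤ 0) :
    ∫⁻ x, ‖piecewiseConstant (dt / lam) dt u x t - u₀ x‖ₑ
      ≤ ENNReal.ofReal (2 * B * (dt / lam)) := by
  have : ⌊t / dt⌋₊ = 0 := Nat.floor_of_nonpos (div_nonpos_of_nonpos_of_nonneg ht h.dt_pos.le)
  simp only [piecewiseConstant, this, h.initial_eq]
  exact lintegral_cellAverage_sub_le hm h.integrable h.dx_pos h.var_nonneg h.var

/-- The `L¹` norm of the error due to the reconstructed local fluxes. -/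
lemma lintegral_localUpdate_le (h : GoodStep g ω δ lam dt C B u₀ σ u) (n : ℕ) :
    ∫⁻ x : ℝ, ‖localUpdate g ω lam (dt / lam) (σ n) (u n) ⌊x / (dt / lam) + 1 / 2⌋‖ₑ
      ≤ ENNReal.ofReal (4 * C * B * weight ω (dt / lam) 0 * dt) := by
  obtain ⟨h1, h2⟩ := h.sol.localUpdate_tsum_le h.lam_pos h.lip h.lip_nonneg
    (weight_nonneg h.kernel h.dx_pos 0) n (h.tv_le n).1 (h.tv_le n).2
  rw [lintegral_cell (fun j => ‖localUpdate g ω lam (dt / lam) (σ n) (u n) j‖ₑ) h.dx_pos]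
  refine (mul_le_mul_right (tsum_enorm_le h1 h2) _).trans (le_of_eq ?_)
  have hlam := h.lam_pos
  rw [← ENNReal.ofReal_mul h.dx_pos.le]
  congr 1; field_simp

lemma uniformBounds {s : ℕ → ℝ} {σ U : ℝ → ℕ → ℤ → ℝ}
    (h : ∀ m, GoodStep g ω δ lam (s m) C B u₀ (σ (s m)) (U (s m))) (hs : Tendsto s atTop (𝓝 0)) :
    UniformBounds (fun m x t => piecewiseConstant (s m / lam) (s m) (U (s m)) x t)
      (∫⁻ x, ‖u₀ x‖ₑ).toReal B (4 * C * B) B s where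
  measurable m t := (measurable_piecewiseConstant _ _ _).comp
    (measurable_id.prodMk measurable_const)
  bounded m x t := (h m).bounded _ _
  translation m t := (h m).translationBound t
  time m s t := (h m).time_le s t
  l1 m := by
    rw [ENNReal.ofReal_toReal (h m).integrable.2.ne]
    refine le_trans (le_of_eq ?_) (h m).l1_initial
    rw [← lintegral_cell (fun j => ‖U (s m) 0 j‖ₑ) (h m).dx_pos]
    simp [piecewiseConstant]
  err_nonneg m := (h m).dt_pos.le
  err_tendsto := hs

end GoodStep

/-! ### Integrals over space-time -/

/-- The square `[-R, R] × [-R, R]` in space-time. -/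
def box (R : ℝ) : Set (ℝ × ℝ) := Icc (-R) R ×ˢ Icc (-R) R

/-- The `L¹` distance on `box R`. -/
noncomputable def boxDist (R : ℝ) (v w : ℝ × ℝ → ℝ) : ℝ := ∫ p in box R, |v p - w p|

lemma measurableSet_box (R : ℝ) : MeasurableSet (box R) := measurableSet_Icc.prod measurableSet_Icc

lemma box_mono {R R' : ℝ} (h : R ≤ R') : box R ⊆ box R' :=
  prod_mono (Icc_subset_Icc (neg_le_neg h) h) (Icc_subset_Icc (neg_le_neg h) h)

lemma volume_box_lt_top (R : ℝ) : volume (box R) < ∞ :=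
  (isCompact_Icc.prod isCompact_Icc).measure_lt_top

lemma integrable_of_box {F : ℝ × ℝ → ℝ} {c R : ℝ} (hF : Measurable F) (hc : ∀ p, |F p| ≤ c)
    (h0 : ∀ p ∉ box R, F p = 0) : Integrable F := by
  rw [← integrableOn_iff_integrable_of_support_subset
    (fun p hp => by_contra fun hn => hp (h0 p hn) : Function.support F ⊆ box R)]
  exact Measure.integrableOn_of_bounded (volume_box_lt_top R).ne hF.aestronglyMeasurable
    (ae_of_all _ hc)

lemma integrableOn_box {F : ℝ × ℝ → ℝ} {c : ℝ} (hF : Measurable F) (hc : ∀ p, |F p| ≤ c) (R : ℝ) :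
    IntegrableOn F (box R) :=
  Measure.integrableOn_of_bounded (volume_box_lt_top R).ne hF.aestronglyMeasurable (ae_of_all _ hc)

lemma abs_integral_le_setIntegral_box {F E : ℝ × ℝ → ℝ} {R : ℝ} (hE : IntegrableOn E (box R))
    (h0 : ∀ p ∉ box R, F p = 0) (h : ∀ p ∈ box R, |F p| ≤ E p) :
    |∫ p, F p| ≤ ∫ p in box R, E p := by
  rw [← setIntegral_eq_integral_of_forall_compl_eq_zero h0]
  exact norm_integral_le_of_norm_le hE ((ae_restrict_iff' (measurableSet_box R)).2
    (ae_of_all _ fun p hp => (Real.norm_eq_abs _).trans_le (h p hp)))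

lemma setIntegral_box_shift_le {E : ℝ × ℝ → ℝ} {c R H h : ℝ} (hE : Measurable E)
    (h0 : ∀ p, 0 ≤ E p) (hc : ∀ p, E p ≤ c) (hh : |h| ≤ H) :
    ∫ p in box R, E (p.1 + h, p.2) ≤ ∫ p in box (R + H), E p := by
  rw [← integral_indicator (measurableSet_box _), ← integral_indicator (measurableSet_box _),
    ← integral_add_right_eq_self ((box (R + H)).indicator E) ((h, 0) : ℝ × ℝ)]
  have hH : 0 ≤ H := (abs_nonneg h).trans hh
  have hcE : ∀ p, |E p| ≤ c := fun p => by rw [abs_of_nonneg (h0 p)]; exact hc p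
  have hi : Integrable ((box (R + H)).indicator E) :=
    (integrable_indicator_iff (measurableSet_box _)).2 (integrableOn_box hE hcE _)
  refine integral_mono_of_nonneg (ae_of_all _ fun p => indicator_nonneg (fun _ _ => h0 _) _)
    (hi.comp_add_right ((h, 0) : ℝ × ℝ)) (ae_of_all _ fun p => ?_)
  by_cases hp : p ∈ box R
  · have hp' : p + (h, 0) ∈ box (R + H) := by
      obtain ⟨⟨h1, h2⟩, h3, h4⟩ := hp
      have := abs_le.1 hh
      refine ⟨⟨?_, ?_⟩, ?_, ?_⟩ <;> simp <;> linarith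
    simp only [indicator_of_mem hp, indicator_of_mem hp']
    refine le_of_eq (congrArg E ?_)
    ext <;> simp
  · simp only [indicator_of_notMem hp]
    exact indicator_nonneg (fun _ _ => h0 _) _

/-- Convergence at every time implies convergence in space-time, by dominated convergence. -/
lemma tendsto_boxDist {v : ℕ → ℝ × ℝ → ℝ} {w : ℝ × ℝ → ℝ} {M : ℝ} (hv : ∀ m, Measurable (v m))
    (hw : Measurable w) (hvM : ∀ m p, |v m p| ≤ M) (hwM : ∀ p, |w p| ≤ M)
    (h : ∀ t, Tendsto (fun m => ∫⁻ x, ‖v m (x, t) - w (x, t)‖ₑ ∂gauss) atTop (𝓝 0)) (R : ℝ) :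
    Tendsto (fun m => boxDist R (v m) w) atTop (𝓝 0) := by
  have hm : ∀ m, Measurable fun p => |v m p - w p| := fun m => ((hv m).sub hw).abs
  have hb : ∀ m p, |(|v m p - w p|)| ≤ 2 * M := fun m p => by
    rw [abs_abs]; linarith [abs_sub (v m p) (w p), hvM m p, hwM p]
  have e : ∀ m, boxDist R (v m) w
      = ∫ t in Icc (-R) R, ∫ x in Icc (-R) R, |v m (x, t) - w (x, t)| := fun m => by
    have hi := integrableOn_box (hm m) (hb m) R
    rw [boxDist, box, Measure.volume_eq_prod, ← Measure.prod_restrict]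
    rw [IntegrableOn, box, Measure.volume_eq_prod, ← Measure.prod_restrict] at hi
    exact integral_prod_symm _ hi
  simp_rw [e]
  rw [show 𝓝 (0 : ℝ) = 𝓝 (∫ t in Icc (-R) R, (0 : ℝ)) by simp]
  refine tendsto_integral_of_dominated_convergence
    (fun _ => 2 * M * (volume (Icc (-R) R)).toReal) (fun m => ?_)
    (integrableOn_const (by simp)) (fun m => ?_) ?_
  · have h2 : StronglyMeasurable fun q : ℝ × ℝ => |v m (q.2, q.1) - w (q.2, q.1)| :=
      ((hm m).comp measurable_swap).stronglyMeasurable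
    exact h2.integral_prod_right.aestronglyMeasurable
  · refine ae_of_all _ fun t => ?_
    exact norm_setIntegral_le_of_norm_le_const (by simp) fun x _ => hb m (x, t)
  · refine ae_of_all _ fun t => ?_
    have h1 := (ENNReal.tendsto_toReal ENNReal.zero_ne_top).comp
      (tendsto_setLIntegral_of_gauss (h t) R)
    rw [ENNReal.toReal_zero] at h1
    refine h1.congr fun m => ?_
    have h2 : AEStronglyMeasurable (fun x => v m (x, t) - w (x, t))
        (volume.restrict (Icc (-R) R)) :=
      (((hv m).sub hw).comp (measurable_id.prodMk measurable_const)).aestronglyMeasurable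
    exact (integral_norm_eq_lintegral_enorm h2).symm

/-! ### The nonlocal interaction at a fixed distance -/

/-- The difference quotient in space at distance `h`; it is `0` for `h = 0`. -/
noncomputable def diffQuot (Ψ : ℝ × ℝ → ℝ) (h : ℝ) (p : ℝ × ℝ) : ℝ :=
  (Ψ (p.1 + h, p.2) - Ψ p) / h

/-- The weak form of the interaction at distance `h` with flux `G`. -/
noncomputable def interaction (Ψ : ℝ × ℝ → ℝ) (G : ℝ → ℝ → ℝ) (v : ℝ × ℝ → ℝ) (h : ℝ) : ℝ :=
  ∫ p, diffQuot Ψ h p * G (v p) (v (p.1 + h, p.2))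

/-- Lipschitz continuity of a two-point flux with constant `C`. -/
def FluxLip (C : ℝ) (G : ℝ → ℝ → ℝ) : Prop :=
  ∀ u₁ v₁ u₂ v₂, |G u₁ v₁ - G u₂ v₂| ≤ C * (|u₁ - u₂| + |v₁ - v₂|)

lemma FluxLip.continuous {C : ℝ} {G : ℝ → ℝ → ℝ} (hG : FluxLip C G) :
    Continuous fun p : ℝ × ℝ => G p.1 p.2 := by
  rw [continuous_iff_continuousAt]
  intro p
  rw [ContinuousAt, tendsto_iff_norm_sub_tendsto_zero]
  have hc : Continuous fun q : ℝ × ℝ => C * (|q.1 - p.1| + |q.2 - p.2|) := by fun_prop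
  have := hc.tendsto p
  simp only [sub_self, abs_zero, add_zero, mul_zero] at this
  exact squeeze_zero (fun _ => norm_nonneg _) (fun q => hG _ _ _ _) this

lemma FluxLip.abs_le {C : ℝ} {G : ℝ → ℝ → ℝ} (hG : FluxLip C G) (hC : 0 ≤ C) {M a b : ℝ}
    (ha : |a| ≤ M) (hb : |b| ≤ M) : |G a b| ≤ |G 0 0| + C * (M + M) := by
  have := hG a b 0 0
  rw [sub_zero, sub_zero] at this
  have h2 := abs_sub_abs_le_abs_sub (G a b) (G 0 0)
  nlinarith [mul_le_mul_of_nonneg_left (add_le_add ha hb) hC]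

/-- Test functions as they enter the interaction term: measurable, Lipschitz in space, and supported
in a box. Smoothness is not required, so that a cut-off at `t = 0` is allowed. -/
structure SpaceTest (Λ R : ℝ) (Ψ : ℝ × ℝ → ℝ) : Prop where
  measurable : Measurable Ψ
  lip : ∀ x y t, |Ψ (x, t) - Ψ (y, t)| ≤ Λ * |x - y|
  lip_nonneg : 0 ≤ Λ
  eq_zero : ∀ p ∉ box R, Ψ p = 0

section Interaction

variable {Ψ v w : ℝ × ℝ → ℝ} {G : ℝ → ℝ → ℝ} {Λ R C M H h h' : ℝ}

lemma SpaceTest.abs_diffQuot_le (hΨ : SpaceTest Λ R Ψ) (h : ℝ) (p : ℝ × ℝ) :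
    |diffQuot Ψ h p| ≤ Λ := by
  rcases eq_or_ne h 0 with rfl | h0
  · simp [diffQuot, hΨ.lip_nonneg]
  · rw [diffQuot, abs_div, div_le_iff₀ (abs_pos.2 h0)]
    simpa using hΨ.lip (p.1 + h) p.1 p.2

lemma SpaceTest.diffQuot_eq_zero (hΨ : SpaceTest Λ R Ψ) (hH : |h| ≤ H) {p : ℝ × ℝ}
    (hp : p ∉ box (R + H)) : diffQuot Ψ h p = 0 := by
  have hH0 : 0 ≤ H := (abs_nonneg h).trans hH
  have h1 : p ∉ box R := fun hn => hp (box_mono (by linarith) hn)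
  have h2 : (p.1 + h, p.2) ∉ box R := fun hn => hp (by
    obtain ⟨⟨h1, h2⟩, h3, h4⟩ := hn
    have := _root_.abs_le.1 hH
    simp only at h1 h2 h3 h4
    exact ⟨⟨by linarith, by linarith⟩, by linarith, by linarith⟩)
  rw [diffQuot, hΨ.eq_zero _ h1, hΨ.eq_zero _ h2]; simp

lemma SpaceTest.measurable_diffQuot (hΨ : SpaceTest Λ R Ψ) (h : ℝ) : Measurable (diffQuot Ψ h) := by
  have := hΨ.measurable
  unfold diffQuot
  exact ((this.comp (by fun_prop)).sub this).div_const h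

lemma measurable_flux (hG : FluxLip C G) (hv : Measurable v) (h : ℝ) :
    Measurable fun p : ℝ × ℝ => G (v p) (v (p.1 + h, p.2)) :=
  hG.continuous.measurable.comp (hv.prodMk (hv.comp (by fun_prop)))

lemma integrable_interaction (hΨ : SpaceTest Λ R Ψ) (hG : FluxLip C G) (hC : 0 ≤ C)
    (hv : Measurable v) (hvM : ∀ p, |v p| ≤ M) (h k : ℝ) :
    Integrable fun p => diffQuot Ψ h p * G (v p) (v (p.1 + k, p.2)) := by
  refine integrable_of_box (c := Λ * (|G 0 0| + C * (M + M))) (R := R + |h|)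
    ((hΨ.measurable_diffQuot h).mul (measurable_flux hG hv k)) (fun p => ?_) (fun p hp => ?_)
  · rw [abs_mul]
    exact mul_le_mul (hΨ.abs_diffQuot_le h p) (hG.abs_le hC (hvM _) (hvM _)) (abs_nonneg _)
      hΨ.lip_nonneg
  · rw [hΨ.diffQuot_eq_zero le_rfl hp, zero_mul]

lemma abs_interaction_le (hΨ : SpaceTest Λ R Ψ) (hG : FluxLip C G) (hC : 0 ≤ C)
    (hvM : ∀ p, |v p| ≤ M) (hH : |h| ≤ H) :
    |interaction Ψ G v h|
      ≤ Λ * (|G 0 0| + C * (M + M)) * (volume (box (R + H))).toReal := by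
  refine (abs_integral_le_setIntegral_box (E := fun _ => Λ * (|G 0 0| + C * (M + M)))
    (R := R + H) (integrableOn_const (volume_box_lt_top _).ne) (fun p hp => ?_)
    fun p _ => ?_).trans (le_of_eq ?_)
  · rw [hΨ.diffQuot_eq_zero hH hp, zero_mul]
  · rw [abs_mul]
    exact mul_le_mul (hΨ.abs_diffQuot_le h p) (hG.abs_le hC (hvM _) (hvM _)) (abs_nonneg _)
      hΨ.lip_nonneg
  · rw [setIntegral_const, smul_eq_mul, mul_comm]; rfl

/-- The interaction depends continuously on `v` in `L¹`, uniformly for bounded distances. -/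
lemma abs_interaction_sub_le (hΨ : SpaceTest Λ R Ψ) (hG : FluxLip C G) (hC : 0 ≤ C)
    (hv : Measurable v) (hw : Measurable w) (hvM : ∀ p, |v p| ≤ M) (hwM : ∀ p, |w p| ≤ M)
    (hH : |h| ≤ H) :
    |interaction Ψ G v h - interaction Ψ G w h| ≤ 2 * Λ * C * boxDist (R + H + H) v w := by
  have hm : Measurable fun p => |v p - w p| := (hv.sub hw).abs
  have hb : ∀ p, |v p - w p| ≤ 2 * M := fun p => by
    linarith [abs_sub (v p) (w p), hvM p, hwM p]
  have hb' : ∀ p, |(|v p - w p|)| ≤ 2 * M := fun p => by rw [abs_abs]; exact hb p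
  have hm' : Measurable fun p : ℝ × ℝ => |v (p.1 + h, p.2) - w (p.1 + h, p.2)| :=
    hm.comp (g := fun p => |v p - w p|) (by fun_prop)
  have hH0 : 0 ≤ H := (abs_nonneg h).trans hH
  rw [interaction, interaction, ← integral_sub (integrable_interaction hΨ hG hC hv hvM h h)
    (integrable_interaction hΨ hG hC hw hwM h h)]
  refine (abs_integral_le_setIntegral_box (R := R + H) (E := fun p =>
    Λ * C * (|v p - w p| + |v (p.1 + h, p.2) - w (p.1 + h, p.2)|)) ?_ (fun p hp => ?_)
    fun p _ => ?_).trans ?_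
  · exact ((integrableOn_box hm hb' _).add (integrableOn_box hm' (fun p => hb' _) _)).const_mul _
  · rw [hΨ.diffQuot_eq_zero hH hp]; ring
  · rw [← mul_sub, abs_mul, mul_assoc Λ]
    exact mul_le_mul (hΨ.abs_diffQuot_le h p) (hG _ _ _ _) (abs_nonneg _) hΨ.lip_nonneg
  · rw [integral_const_mul, integral_add (integrableOn_box hm hb' _)
      (integrableOn_box hm' (fun p => hb' _) _)]
    have h1 : ∫ p in box (R + H), |v p - w p| ≤ boxDist (R + H + H) v w :=
      setIntegral_mono_set (integrableOn_box hm hb' _) (ae_of_all _ fun p => abs_nonneg _)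
        (box_mono (by linarith)).eventuallyLE
    have h2 : ∫ p in box (R + H), |v (p.1 + h, p.2) - w (p.1 + h, p.2)|
        ≤ boxDist (R + H + H) v w :=
      setIntegral_box_shift_le (E := fun p => |v p - w p|) hm (fun p => abs_nonneg _) hb hH
    have h3 := mul_nonneg hΨ.lip_nonneg hC
    nlinarith

/-- The `L¹` modulus of translation, integrated in time over a box. -/
lemma setIntegral_box_translation_le {B : ℝ} (hB0 : 0 ≤ B) (hv : Measurable v)
    (hB : ∀ t, TranslationBound B fun x => v (x, t)) (hR : 0 ≤ R) (h k : ℝ) :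
    ∫ p in box R, |v (p.1 + h, p.2) - v (p.1 + k, p.2)| ≤ 2 * R * (B * |h - k|) := by
  have hm : Measurable fun p : ℝ × ℝ => v (p.1 + h, p.2) - v (p.1 + k, p.2) :=
    (hv.comp (by fun_prop)).sub (hv.comp (by fun_prop))
  have e := integral_norm_eq_lintegral_enorm (μ := volume.restrict (box R)) hm.aestronglyMeasurable
  simp only [Real.norm_eq_abs] at e
  rw [e]
  refine ENNReal.toReal_le_of_le_ofReal (by positivity) ?_
  rw [box, Measure.volume_eq_prod, ← Measure.prod_restrict, lintegral_prod_symm _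
    (hm.enorm.aemeasurable)]
  calc ∫⁻ t in Icc (-R) R, ∫⁻ x in Icc (-R) R, ‖v (x + h, t) - v (x + k, t)‖ₑ
      ≤ ∫⁻ t in Icc (-R) R, ENNReal.ofReal (B * |h - k|) := by
        refine lintegral_mono fun t => (setLIntegral_le_lintegral _ _).trans ?_
        rw [← lintegral_add_right_eq_self _ (-k)]
        refine le_trans (le_of_eq (lintegral_congr fun x => ?_)) (hB t (h - k))
        rw [neg_add_cancel_right, add_assoc, neg_add_eq_sub]
    _ = ENNReal.ofReal (2 * R * (B * |h - k|)) := by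
        rw [setLIntegral_const, Real.volume_Icc, ← ENNReal.ofReal_mul (by positivity)]
        congr 1; ring

/-- The interaction depends continuously on the distance `h > 0`. The translation bound on `v`
controls the change of the flux arguments. -/
lemma exists_abs_interaction_sub_le {B : ℝ} (hΨ : SpaceTest Λ R Ψ) (hG : FluxLip C G) (hC : 0 ≤ C)
    (hv : Measurable v) (hvM : ∀ p, |v p| ≤ M) (hB0 : 0 ≤ B)
    (hB : ∀ t, TranslationBound B fun x => v (x, t)) (hR : 0 ≤ R) (H : ℝ) :
    ∃ K : ℝ, ∀ h k, 0 < h → h ≤ H → 0 < k → k ≤ H →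
      |interaction Ψ G v h - interaction Ψ G v k| ≤ K * |h - k| * (1 / k + 1) := by
  have hM0 : 0 ≤ M := (abs_nonneg _).trans (hvM 0)
  set G₀ := |G 0 0| + C * (M + M) with hG₀
  have hG₀0 : 0 ≤ G₀ := by positivity
  set V := (volume (box (R + H))).toReal with hV
  have hΛ := hΨ.lip_nonneg
  refine ⟨2 * Λ * G₀ * V + Λ * C * (2 * (R + H) * B), fun h k h0 hH k0 kH => ?_⟩
  have hH0 : 0 ≤ H := h0.le.trans hH
  have i1 := integrable_interaction hΨ hG hC hv hvM h h
  have i2 := integrable_interaction hΨ hG hC hv hvM k h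
  have i3 := integrable_interaction hΨ hG hC hv hvM k k
  -- change the distance first in the difference quotient and then in the flux
  have e : interaction Ψ G v h - interaction Ψ G v k
      = (∫ p, (diffQuot Ψ h p - diffQuot Ψ k p) * G (v p) (v (p.1 + h, p.2)))
        + ∫ p, diffQuot Ψ k p * (G (v p) (v (p.1 + h, p.2)) - G (v p) (v (p.1 + k, p.2))) := by
    simp_rw [sub_mul, mul_sub]
    rw [integral_sub i1 i2, integral_sub i2 i3, interaction, interaction]
    ring
  have hq : ∀ p, |diffQuot Ψ h p - diffQuot Ψ k p| ≤ 2 * Λ * |h - k| / k := fun p => by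
    have e1 : diffQuot Ψ h p - diffQuot Ψ k p
        = (Ψ (p.1 + h, p.2) - Ψ (p.1 + k, p.2)) / k
          + (Ψ (p.1 + h, p.2) - Ψ p) * ((k - h) / (h * k)) := by
      rw [diffQuot, diffQuot]; field_simp; ring
    have a1 : |(Ψ (p.1 + h, p.2) - Ψ (p.1 + k, p.2)) / k| ≤ Λ * |h - k| / k := by
      rw [abs_div, abs_of_pos k0]
      have := hΨ.lip (p.1 + h) (p.1 + k) p.2
      rw [add_sub_add_left_eq_sub] at this
      gcongr
    have a2 : |(Ψ (p.1 + h, p.2) - Ψ p) * ((k - h) / (h * k))| ≤ Λ * |h - k| / k := by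
      rw [abs_mul, abs_div, abs_of_pos (mul_pos h0 k0), abs_sub_comm k h]
      have := hΨ.lip (p.1 + h) p.1 p.2
      rw [add_sub_cancel_left, abs_of_pos h0] at this
      calc _ ≤ Λ * h * (|h - k| / (h * k)) := by gcongr
        _ = _ := by field_simp
    rw [e1]
    refine (abs_add_le _ _).trans ((add_le_add a1 a2).trans (le_of_eq (by ring)))
  have t1 : |∫ p, (diffQuot Ψ h p - diffQuot Ψ k p) * G (v p) (v (p.1 + h, p.2))|
      ≤ 2 * Λ * |h - k| / k * G₀ * V := by
    refine (abs_integral_le_setIntegral_box (E := fun _ => 2 * Λ * |h - k| / k * G₀)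
      (R := R + H) (integrableOn_const (volume_box_lt_top _).ne) (fun p hp => ?_)
      fun p _ => ?_).trans (le_of_eq ?_)
    · rw [hΨ.diffQuot_eq_zero (by rwa [abs_of_pos h0]) hp,
        hΨ.diffQuot_eq_zero (by rwa [abs_of_pos k0]) hp]
      ring
    · rw [abs_mul]
      exact mul_le_mul (hq p) (hG.abs_le hC (hvM _) (hvM _)) (abs_nonneg _) (by positivity)
    · rw [setIntegral_const, smul_eq_mul, mul_comm]; rfl
  have t2 : |∫ p, diffQuot Ψ k p * (G (v p) (v (p.1 + h, p.2)) - G (v p) (v (p.1 + k, p.2)))|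
      ≤ Λ * C * (2 * (R + H) * (B * |h - k|)) := by
    have hm : Measurable fun p : ℝ × ℝ => |v (p.1 + h, p.2) - v (p.1 + k, p.2)| :=
      ((hv.comp (by fun_prop)).sub (hv.comp (by fun_prop))).abs
    have hb : ∀ p : ℝ × ℝ, |(|v (p.1 + h, p.2) - v (p.1 + k, p.2)|)| ≤ 2 * M := fun p => by
      rw [abs_abs]
      linarith [abs_sub (v (p.1 + h, p.2)) (v (p.1 + k, p.2)), hvM (p.1 + h, p.2),
        hvM (p.1 + k, p.2)]
    refine (abs_integral_le_setIntegral_box (R := R + H)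
      (E := fun p => Λ * C * |v (p.1 + h, p.2) - v (p.1 + k, p.2)|)
      ((integrableOn_box hm hb _).const_mul _) (fun p hp => ?_) fun p _ => ?_).trans ?_
    · rw [hΨ.diffQuot_eq_zero (by rwa [abs_of_pos k0]) hp, zero_mul]
    · rw [abs_mul, mul_assoc]
      refine mul_le_mul (hΨ.abs_diffQuot_le k p) ?_ (abs_nonneg _) hΛ
      simpa using hG (v p) (v (p.1 + h, p.2)) (v p) (v (p.1 + k, p.2))
    · rw [integral_const_mul]
      exact mul_le_mul_of_nonneg_left
        (setIntegral_box_translation_le hB0 hv hB (by positivity) h k) (by positivity)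
  rw [e]
  refine (abs_add_le _ _).trans ((add_le_add t1 t2).trans ?_)
  have hV0 : 0 ≤ V := ENNReal.toReal_nonneg
  have p1 : 0 ≤ Λ * C * (2 * (R + H) * B) * |h - k| * (1 / k) := by positivity
  have p2 : 0 ≤ 2 * Λ * G₀ * V * |h - k| := by positivity
  calc _ = 2 * Λ * G₀ * V * |h - k| * (1 / k) + Λ * C * (2 * (R + H) * B) * |h - k| := by ring
    _ ≤ _ := by nlinarith

end Interaction

/-! ### Passage to the limit -/

section Limit

variable {Ψ Φ Φt w : ℝ × ℝ → ℝ} {v : ℕ → ℝ × ℝ → ℝ} {G : ℝ → ℝ → ℝ} {η : ℝ → ℝ} {ω : ℝ → ℝ}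
  {Λ R B C M δ : ℝ} {d : ℕ → ℝ}

/-- The quadrature of the interaction term converges: at a fixed distance `h > 0` only nodes
`k * dx` within `dx` of `h` contribute, and there the interaction is close to its limit. -/
lemma tendsto_sum_weight_interaction (hω : IsInteractionKernel δ ω) (hδ : 0 < δ)
    (hd : ∀ m, 0 < d m) (hd0 : Tendsto d atTop (𝓝 0)) (hΨ : SpaceTest Λ R Ψ) (hG : FluxLip C G)
    (hC : 0 ≤ C) (hv : ∀ m, Measurable (v m)) (hw : Measurable w) (hvM : ∀ m p, |v m p| ≤ M)
    (hwM : ∀ p, |w p| ≤ M) (hB0 : 0 ≤ B) (hB : ∀ t, TranslationBound B fun x => w (x, t))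
    (hR : 0 ≤ R) (hdist : ∀ R, Tendsto (fun m => boxDist R (v m) w) atTop (𝓝 0)) :
    Tendsto (fun m => ∑ k ∈ Finset.Icc 1 (⌊δ / d m⌋₊ + 1),
      weight ω (d m) k * interaction Ψ G (v m) (k * d m)) atTop
      (𝓝 (∫ h in Ioc 0 δ, interaction Ψ G w h * ω h)) := by
  obtain ⟨K, hK⟩ := exists_abs_interaction_sub_le hΨ hG hC hw hwM hB0 hB hR (δ + 1)
  set Jm := Λ * (|G 0 0| + C * (M + M)) * (volume (box (R + (δ + 1)))).toReal with hJm
  have hM0 : 0 ≤ M := (abs_nonneg _).trans (hwM 0)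
  have hJm0 : 0 ≤ Jm := mul_nonneg (mul_nonneg hΨ.lip_nonneg (by positivity)) ENNReal.toReal_nonneg
  have hd1 : ∀ᶠ m in atTop, d m < 1 := hd0.eventually (gt_mem_nhds one_pos)
  have hsub : ∀ n : ℕ, Finset.Icc 1 (n + 1) ⊆ Finset.range (n + 2) := fun n k hk => by
    have := (Finset.mem_Icc.1 hk).2
    exact Finset.mem_range.2 (by omega)
  have hkd : ∀ m, d m < 1 → ∀ k ∈ Finset.Icc 1 (⌊δ / d m⌋₊ + 1),
      0 < (k : ℝ) * d m ∧ (k : ℝ) * d m ≤ δ + 1 := fun m hm k hk => by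
    obtain ⟨h1, h2⟩ := Finset.mem_Icc.1 hk
    have h1' : (1 : ℝ) ≤ k := by exact_mod_cast h1
    have h2' : (k : ℝ) ≤ ⌊δ / d m⌋₊ + 1 := by exact_mod_cast h2
    have h3 := Nat.floor_le (div_nonneg hδ.le (hd m).le)
    rw [le_div_iff₀ (hd m)] at h3
    have := hd m
    exact ⟨by positivity, by nlinarith⟩
  simp_rw [sum_weight_mul hω hδ (hd _)]
  refine tendsto_integral_filter_of_dominated_convergence (fun h => Jm * ω h)
    (Eventually.of_forall fun m => ?_) ?_ ((hω.integrableOn hδ).const_mul _) ?_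
  · refine AEStronglyMeasurable.mul (Continuous.aestronglyMeasurable ?_)
      (hω.integrableOn hδ).aestronglyMeasurable
    exact continuous_finsetSum _ fun k _ => (continuous_hat _ k).mul continuous_const
  · filter_upwards [hd1] with m hm
    refine (ae_restrict_iff' measurableSet_Ioc).2 (ae_of_all _ fun h hh => ?_)
    rw [norm_mul, Real.norm_of_nonneg (hω.nonneg h)]
    refine mul_le_mul_of_nonneg_right ?_ (hω.nonneg h)
    calc |∑ k ∈ Finset.Icc 1 (⌊δ / d m⌋₊ + 1), hat (d m) k h * interaction Ψ G (v m) (k * d m)|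
        ≤ ∑ k ∈ Finset.Icc 1 (⌊δ / d m⌋₊ + 1), hat (d m) k h * Jm := by
          refine (Finset.abs_sum_le_sum_abs _ _).trans (Finset.sum_le_sum fun k hk => ?_)
          rw [abs_mul, abs_of_nonneg (hat_nonneg _ _ _)]
          refine mul_le_mul_of_nonneg_left (abs_interaction_le hΨ hG hC (hvM m) ?_)
            (hat_nonneg _ _ _)
          rw [abs_of_pos (hkd m hm k hk).1]
          exact (hkd m hm k hk).2
      _ ≤ ∑ k ∈ Finset.range (⌊δ / d m⌋₊ + 2), hat (d m) k h * Jm :=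
          Finset.sum_le_sum_of_subset_of_nonneg (hsub _) fun k _ _ =>
            mul_nonneg (hat_nonneg _ _ _) hJm0
      _ = Jm := by rw [← Finset.sum_mul, hat_sum (hd m) hh.1.le hh.2, one_mul]
  · refine (ae_restrict_iff' measurableSet_Ioc).2 (ae_of_all _ fun h hh => ?_)
    refine Tendsto.mul_const _ ?_
    rw [tendsto_iff_norm_sub_tendsto_zero]
    have hlim : Tendsto (fun m => 2 * Λ * C * boxDist (R + (δ + 1) + (δ + 1)) (v m) w
        + |K| * d m * (1 / h + 1)) atTop (𝓝 0) := by
      have := ((hdist (R + (δ + 1) + (δ + 1))).const_mul (2 * Λ * C)).add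
        ((hd0.const_mul |K|).mul_const (1 / h + 1))
      simpa using this
    refine squeeze_zero' (Eventually.of_forall fun _ => norm_nonneg _) ?_ hlim
    filter_upwards [hd1, hd0.eventually (gt_mem_nhds hh.1)] with m hm hmh
    have hdm := hd m
    have h1h : 0 < 1 / h := one_div_pos.2 hh.1
    -- the node `k = 0` does not see the distance `h`, since `dx < h`
    have hone : ∑ k ∈ Finset.Icc 1 (⌊δ / d m⌋₊ + 1), hat (d m) k h = 1 := by
      rw [← hat_sum hdm hh.1.le hh.2]
      refine Finset.sum_subset (hsub _) fun k hk hk' => hat_eq_zero hdm ?_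
      have : k = 0 := by
        simp only [Finset.mem_range, Finset.mem_Icc] at hk hk'
        omega
      rw [this, Nat.cast_zero, zero_mul, sub_zero]
      exact hmh.le.trans (le_abs_self h)
    have e : (∑ k ∈ Finset.Icc 1 (⌊δ / d m⌋₊ + 1), hat (d m) k h *
        interaction Ψ G (v m) (k * d m)) - interaction Ψ G w h
        = ∑ k ∈ Finset.Icc 1 (⌊δ / d m⌋₊ + 1), hat (d m) k h *
          (interaction Ψ G (v m) (k * d m) - interaction Ψ G w h) := by
      simp_rw [mul_sub]
      rw [Finset.sum_sub_distrib, ← Finset.sum_mul, hone, one_mul]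
    rw [e, Real.norm_eq_abs]
    refine (Finset.abs_sum_le_sum_abs _ _).trans ?_
    refine le_trans (Finset.sum_le_sum (g := fun k => hat (d m) k h *
      (2 * Λ * C * boxDist (R + (δ + 1) + (δ + 1)) (v m) w + |K| * d m * (1 / h + 1)))
      fun k hk => ?_) (le_of_eq (by rw [← Finset.sum_mul, hone, one_mul]))
    rw [abs_mul, abs_of_nonneg (hat_nonneg _ _ _)]
    by_cases hkh : d m ≤ |h - k * d m|
    · rw [hat_eq_zero hdm hkh]; simp
    · refine mul_le_mul_of_nonneg_left ?_ (hat_nonneg _ _ _)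
      obtain ⟨k1, k2⟩ := hkd m hm k hk
      have a1 := abs_interaction_sub_le hΨ hG hC (hv m) hw (hvM m) hwM (h := k * d m)
        (H := δ + 1) (by rwa [abs_of_pos k1])
      have a2 := hK (k * d m) h k1 k2 hh.1 (by linarith [hh.2])
      have a3 : |(k : ℝ) * d m - h| ≤ d m := by rw [abs_sub_comm]; exact (not_le.1 hkh).le
      refine (abs_sub_le _ (interaction Ψ G w (k * d m)) _).trans (add_le_add a1 (a2.trans ?_))
      refine mul_le_mul_of_nonneg_right ?_ (by positivity)
      exact mul_le_mul (le_abs_self K) a3 (abs_nonneg _) (abs_nonneg _)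

/-- Backward difference quotients in time converge to minus the time derivative. -/
lemma tendsto_time_term (hd : ∀ m, 0 < d m) (hd0 : Tendsto d atTop (𝓝 0)) (hΦ : Measurable Φ)
    (hΛ : 0 ≤ Λ) (hΦL : ∀ x s t, |Φ (x, s) - Φ (x, t)| ≤ Λ * |s - t|)
    (hΦ0 : ∀ p ∉ box R, Φ p = 0) (hΦt : ∀ x t, HasDerivAt (fun s => Φ (x, s)) (Φt (x, t)) t)
    {Lη : ℝ} (hη : ∀ a b, |η a - η b| ≤ Lη * |a - b|) (hηc : Continuous η)
    (hv : ∀ m, Measurable (v m))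
    (hw : Measurable w) (hvM : ∀ m p, |v m p| ≤ M) (hwM : ∀ p, |w p| ≤ M)
    (hdist : ∀ R, Tendsto (fun m => boxDist R (v m) w) atTop (𝓝 0)) :
    Tendsto (fun m => ∫ p : ℝ × ℝ, (Φ (p.1, p.2 - d m) - Φ p) / d m * η (v m p)) atTop
      (𝓝 (-∫ p, Φt p * η (w p))) := by
  have hd1 : ∀ᶠ m in atTop, d m < 1 := hd0.eventually (gt_mem_nhds one_pos)
  set q : ℕ → ℝ × ℝ → ℝ := fun m p => (Φ (p.1, p.2 - d m) - Φ p) / d m with hq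
  have hqm : ∀ m, Measurable (q m) := fun m =>
    ((hΦ.comp (by fun_prop)).sub hΦ).div_const (d m)
  have hqb : ∀ m p, |q m p| ≤ Λ := fun m p => by
    rw [hq, abs_div, abs_of_pos (hd m), div_le_iff₀ (hd m)]
    have := hΦL p.1 (p.2 - d m) p.2
    rwa [sub_sub_cancel_left, abs_neg, abs_of_pos (hd m)] at this
  have hq0 : ∀ m, d m < 1 → ∀ p ∉ box (R + 1), q m p = 0 := fun m hm p hp => by
    have h1 : p ∉ box R := fun hn => hp (box_mono (by linarith) hn)
    have h2 : (p.1, p.2 - d m) ∉ box R := fun hn => hp (by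
      obtain ⟨⟨h1, h2⟩, h3, h4⟩ := hn
      have := hd m
      simp only at h1 h2 h3 h4
      exact ⟨⟨by linarith, by linarith⟩, by linarith, by linarith⟩)
    simp only [hq]
    rw [hΦ0 _ h1, hΦ0 _ h2]; simp
  have hηb : ∀ a, |a| ≤ M → |η a| ≤ |η 0| + |Lη| * M := fun a ha => by
    have h1 := hη a 0
    rw [sub_zero] at h1
    have h2 := abs_sub_abs_le_abs_sub (η a) (η 0)
    have h3 : Lη * |a| ≤ |Lη| * M := mul_le_mul (le_abs_self _) ha (abs_nonneg _) (abs_nonneg _)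
    linarith
  have hM0 : 0 ≤ M := (abs_nonneg _).trans (hwM 0)
  have hint : ∀ m, d m < 1 → ∀ f : ℝ × ℝ → ℝ, Measurable f → (∀ p, |f p| ≤ M) →
      Integrable fun p => q m p * η (f p) := fun m hm f hf hfM => by
    refine integrable_of_box (c := Λ * (|η 0| + |Lη| * M)) (R := R + 1)
      ((hqm m).mul (hηc.measurable.comp hf)) (fun p => ?_) (fun p hp => ?_)
    · rw [abs_mul]
      exact mul_le_mul (hqb m p) (hηb _ (hfM p)) (abs_nonneg _) hΛ
    · rw [hq0 m hm p hp, zero_mul]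
  have hlim : Tendsto (fun m => ∫ p, q m p * η (w p)) atTop (𝓝 (-∫ p, Φt p * η (w p))) := by
    rw [← integral_neg]
    refine tendsto_integral_filter_of_dominated_convergence
      ((box (R + 1)).indicator fun _ => Λ * (|η 0| + |Lη| * M)) ?_ ?_ ?_ ?_
    · exact Eventually.of_forall fun m =>
        ((hqm m).mul (hηc.measurable.comp hw)).aestronglyMeasurable
    · filter_upwards [hd1] with m hm
      refine ae_of_all _ fun p => ?_
      by_cases hp : p ∈ box (R + 1)
      · rw [indicator_of_mem hp, Real.norm_eq_abs, abs_mul]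
        exact mul_le_mul (hqb m p) (hηb _ (hwM p)) (abs_nonneg _) hΛ
      · rw [hq0 m hm p hp, indicator_of_notMem hp]; simp
    · exact (integrable_indicator_iff (measurableSet_box _)).2
        (integrableOn_const (volume_box_lt_top _).ne)
    · refine ae_of_all _ fun p => ?_
      rw [← neg_mul]
      refine Tendsto.mul_const _ ?_
      have h1 := (hΦt p.1 p.2).tendsto_slope_zero
      have h2 : Tendsto (fun m => -d m) atTop (𝓝[≠] 0) := by
        refine tendsto_nhdsWithin_iff.2 ⟨by simpa using hd0.neg, Eventually.of_forall fun m => ?_⟩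
        simpa using (hd m).ne'
      refine ((h1.comp h2).neg).congr fun m => ?_
      simp only [Function.comp, hq, smul_eq_mul, Prod.mk.eta, ← sub_eq_add_neg]
      rw [inv_neg, neg_mul, neg_neg, div_eq_inv_mul]
  have herr : Tendsto (fun m => (∫ p, q m p * η (v m p)) - ∫ p, q m p * η (w p)) atTop (𝓝 0) := by
    refine squeeze_zero_norm' ?_
      (show Tendsto (fun m => Λ * |Lη| * boxDist (R + 1) (v m) w) atTop (𝓝 0) by
        simpa using (hdist (R + 1)).const_mul (Λ * |Lη|))
    filter_upwards [hd1] with m hm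
    rw [← integral_sub (hint m hm _ (hv m) (hvM m)) (hint m hm _ hw hwM), Real.norm_eq_abs,
      boxDist, ← integral_const_mul]
    have hb : ∀ p, |(|v m p - w p|)| ≤ 2 * M := fun p => by
      rw [abs_abs]; linarith [abs_sub (v m p) (w p), hvM m p, hwM p]
    refine abs_integral_le_setIntegral_box
      ((integrableOn_box ((hv m).sub hw).abs hb _).const_mul _) (fun p hp => ?_) fun p _ => ?_
    · rw [hq0 m hm p hp]; ring
    · rw [← mul_sub, abs_mul, mul_assoc]
      refine mul_le_mul (hqb m p) ((hη _ _).trans ?_) (abs_nonneg _) hΛ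
      exact mul_le_mul_of_nonneg_right (le_abs_self _) (abs_nonneg _)
  have := herr.add hlim
  simpa using this

end Limit

/-! ### The balance satisfied by the scheme -/

/-- The restriction of a function to nonnegative times. -/
noncomputable def cutoff (Φ : ℝ × ℝ → ℝ) (p : ℝ × ℝ) : ℝ := if 0 ≤ p.2 then Φ p else 0

/-- The defect of the discrete balance law for the entropy `η` and the flux `G`. -/
noncomputable def residual (η : ℝ → ℝ) (G : ℝ → ℝ → ℝ) (ω : ℝ → ℝ) (δ lam dt : ℝ)
    (v : ℝ × ℝ → ℝ) (p : ℝ × ℝ) : ℝ :=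
  η (v (p.1, p.2 + dt)) - η (v p) + ∑ k ∈ Finset.Icc 1 (⌊δ / (dt / lam)⌋₊ + 1),
    coeff ω lam (dt / lam) k * (G (v p) (v (p.1 + k * (dt / lam), p.2))
      - G (v (p.1 - k * (dt / lam), p.2)) (v p))

section Balance

variable {Φ v : ℝ × ℝ → ℝ} {G : ℝ → ℝ → ℝ} {η : ℝ → ℝ} {ω : ℝ → ℝ} {Λ R C M δ lam dt : ℝ}

lemma measurable_cutoff (hΦ : Measurable Φ) : Measurable (cutoff Φ) :=
  Measurable.ite (measurableSet_le measurable_const measurable_snd) hΦ measurable_const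

/-- Summation by parts, in space and in time. There is no boundary term at `t = 0` because the
piecewise constant functions are continued to negative times by their initial values. -/
lemma integral_cutoff_residual (hdt : 0 < dt) (hlam : 0 < lam) (hΦ : Measurable Φ)
    (hΦb : ∀ p, |Φ p| ≤ Λ) (hΦ0 : ∀ p ∉ box R, Φ p = 0) (hη : Continuous η) (hG : FluxLip C G)
    (hC : 0 ≤ C) (hv : Measurable v) (hvM : ∀ p, |v p| ≤ M)
    (hv0 : ∀ x t, t < 0 → v (x, t + dt) = v (x, t)) :
    (Integrable fun p => cutoff Φ p * residual η G ω δ lam dt v p) ∧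
    ∫ p, cutoff Φ p * residual η G ω δ lam dt v p
      = dt * ((∫ p : ℝ × ℝ, (Φ (p.1, p.2 - dt) - Φ p) / dt * η (v p))
        - ∑ k ∈ Finset.Icc 1 (⌊δ / (dt / lam)⌋₊ + 1),
          weight ω (dt / lam) k * interaction (cutoff Φ) G v (k * (dt / lam))) := by
  have hΨ := measurable_cutoff hΦ
  have hΨb : ∀ p, |cutoff Φ p| ≤ Λ := fun p => by
    unfold cutoff
    split_ifs
    · exact hΦb p
    · rw [abs_zero]; exact (abs_nonneg _).trans (hΦb p)
  have hΨ0 : ∀ p ∉ box R, cutoff Φ p = 0 := fun p hp => by simp [cutoff, hΦ0 p hp]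
  have hΛ : 0 ≤ Λ := (abs_nonneg _).trans (hΦb 0)
  obtain ⟨cη, hcη⟩ : ∃ c, ∀ a, |a| ≤ M → |η a| ≤ c := by
    obtain ⟨c, hc⟩ :=
      (isCompact_Icc (a := -M) (b := M)).exists_bound_of_continuousOn hη.continuousOn
    exact ⟨c, fun a ha => hc a (abs_le.1 ha)⟩
  have hint : ∀ F E : ℝ × ℝ → ℝ, Measurable F → (∀ p, |F p| ≤ Λ) → (∀ p ∉ box R, F p = 0) →
      Measurable E → (∃ c, ∀ p, |E p| ≤ c) → Integrable fun p => F p * E p := by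
    rintro F E hF hFb hF0 hE ⟨c, hc⟩
    refine integrable_of_box (c := Λ * c) (R := R) (hF.mul hE) (fun p => ?_) fun p hp => ?_
    · rw [abs_mul]; exact mul_le_mul (hFb p) (hc p) (abs_nonneg _) hΛ
    · rw [hF0 p hp, zero_mul]
  have mη : ∀ c : ℝ, Measurable fun p : ℝ × ℝ => η (v (p.1, p.2 + c)) := fun c =>
    hη.measurable.comp (hv.comp (by fun_prop))
  have mη0 : Measurable fun p : ℝ × ℝ => η (v p) := hη.measurable.comp hv
  have bη : ∀ c : ℝ, ∃ c', ∀ p : ℝ × ℝ, |η (v (p.1, p.2 + c))| ≤ c' := fun c =>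
    ⟨cη, fun p => hcη _ (hvM _)⟩
  have bη0 : ∃ c', ∀ p : ℝ × ℝ, |η (v p)| ≤ c' := ⟨cη, fun p => hcη _ (hvM _)⟩
  have mG : ∀ a b : ℝ, Measurable fun p : ℝ × ℝ => G (v (p.1 + a, p.2)) (v (p.1 + b, p.2)) :=
    fun a b => hG.continuous.measurable.comp
      ((hv.comp (by fun_prop : Measurable fun p : ℝ × ℝ => (p.1 + a, p.2))).prodMk
        (hv.comp (by fun_prop : Measurable fun p : ℝ × ℝ => (p.1 + b, p.2))))
  have bG : ∀ a b : ℝ, ∃ c, ∀ p : ℝ × ℝ, |G (v (p.1 + a, p.2)) (v (p.1 + b, p.2))| ≤ c :=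
    fun a b => ⟨_, fun p => hG.abs_le hC (hvM _) (hvM _)⟩
  -- the two shifted copies of a flux term, in the form in which they appear in the residual
  have mG1 : ∀ b : ℝ, Measurable fun p : ℝ × ℝ => G (v p) (v (p.1 + b, p.2)) := fun b => by
    simpa using mG 0 b
  have bG1 : ∀ b : ℝ, ∃ c, ∀ p : ℝ × ℝ, |G (v p) (v (p.1 + b, p.2))| ≤ c := fun b => by
    simpa using bG 0 b
  have mG2 : ∀ a : ℝ, Measurable fun p : ℝ × ℝ => G (v (p.1 - a, p.2)) (v p) := fun a => by
    simpa [sub_eq_add_neg] using mG (-a) 0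
  have bG2 : ∀ a : ℝ, ∃ c, ∀ p : ℝ × ℝ, |G (v (p.1 - a, p.2)) (v p)| ≤ c := fun a => by
    simpa [sub_eq_add_neg] using bG (-a) 0
  have htime : ∫ p : ℝ × ℝ, cutoff Φ p * (η (v (p.1, p.2 + dt)) - η (v p))
      = dt * ∫ p : ℝ × ℝ, (Φ (p.1, p.2 - dt) - Φ p) / dt * η (v p) := by
    have e1 : ∀ p : ℝ × ℝ, cutoff Φ p * (η (v (p.1, p.2 + dt)) - η (v p))
        = Φ p * η (v (p.1, p.2 + dt)) - Φ p * η (v p) := fun p => by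
      unfold cutoff
      split_ifs with h
      · ring
      · rw [hv0 p.1 p.2 (not_le.1 h)]; ring
    have e2 : ∫ p : ℝ × ℝ, Φ p * η (v (p.1, p.2 + dt))
        = ∫ p : ℝ × ℝ, Φ (p.1, p.2 - dt) * η (v p) := by
      rw [← integral_add_right_eq_self (fun p : ℝ × ℝ => Φ (p.1, p.2 - dt) * η (v p)) (0, dt)]
      refine integral_congr_ae (ae_of_all _ fun p => ?_)
      have : p + (0, dt) = (p.1, p.2 + dt) := by ext <;> simp
      simp [this]
    have i2 : Integrable fun p : ℝ × ℝ => Φ (p.1, p.2 - dt) * η (v p) := by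
      have := (hint Φ _ hΦ hΦb hΦ0 (mη dt) (bη dt)).comp_add_right ((0, -dt) : ℝ × ℝ)
      refine this.congr (ae_of_all _ fun p => ?_)
      have : p + (0, -dt) = (p.1, p.2 + -dt) := by ext <;> simp
      simp [this, sub_eq_add_neg]
    simp_rw [e1]
    rw [integral_sub (hint Φ _ hΦ hΦb hΦ0 (mη dt) (bη dt)) (hint Φ _ hΦ hΦb hΦ0 mη0 bη0), e2,
      ← integral_sub i2 (hint Φ _ hΦ hΦb hΦ0 mη0 bη0), ← integral_const_mul]
    refine integral_congr_ae (ae_of_all _ fun p => ?_)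
    simp only
    field_simp
  have hflux : ∀ h : ℝ, h ≠ 0 →
      ∫ p : ℝ × ℝ, cutoff Φ p * (G (v p) (v (p.1 + h, p.2)) - G (v (p.1 - h, p.2)) (v p))
        = -(h * interaction (cutoff Φ) G v h) := fun h hh => by
    have i1 := hint _ _ hΨ hΨb hΨ0 (mG1 h) (bG1 h)
    have i2 := hint _ _ hΨ hΨb hΨ0 (mG2 h) (bG2 h)
    have e2 : ∫ p : ℝ × ℝ, cutoff Φ p * G (v (p.1 - h, p.2)) (v p)
        = ∫ p : ℝ × ℝ, cutoff Φ (p.1 + h, p.2) * G (v p) (v (p.1 + h, p.2)) := by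
      rw [← integral_add_right_eq_self
        (fun p : ℝ × ℝ => cutoff Φ p * G (v (p.1 - h, p.2)) (v p)) (h, 0)]
      refine integral_congr_ae (ae_of_all _ fun p => ?_)
      have : p + (h, 0) = (p.1 + h, p.2) := by ext <;> simp
      simp [this]
    have i3 : Integrable fun p : ℝ × ℝ =>
        cutoff Φ (p.1 + h, p.2) * G (v p) (v (p.1 + h, p.2)) := by
      have := i2.comp_add_right ((h, 0) : ℝ × ℝ)
      refine this.congr (ae_of_all _ fun p => ?_)
      have : p + (h, 0) = (p.1 + h, p.2) := by ext <;> simp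
      simp [this]
    simp_rw [mul_sub]
    rw [integral_sub i1 i2, e2, ← integral_sub i1 i3, interaction, ← integral_const_mul,
      ← integral_neg]
    refine integral_congr_ae (ae_of_all _ fun p => ?_)
    simp only [diffQuot]
    field_simp
    ring
  have iη : Integrable fun p : ℝ × ℝ => cutoff Φ p * (η (v (p.1, p.2 + dt)) - η (v p)) := by
    simp_rw [mul_sub]
    exact (hint _ _ hΨ hΨb hΨ0 (mη dt) (bη dt)).sub (hint _ _ hΨ hΨb hΨ0 mη0 bη0)
  have iG : ∀ h : ℝ, Integrable fun p : ℝ × ℝ =>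
      cutoff Φ p * (G (v p) (v (p.1 + h, p.2)) - G (v (p.1 - h, p.2)) (v p)) := fun h => by
    simp_rw [mul_sub]
    exact (hint _ _ hΨ hΨb hΨ0 (mG1 h) (bG1 h)).sub (hint _ _ hΨ hΨb hΨ0 (mG2 h) (bG2 h))
  have eres : ∀ p : ℝ × ℝ, cutoff Φ p * residual η G ω δ lam dt v p
      = cutoff Φ p * (η (v (p.1, p.2 + dt)) - η (v p))
        + ∑ k ∈ Finset.Icc 1 (⌊δ / (dt / lam)⌋₊ + 1), coeff ω lam (dt / lam) k *
          (cutoff Φ p * (G (v p) (v (p.1 + k * (dt / lam), p.2))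
            - G (v (p.1 - k * (dt / lam), p.2)) (v p))) := fun p => by
    rw [residual, mul_add, Finset.mul_sum]
    congr 1
    exact Finset.sum_congr rfl fun k _ => by ring
  simp_rw [eres]
  have isum : Integrable fun p : ℝ × ℝ => ∑ k ∈ Finset.Icc 1 (⌊δ / (dt / lam)⌋₊ + 1),
      coeff ω lam (dt / lam) k * (cutoff Φ p * (G (v p) (v (p.1 + k * (dt / lam), p.2))
            - G (v (p.1 - k * (dt / lam), p.2)) (v p))) :=
    integrable_finsetSum _ fun k _ => (iG _).const_mul _
  refine ⟨iη.add isum, ?_⟩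
  rw [integral_add iη isum, htime, integral_finsetSum _ fun k _ => (iG _).const_mul _, mul_sub,
    sub_eq_add_neg, Finset.mul_sum, ← Finset.sum_neg_distrib]
  congr 1
  refine Finset.sum_congr rfl fun k hk => ?_
  have hk1 : 1 ≤ k := (Finset.mem_Icc.1 hk).1
  have hk0 : (k : ℝ) ≠ 0 := by positivity
  rw [integral_const_mul, hflux _ (by positivity), coeff, max_eq_left hk1]
  field_simp

end Balance

/-! ### Test functions and the weak formulation -/

/-- The expression tested in the definitions of weak and of entropy solutions, for an entropy `η`
and an entropy flux `G`. -/
noncomputable def testFunctional (η : ℝ → ℝ) (G : ℝ → ℝ → ℝ) (ω : ℝ → ℝ) (δ T : ℝ) (u₀ : ℝ → ℝ)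
    (u : ℝ → ℝ → ℝ) (φ : ℝ → ℝ → ℝ) : ℝ :=
  (∫ t in (0 : ℝ)..T, ∫ x, η (u x t) * deriv (fun s => φ x s) t) + (∫ x, η (u₀ x) * φ x 0)
    + (∫ t in (0 : ℝ)..T, ∫ x, ∫ h in (0 : ℝ)..δ,
        (φ (x + h) t - φ x t) / h * G (u x t) (u (x + h) t) * ω h)

/-- The quantitative consequences of smoothness and compact support of a test function. -/
structure TestBounds (T Λ R : ℝ) (φ : ℝ → ℝ → ℝ) : Prop where
  radius_nonneg : 0 ≤ R
  const_nonneg : 0 ≤ Λ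
  continuous : Continuous fun p : ℝ × ℝ => φ p.1 p.2
  bound : ∀ x t, |φ x t| ≤ Λ
  lip_fst : ∀ x y t, |φ x t - φ y t| ≤ Λ * |x - y|
  lip_snd : ∀ x s t, |φ x s - φ x t| ≤ Λ * |s - t|
  eq_zero : ∀ p : ℝ × ℝ, p ∉ box R → φ p.1 p.2 = 0
  eq_zero_of_le : ∀ x t, T ≤ t → φ x t = 0
  hasDerivAt : ∀ x t, HasDerivAt (fun s => φ x s) (deriv (fun s => φ x s) t) t
  deriv_bound : ∀ x t, |deriv (fun s => φ x s) t| ≤ Λ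
  deriv_eq_zero : ∀ p : ℝ × ℝ, p ∉ box R → deriv (fun s => φ p.1 s) p.2 = 0
  deriv_eq_zero_of_le : ∀ x t, T ≤ t → deriv (fun s => φ x s) t = 0
  deriv_continuous : Continuous fun p : ℝ × ℝ => deriv (fun s => φ p.1 s) p.2

lemma IsTestFunction.exists_bounds {T : ℝ} {φ : ℝ → ℝ → ℝ} (h : IsTestFunction T φ) :
    ∃ Λ R, TestBounds T Λ R φ := by
  set Φ : ℝ × ℝ → ℝ := fun p => φ p.1 p.2 with hΦ
  have hsm : ContDiff ℝ ((⊤ : ℕ∞) : WithTop ℕ∞) Φ := h.smooth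
  have hcs : HasCompactSupport Φ := h.compact_support
  have hc1 : ContDiff ℝ 1 Φ := hsm.of_le (by exact_mod_cast le_top)
  obtain ⟨K, hK⟩ := hc1.lipschitzWith_of_hasCompactSupport hcs one_ne_zero
  obtain ⟨c, hc⟩ := hcs.exists_bound_of_continuous hsm.continuous
  obtain ⟨R, hR⟩ := hcs.isCompact.isBounded.subset_closedBall 0
  have hbox : tsupport Φ ⊆ box R := fun p hp => by
    have := hR hp
    rw [Metric.mem_closedBall, dist_zero_right, Prod.norm_def, max_le_iff, Real.norm_eq_abs,
      Real.norm_eq_abs, abs_le, abs_le] at this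
    exact this
  have hda : ∀ x t, HasDerivAt (fun s => φ x s) (fderiv ℝ Φ (x, t) (0, 1)) t := fun x t => by
    have h1 : HasFDerivAt Φ (fderiv ℝ Φ (x, t)) (x, t) :=
      (hc1.differentiable one_ne_zero (x, t)).hasFDerivAt
    have h2 : HasDerivAt (fun s : ℝ => (x, s)) ((0 : ℝ), (1 : ℝ)) t :=
      (hasDerivAt_const t x).prodMk (hasDerivAt_id t)
    exact h1.comp_hasDerivAt t h2
  have hd : ∀ x t, deriv (fun s => φ x s) t = fderiv ℝ Φ (x, t) (0, 1) := fun x t =>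
    (hda x t).deriv
  have hd0 : ∀ x t, (x, t) ∉ tsupport Φ → deriv (fun s => φ x s) t = 0 := fun x t hxt => by
    rw [hd, image_eq_zero_of_notMem_tsupport (f := fderiv ℝ Φ)
      (fun hn => hxt (tsupport_fderiv_subset ℝ hn))]
    rfl
  have hT : ∀ x t, T ≤ t → (x, t) ∉ tsupport Φ := fun x t ht hn =>
    absurd (h.tsupport_subset hn).2 (not_lt.2 ht)
  set Λ := max (max (K : ℝ) c) 0 with hΛ
  have hKΛ : (K : ℝ) ≤ Λ := (le_max_left _ _).trans (le_max_left _ _)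
  have hl2 : ∀ x s t, |φ x s - φ x t| ≤ Λ * |s - t| := fun x s t => by
    have := hK.dist_le_mul (x, s) (x, t)
    rw [Real.dist_eq, Prod.dist_eq, dist_self, max_eq_right dist_nonneg, Real.dist_eq] at this
    exact this.trans (mul_le_mul_of_nonneg_right hKΛ (abs_nonneg _))
  have hR' : box R ⊆ box (max R 0) := box_mono (le_max_left _ _)
  refine ⟨Λ, max R 0, ⟨le_max_right _ _, le_max_right _ _, hsm.continuous, fun x t => ?_,
    fun x y t => ?_, hl2, fun p hp => ?_, fun x t ht => ?_, fun x t => ?_, fun x t => ?_,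
    fun p hp => ?_, fun x t ht => ?_, ?_⟩⟩
  · exact (hc (x, t)).trans ((le_max_right _ _).trans (le_max_left _ _))
  · have := hK.dist_le_mul (x, t) (y, t)
    rw [Real.dist_eq, Prod.dist_eq, dist_self, max_eq_left dist_nonneg, Real.dist_eq] at this
    exact this.trans (mul_le_mul_of_nonneg_right hKΛ (abs_nonneg _))
  · exact image_eq_zero_of_notMem_tsupport (f := Φ) fun hn => hp (hR' (hbox hn))
  · exact image_eq_zero_of_notMem_tsupport (f := Φ) (hT x t ht)
  · rw [hd]; exact hda x t
  · rw [hd, ← Real.norm_eq_abs]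
    refine (ContinuousLinearMap.le_opNorm _ _).trans ?_
    have h1 : ‖fderiv ℝ Φ (x, t)‖ ≤ Λ := (norm_fderiv_le_of_lipschitz ℝ hK).trans hKΛ
    have h2 : ‖((0 : ℝ), (1 : ℝ))‖ = 1 := by simp [Prod.norm_def]
    rw [h2, mul_one]
    exact h1
  · exact hd0 _ _ fun hn => hp (hR' (hbox hn))
  · exact hd0 _ _ (hT x t ht)
  · simp_rw [hd]
    exact (hc1.continuous_fderiv one_ne_zero).clm_apply continuous_const

section Functional

variable {T Λ R C M δ : ℝ} {φ : ℝ → ℝ → ℝ} {η : ℝ → ℝ} {G : ℝ → ℝ → ℝ} {ω : ℝ → ℝ}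
  {w : ℝ × ℝ → ℝ}

lemma TestBounds.spaceTest (h : TestBounds T Λ R φ) :
    SpaceTest Λ R (cutoff fun p => φ p.1 p.2) where
  measurable := measurable_cutoff h.continuous.measurable
  lip x y t := by
    unfold cutoff
    split_ifs
    · exact h.lip_fst x y t
    · simpa using mul_nonneg h.const_nonneg (abs_nonneg _)
  lip_nonneg := h.const_nonneg
  eq_zero p hp := by simp [cutoff, h.eq_zero p hp]

lemma integrable_interaction_prod (hω : IsInteractionKernel δ ω) (hδ : 0 < δ)
    {Ψ : ℝ × ℝ → ℝ} (hΨ : SpaceTest Λ R Ψ) (hG : FluxLip C G) (hC : 0 ≤ C) (hw : Measurable w)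
    (hwM : ∀ p, |w p| ≤ M) :
    Integrable (fun q : (ℝ × ℝ) × ℝ => diffQuot Ψ q.2 q.1 * G (w q.1) (w (q.1.1 + q.2, q.1.2))
      * ω q.2) (volume.prod (volume.restrict (Ioc 0 δ))) := by
  have hi := hω.integrableOn hδ
  have hb : Integrable ((box (R + δ)).indicator fun _ => Λ * (|G 0 0| + C * (M + M))) :=
    (integrable_indicator_iff (measurableSet_box _)).2
      (integrableOn_const (volume_box_lt_top _).ne)
  refine (hb.mul_prod hi).mono' ?_ ?_
  · refine AEStronglyMeasurable.mul (Measurable.aestronglyMeasurable (Measurable.mul ?_ ?_))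
      hi.aestronglyMeasurable.comp_snd
    · have := hΨ.measurable
      unfold diffQuot
      exact ((this.comp (by fun_prop)).sub (this.comp (by fun_prop))).div measurable_snd
    · exact hG.continuous.measurable.comp ((hw.comp (by fun_prop)).prodMk (hw.comp (by fun_prop)))
  · have : ∀ᵐ q : (ℝ × ℝ) × ℝ ∂(volume.prod (volume.restrict (Ioc 0 δ))), q.2 ∈ Ioc 0 δ :=
      Measure.quasiMeasurePreserving_snd.ae (ae_restrict_mem measurableSet_Ioc)
    filter_upwards [this] with q hq
    rw [norm_mul, Real.norm_of_nonneg (hω.nonneg _)]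
    refine mul_le_mul_of_nonneg_right ?_ (hω.nonneg _)
    by_cases hp : q.1 ∈ box (R + δ)
    · rw [indicator_of_mem hp, norm_mul]
      exact mul_le_mul (hΨ.abs_diffQuot_le _ _) (hG.abs_le hC (hwM _) (hwM _)) (abs_nonneg _)
        hΨ.lip_nonneg
    · rw [hΨ.diffQuot_eq_zero (by rw [abs_of_pos hq.1]; exact hq.2) hp, zero_mul, norm_zero,
        indicator_of_notMem hp]

/-- Integrating over the distance last gives the interaction term of the weak formulation. -/
lemma interaction_term_eq (hω : IsInteractionKernel δ ω) (hδ : 0 < δ) (hT : 0 < T)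
    (h : TestBounds T Λ R φ) (hG : FluxLip C G) (hC : 0 ≤ C) (hw : Measurable w)
    (hwM : ∀ p, |w p| ≤ M) :
    (∫ t in (0 : ℝ)..T, ∫ x, ∫ h in (0 : ℝ)..δ,
        (φ (x + h) t - φ x t) / h * G (w (x, t)) (w (x + h, t)) * ω h)
      = ∫ h in Ioc 0 δ, interaction (cutoff fun p => φ p.1 p.2) G w h * ω h := by
  have hi := integrable_interaction_prod hω hδ h.spaceTest hG hC hw hwM
  have e1 : ∀ h, interaction (cutoff fun p => φ p.1 p.2) G w h * ω h
      = ∫ p : ℝ × ℝ, diffQuot (cutoff fun p => φ p.1 p.2) h p * G (w p) (w (p.1 + h, p.2)) * ω h :=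
    fun h => by rw [interaction, integral_mul_const]
  simp_rw [e1]
  rw [← integral_integral_swap hi]
  have hi2 := hi.integral_prod_left
  rw [Measure.volume_eq_prod] at hi2 ⊢
  rw [integral_prod_symm _ hi2, intervalIntegral.integral_of_le hT.le,
    ← integral_Icc_eq_integral_Ioc]
  have hz : ∀ t ∉ Icc 0 T, ∫ x : ℝ, ∫ h in Ioc 0 δ, diffQuot (cutoff fun p => φ p.1 p.2) h (x, t)
      * G (w (x, t)) (w ((x, t).1 + h, (x, t).2)) * ω h = 0 := fun t ht => by
    have : ∀ x : ℝ, cutoff (fun p => φ p.1 p.2) (x, t) = 0 := fun x => by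
      unfold cutoff
      split_ifs with h0
      · exact h.eq_zero_of_le _ _ (le_of_not_ge fun hn => ht ⟨h0, hn⟩)
      · rfl
    simp [diffQuot, this]
  rw [← setIntegral_eq_integral_of_forall_compl_eq_zero hz]
  refine setIntegral_congr_fun measurableSet_Icc fun t ht => ?_
  simp only [intervalIntegral.integral_of_le hδ.le]
  refine integral_congr_ae (ae_of_all _ fun x => integral_congr_ae (ae_of_all _ fun h => ?_))
  simp [diffQuot, cutoff, ht.1]

lemma TestBounds.integral_Iic_deriv (h : TestBounds T Λ R φ) (htest : IsTestFunction T φ) (x : ℝ) :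
    ∫ t in Iic (0 : ℝ), deriv (fun s => φ x s) t = φ x 0 := by
  have hsx : ContDiff ℝ 1 fun s => φ x s :=
    (htest.smooth.of_le (by exact_mod_cast le_top)).comp (contDiff_const.prodMk contDiff_id)
  have hcx : HasCompactSupport fun s => φ x s :=
    HasCompactSupport.intro (isCompact_Icc (a := -R) (b := R)) fun s hs =>
      h.eq_zero (x, s) fun hb => hs hb.2
  exact HasCompactSupport.integral_Iic_deriv_eq hsx hcx 0

/-- The time derivative term, with the initial datum as the values at nonpositive times: integrating
`∂ₜφ` over these times produces the initial term of the weak formulation. -/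
lemma time_term_eq (hT : 0 < T) (h : TestBounds T Λ R φ) (htest : IsTestFunction T φ)
    (hη : Continuous η) (hw : Measurable w)
    (hwM : ∀ p, |w p| ≤ M) {u₀ : ℝ → ℝ} (hu₀ : ∀ t ≤ 0, ∀ᵐ x, w (x, t) = u₀ x) :
    ∫ p : ℝ × ℝ, deriv (fun s => φ p.1 s) p.2 * η (w p)
      = (∫ t in (0 : ℝ)..T, ∫ x, η (w (x, t)) * deriv (fun s => φ x s) t)
        + ∫ x, η (u₀ x) * φ x 0 := by
  obtain ⟨c, hc⟩ := (isCompact_Icc (a := -M) (b := M)).exists_bound_of_continuousOn hη.continuousOn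
  have hηb : ∀ p, |η (w p)| ≤ c := fun p => hc _ (abs_le.1 (hwM p))
  have hint : Integrable fun p : ℝ × ℝ => deriv (fun s => φ p.1 s) p.2 * η (w p) := by
    refine integrable_of_box (c := Λ * c) (R := R)
      (h.deriv_continuous.measurable.mul (hη.measurable.comp hw)) (fun p => ?_) fun p hp => ?_
    · rw [abs_mul]
      exact mul_le_mul (h.deriv_bound _ _) (hηb p) (abs_nonneg _) h.const_nonneg
    · rw [h.deriv_eq_zero p hp, zero_mul]
  have hint0 : Integrable fun p : ℝ × ℝ => deriv (fun s => φ p.1 s) p.2 * η (w (p.1, 0)) := by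
    refine integrable_of_box (c := Λ * c) (R := R)
      (h.deriv_continuous.measurable.mul (hη.measurable.comp (hw.comp (by fun_prop))))
      (fun p => ?_) fun p hp => ?_
    · rw [abs_mul]
      exact mul_le_mul (h.deriv_bound _ _) (hηb _) (abs_nonneg _) h.const_nonneg
    · rw [h.deriv_eq_zero p hp, zero_mul]
  rw [Measure.volume_eq_prod] at hint ⊢
  rw [integral_prod_symm _ hint]
  have hi2 := hint.integral_prod_right
  rw [← setIntegral_univ, ← Iic_union_Ioi (a := (0 : ℝ)), setIntegral_union
    (Iic_disjoint_Ioi le_rfl) measurableSet_Ioi hi2.integrableOn hi2.integrableOn, add_comm]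
  congr 1
  · rw [intervalIntegral.integral_of_le hT.le]
    refine (setIntegral_eq_of_subset_of_forall_sdiff_eq_zero (s := Ioc 0 T) (t := Ioi 0)
      measurableSet_Ioi
      Ioc_subset_Ioi_self fun t ht => ?_).trans ?_
    · have : T ≤ t := le_of_not_gt fun hn => ht.2 ⟨ht.1, hn.le⟩
      simp [h.deriv_eq_zero_of_le _ _ this]
    · exact setIntegral_congr_fun measurableSet_Ioc fun t _ =>
        integral_congr_ae (ae_of_all _ fun x => mul_comm _ _)
  · have e1 : ∫ t in Iic (0 : ℝ), ∫ x, deriv (fun s => φ x s) t * η (w (x, t))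
        = ∫ t in Iic (0 : ℝ), ∫ x, deriv (fun s => φ x s) t * η (w (x, 0)) := by
      refine setIntegral_congr_fun measurableSet_Iic fun t ht => integral_congr_ae ?_
      filter_upwards [hu₀ t ht, hu₀ 0 le_rfl] with x h1 h2
      rw [h1, h2]
    rw [e1]
    have hsw : Integrable (Function.uncurry fun (t x : ℝ) =>
        deriv (fun s => φ x s) t * η (w (x, 0))) ((volume.restrict (Iic 0)).prod volume) := by
      rw [Measure.volume_eq_prod] at hint0
      have : Integrable (fun q : ℝ × ℝ => deriv (fun s => φ q.2 s) q.1 * η (w (q.2, 0)))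
        (volume.prod volume) := hint0.swap
      have h3 := this.restrict (s := Iic 0 ×ˢ univ)
      rwa [← Measure.prod_restrict, Measure.restrict_univ] at h3
    rw [integral_integral_swap hsw]
    refine integral_congr_ae ?_
    filter_upwards [hu₀ 0 le_rfl] with x hx
    rw [integral_mul_const, hx, mul_comm]
    congr 1
    exact h.integral_Iic_deriv htest x

end Functional

/-! ### Limits of the scheme -/

lemma setIntegral_box_abs_le {E : ℝ × ℝ → ℝ} {c R : ℝ} (hE : Measurable E) (hc : 0 ≤ c)
    (hR : 0 ≤ R) (h : ∀ t, ∫⁻ x, ‖E (x, t)‖ₑ ≤ ENNReal.ofReal c) :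
    IntegrableOn (fun p => |E p|) (box R) ∧ ∫ p in box R, |E p| ≤ 2 * R * c := by
  have hle : ∫⁻ p in box R, ‖E p‖ₑ ≤ ENNReal.ofReal (2 * R * c) := by
    rw [box, Measure.volume_eq_prod, ← Measure.prod_restrict, lintegral_prod_symm _
      (hE.enorm.aemeasurable)]
    calc ∫⁻ t in Icc (-R) R, ∫⁻ x in Icc (-R) R, ‖E (x, t)‖ₑ
        ≤ ∫⁻ t in Icc (-R) R, ENNReal.ofReal c :=
          lintegral_mono fun t => (setLIntegral_le_lintegral _ _).trans (h t)
      _ = ENNReal.ofReal (2 * R * c) := by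
          rw [setLIntegral_const, Real.volume_Icc, ← ENNReal.ofReal_mul hc]
          congr 1; ring
  refine ⟨Integrable.abs ⟨hE.aestronglyMeasurable, hle.trans_lt ENNReal.ofReal_lt_top⟩, ?_⟩
  have e := integral_norm_eq_lintegral_enorm (μ := volume.restrict (box R)) hE.aestronglyMeasurable
  simp only [Real.norm_eq_abs] at e
  rw [e]
  exact ENNReal.toReal_le_of_le_ofReal (by positivity) hle

section Residual

variable {g G : ℝ → ℝ → ℝ} {η : ℝ → ℝ} {ω : ℝ → ℝ} {δ lam dt C B : ℝ} {u₀ : ℝ → ℝ}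
  {σ u : ℕ → ℤ → ℝ}

/-- The part of the update that is due to the reconstructed interface fluxes, as a function on
space-time. -/
noncomputable def localError (g : ℝ → ℝ → ℝ) (ω : ℝ → ℝ) (lam dt : ℝ) (σ u : ℕ → ℤ → ℝ)
    (p : ℝ × ℝ) : ℝ :=
  piecewiseConstant (dt / lam) dt (fun n => localUpdate g ω lam (dt / lam) (σ n) (u n)) p.1 p.2

lemma residual_eq (hdt : 0 < dt) (hlam : 0 < lam) {p : ℝ × ℝ} (hp : 0 ≤ p.2) :
    residual η G ω δ lam dt (fun p => piecewiseConstant (dt / lam) dt u p.1 p.2) p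
      = η (u (⌊p.2 / dt⌋₊ + 1) ⌊p.1 / (dt / lam) + 1 / 2⌋)
        - η (u ⌊p.2 / dt⌋₊ ⌊p.1 / (dt / lam) + 1 / 2⌋)
        + ∑ k ∈ Finset.Icc 1 (⌊δ / (dt / lam)⌋₊ + 1), coeff ω lam (dt / lam) k *
          (G (u ⌊p.2 / dt⌋₊ ⌊p.1 / (dt / lam) + 1 / 2⌋)
              (u ⌊p.2 / dt⌋₊ (⌊p.1 / (dt / lam) + 1 / 2⌋ + k))
            - G (u ⌊p.2 / dt⌋₊ (⌊p.1 / (dt / lam) + 1 / 2⌋ - k))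
              (u ⌊p.2 / dt⌋₊ ⌊p.1 / (dt / lam) + 1 / 2⌋)) := by
  have hdx : dt / lam ≠ 0 := (div_pos hdt hlam).ne'
  have ht : ⌊(p.2 + dt) / dt⌋₊ = ⌊p.2 / dt⌋₊ + 1 := by
    rw [add_div, div_self hdt.ne', Nat.floor_add_one (div_nonneg hp hdt.le)]
  have hx : ∀ k : ℕ, ⌊(p.1 + k * (dt / lam)) / (dt / lam) + 1 / 2⌋
      = ⌊p.1 / (dt / lam) + 1 / 2⌋ + k := fun k => by
    rw [add_div, mul_div_cancel_right₀ _ hdx, add_right_comm, Int.floor_add_natCast]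
  have hx' : ∀ k : ℕ, ⌊(p.1 - k * (dt / lam)) / (dt / lam) + 1 / 2⌋
      = ⌊p.1 / (dt / lam) + 1 / 2⌋ - k := fun k => by
    rw [sub_div, mul_div_cancel_right₀ _ hdx, sub_add_eq_add_sub, Int.floor_sub_natCast]
  simp only [residual, piecewiseConstant, ht, hx, hx']

/-- For the identity as entropy the residual is exactly the local error. -/
lemma GoodStep.residual_id (h : GoodStep g ω δ lam dt C B u₀ σ u) {p : ℝ × ℝ} (hp : 0 ≤ p.2) :
    residual id g ω δ lam dt (fun p => piecewiseConstant (dt / lam) dt u p.1 p.2) p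
      = -localError g ω lam dt σ u p := by
  rw [residual_eq h.dt_pos h.lam_pos hp, id, id, h.sol.step_eq h.dt_pos h.lam_pos, localError,
    piecewiseConstant]
  ring

lemma GoodStep.residual_abs_le (h : GoodStep g ω δ lam dt C B u₀ σ u) (c : ℝ) {p : ℝ × ℝ}
    (hp : 0 ≤ p.2) :
    residual (fun a => |a - c|) (entropyFlux g c) ω δ lam dt
      (fun p => piecewiseConstant (dt / lam) dt u p.1 p.2) p ≤ |localError g ω lam dt σ u p| := by
  obtain ⟨f, hf⟩ := h.flux
  rw [residual_eq h.dt_pos h.lam_pos hp]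
  exact h.sol.entropy_step h.dt_pos h.lam_pos hf h.lip h.lip_nonneg h.coeff_nonneg h.small c _ _

lemma FluxLip.entropyFlux {C : ℝ} (hC : 0 ≤ C) (hg : FluxLip C g) (c : ℝ) :
    FluxLip (2 * C) (entropyFlux g c) := fun u₁ v₁ u₂ v₂ => by
  have h1 := hg (max u₁ c) (max v₁ c) (max u₂ c) (max v₂ c)
  have h2 := hg (min u₁ c) (min v₁ c) (min u₂ c) (min v₂ c)
  have e : ∀ a b : ℝ, |max a c - max b c| ≤ |a - b| := fun a b => by
    have := abs_max_sub_max_le_max a c b c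
    simpa using this
  have e' : ∀ a b : ℝ, |min a c - min b c| ≤ |a - b| := fun a b => by
    have := abs_min_sub_min_le_max a c b c
    simpa using this
  unfold PairInteraction.entropyFlux
  rw [sub_sub_sub_comm]
  refine (abs_sub _ _).trans ((add_le_add h1 h2).trans ?_)
  have := add_le_add (mul_le_mul_of_nonneg_left (add_le_add (e u₁ u₂) (e v₁ v₂)) hC)
    (mul_le_mul_of_nonneg_left (add_le_add (e' u₁ u₂) (e' v₁ v₂)) hC)
  linarith

end Residual

section Limit

variable {g G : ℝ → ℝ → ℝ} {η : ℝ → ℝ} {ω : ℝ → ℝ} {δ T lam C C' B Lη : ℝ} {u₀ : ℝ → ℝ}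
  {s : ℕ → ℝ} {σ U : ℝ → ℕ → ℤ → ℝ} {w : ℝ × ℝ → ℝ} {φ : ℝ → ℝ → ℝ}

/-- A limit of scheme solutions, for a sequence of time steps: the data that are shared by the weak
and the entropy formulation. -/
structure SchemeLimit (g : ℝ → ℝ → ℝ) (ω : ℝ → ℝ) (δ lam C B : ℝ) (u₀ : ℝ → ℝ)
    (s : ℕ → ℝ) (σ U : ℝ → ℕ → ℤ → ℝ) (w : ℝ × ℝ → ℝ) : Prop where
  good : ∀ m, GoodStep g ω δ lam (s m) C B u₀ (σ (s m)) (U (s m))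
  step_tendsto : Tendsto s atTop (𝓝 0)
  measurable : Measurable w
  bounded : ∀ p, |w p| ≤ B
  translation : ∀ t, TranslationBound B fun x => w (x, t)
  integrable : ∀ t, Integrable fun x => w (x, t)
  time : ∀ s t, ∫⁻ x, ‖w (x, t) - w (x, s)‖ₑ ≤ ENNReal.ofReal (4 * C * B * |t - s|)
  tendsto : ∀ t, Tendsto (fun m => ∫⁻ x,
    ‖piecewiseConstant (s m / lam) (s m) (U (s m)) x t - w (x, t)‖ₑ ∂gauss) atTop (𝓝 0)

lemma exists_schemeLimit
    (h : ∀ m, GoodStep g ω δ lam (s m) C B u₀ (σ (s m)) (U (s m))) (hs : Tendsto s atTop (𝓝 0)) :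
    ∃ κ : ℕ → ℕ, StrictMono κ ∧ ∃ w, SchemeLimit g ω δ lam C B u₀ (s ∘ κ) σ U w := by
  have hC := (h 0).lip_nonneg
  have hB := (h 0).var_nonneg
  obtain ⟨κ, hκ, w, h1, h2, h3, h4, h5, h6⟩ :=
    (GoodStep.uniformBounds h hs).exists_subseq_tendsto hB (by positivity) hB
  exact ⟨κ, hκ, w, ⟨fun m => h (κ m), hs.comp hκ.tendsto_atTop, h1, h2, h5, h4, h6, h3⟩⟩

lemma SchemeLimit.initial (h : SchemeLimit g ω δ lam C B u₀ s σ U w) (hm : Measurable u₀) {t : ℝ}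
    (ht : t ≤ 0) : ∀ᵐ x, w (x, t) = u₀ x := by
  have hw : Measurable fun x => w (x, t) := h.measurable.comp (by fun_prop)
  set F : ℕ → ℝ → ℝ := fun m x => piecewiseConstant (s m / lam) (s m) (U (s m)) x t with hF
  have hFm : ∀ m, Measurable (F m) := fun m => (measurable_piecewiseConstant _ _ _).comp
    (measurable_id.prodMk measurable_const)
  have h1 : Tendsto (fun m => ENNReal.ofReal (2 * B * (s m / lam))) atTop (𝓝 0) := by
    have := ENNReal.tendsto_ofReal ((h.step_tendsto.div_const lam).const_mul (2 * B))
    simpa using this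
  have h2 : Tendsto (fun m => ∫⁻ x, ‖F m x - u₀ x‖ₑ ∂gauss) atTop (𝓝 0) :=
    tendsto_of_tendsto_of_tendsto_of_le_of_le tendsto_const_nhds h1 (fun _ => zero_le) fun m =>
      (lintegral_mono' gauss_le_volume le_rfl).trans ((h.good m).lintegral_initial_sub_le hm ht)
  have h3 : ∀ m, ∫⁻ x, ‖w (x, t) - u₀ x‖ₑ ∂gauss
      ≤ (∫⁻ x, ‖F m x - w (x, t)‖ₑ ∂gauss) + ∫⁻ x, ‖F m x - u₀ x‖ₑ ∂gauss := fun m => by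
    have hm' : Measurable fun x => ‖F m x - w (x, t)‖ₑ := ((hFm m).sub hw).enorm
    rw [← lintegral_add_left hm']
    refine lintegral_mono fun x => ?_
    rw [enorm_sub_rev (F m x) (w (x, t)), ← sub_add_sub_cancel (w (x, t)) (F m x) (u₀ x)]
    exact enorm_add_le _ _
  have h4 : ∫⁻ x, ‖w (x, t) - u₀ x‖ₑ ∂gauss = 0 := by
    have h5 := (h.tendsto t).add h2
    rw [add_zero] at h5
    exact le_antisymm (ge_of_tendsto' h5 h3) zero_le
  have hwu : Measurable fun x => ‖w (x, t) - u₀ x‖ₑ := (hw.sub hm).enorm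
  rw [lintegral_eq_zero_iff hwu] at h4
  filter_upwards [volume_absolutelyContinuous_gauss.ae_le h4] with x hx
  exact sub_eq_zero.1 (enorm_eq_zero.1 hx)

/-- Passage to the limit in the discrete balance, which holds up to the local error. -/
lemma SchemeLimit.testFunctional_nonneg (h : SchemeLimit g ω δ lam C B u₀ s σ U w)
    (hm : Measurable u₀) (hT : 0 < T) (hη : ∀ a b, |η a - η b| ≤ Lη * |a - b|)
    (hηc : Continuous η) (hG : FluxLip C' G) (hC' : 0 ≤ C') (hφ : IsTestFunction T φ)
    (hres : ∀ m (p : ℝ × ℝ), 0 ≤ p.2 → φ p.1 p.2 * residual η G ω δ lam (s m)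
        (fun p => piecewiseConstant (s m / lam) (s m) (U (s m)) p.1 p.2) p
      ≤ |φ p.1 p.2| * |localError g ω lam (s m) (σ (s m)) (U (s m)) p|) :
    0 ≤ testFunctional η G ω δ T u₀ (fun x t => w (x, t)) φ := by
  obtain ⟨Λ, R, hb⟩ := hφ.exists_bounds
  have hω := (h.good 0).kernel
  have hδ := (h.good 0).horizon
  have hlam := (h.good 0).lam_pos
  have hC := (h.good 0).lip_nonneg
  have hB := (h.good 0).var_nonneg
  have hs : ∀ m, 0 < s m := fun m => (h.good m).dt_pos
  set v : ℕ → ℝ × ℝ → ℝ :=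
    fun m p => piecewiseConstant (s m / lam) (s m) (U (s m)) p.1 p.2 with hv
  have hvm : ∀ m, Measurable (v m) := fun m => measurable_piecewiseConstant _ _ _
  have hvM : ∀ m p, |v m p| ≤ B := fun m p => (h.good m).bounded _ _
  have hdist := tendsto_boxDist hvm h.measurable hvM h.bounded h.tendsto
  have hd0 : Tendsto (fun m => s m / lam) atTop (𝓝 0) := by
    simpa using h.step_tendsto.div_const lam
  have l1 := tendsto_time_term hs h.step_tendsto hb.continuous.measurable hb.const_nonneg
    (Φ := fun p => φ p.1 p.2) (Φt := fun p => deriv (fun s => φ p.1 s) p.2) hb.lip_snd hb.eq_zero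
    hb.hasDerivAt hη hηc hvm h.measurable hvM h.bounded hdist
  have l2 := tendsto_sum_weight_interaction hω hδ (fun m => (h.good m).dx_pos) hd0 hb.spaceTest hG
    hC' hvm h.measurable hvM h.bounded hB h.translation hb.radius_nonneg hdist
  have l3 : Tendsto (fun m => Λ * (2 * R * (4 * C * B * weight ω (s m / lam) 0))) atTop (𝓝 0) := by
    have hd0' : Tendsto (fun m => s m / lam) atTop (𝓝[>] 0) :=
      tendsto_nhdsWithin_iff.2 ⟨hd0, Eventually.of_forall fun m => (h.good m).dx_pos⟩
    have := (((tendsto_weight_zero hω hδ).comp hd0').const_mul (4 * C * B)).const_mul (2 * R)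
    simpa using this.const_mul Λ
  have key := le_of_tendsto_of_tendsto' (l1.sub l2) l3 fun m => ?_
  · unfold testFunctional
    rw [interaction_term_eq hω hδ hT hb hG hC' h.measurable h.bounded]
    have := time_term_eq hT hb hφ hηc h.measurable h.bounded fun t ht => h.initial hm ht
    rw [← this]
    linarith
  · have hv0 : ∀ x t, t < 0 → v m (x, t + s m) = v m (x, t) := fun x t ht => by
      have e1 : ⌊(t + s m) / s m⌋₊ = 0 :=
        Nat.floor_eq_zero.2 (by rw [div_lt_one (hs m)]; linarith)
      have e2 : ⌊t / s m⌋₊ = 0 :=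
        Nat.floor_of_nonpos (div_nonpos_of_nonpos_of_nonneg ht.le (hs m).le)
      simp only [hv, piecewiseConstant, e1, e2]
    obtain ⟨hi, he⟩ := integral_cutoff_residual (G := G) (η := η) (ω := ω) (δ := δ) (R := R) (hs m)
      hlam (Φ := fun p => φ p.1 p.2)
      hb.continuous.measurable (fun p => hb.bound _ _) hb.eq_zero hηc hG hC' (hvm m) (hvM m) hv0
    have hEm : Measurable (localError g ω lam (s m) (σ (s m)) (U (s m))) :=
      measurable_piecewiseConstant _ _ _
    have hW := weight_nonneg hω (h.good m).dx_pos 0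
    have hsm := hs m
    obtain ⟨hE1, hE2⟩ := setIntegral_box_abs_le (R := R)
      (c := 4 * C * B * weight ω (s m / lam) 0 * s m) hEm
      (by positivity) hb.radius_nonneg fun t => (h.good m).lintegral_localUpdate_le ⌊t / s m⌋₊
    have hle : ∫ p, cutoff (fun p => φ p.1 p.2) p * residual η G ω δ lam (s m) (v m) p
        ≤ Λ * (2 * R * (4 * C * B * weight ω (s m / lam) 0 * s m)) := by
      have hz : ∀ p ∉ box R,
          cutoff (fun p => φ p.1 p.2) p * residual η G ω δ lam (s m) (v m) p = 0 :=
        fun p hp => by simp [cutoff, hb.eq_zero p hp]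
      rw [← setIntegral_eq_integral_of_forall_compl_eq_zero hz]
      refine le_trans (setIntegral_mono hi.integrableOn (hE1.const_mul Λ) fun p => ?_) ?_
      · simp only [cutoff]
        split_ifs with hp
        · exact (hres m p hp).trans (mul_le_mul_of_nonneg_right (hb.bound _ _) (abs_nonneg _))
        · rw [zero_mul]
          exact mul_nonneg hb.const_nonneg (abs_nonneg _)
      · rw [integral_const_mul]
        exact mul_le_mul_of_nonneg_left hE2 hb.const_nonneg
    rw [he] at hle
    refine le_of_mul_le_mul_left (hle.trans (le_of_eq ?_)) hsm
    ring

lemma SchemeLimit.memLInfty (h : SchemeLimit g ω δ lam C B u₀ s σ U w) :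
    MemLInfty T fun x t => w (x, t) :=
  memLp_top_of_bound h.measurable.aestronglyMeasurable B (ae_of_all _ h.bounded)

lemma SchemeLimit.continuousInL1 (h : SchemeLimit g ω δ lam C B u₀ s σ U w) :
    ContinuousInL1 T fun x t => w (x, t) := by
  refine ⟨fun t _ => h.integrable t, fun s _ => ?_⟩
  have h1 : Tendsto (fun t => ENNReal.ofReal (4 * C * B * |t - s|)) (𝓝[Icc 0 T] s) (𝓝 0) := by
    have hc : Continuous fun t => ENNReal.ofReal (4 * C * B * |t - s|) :=
      ENNReal.continuous_ofReal.comp (by fun_prop)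
    have := (hc.tendsto s).mono_left (nhdsWithin_le_nhds (s := Icc 0 T))
    simpa using this
  refine tendsto_of_tendsto_of_tendsto_of_le_of_le tendsto_const_nhds h1 (fun _ => zero_le)
    fun t => ?_
  simp only
  rw [eLpNorm_one_eq_lintegral_enorm]
  exact h.time s t

lemma IsTestFunction.neg (h : IsTestFunction T φ) : IsTestFunction T fun x t => -φ x t where
  smooth := h.smooth.neg
  compact_support := h.compact_support.neg
  tsupport_subset := by
    have : tsupport (fun p : ℝ × ℝ => -φ p.1 p.2) = tsupport fun p : ℝ × ℝ => φ p.1 p.2 := by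
      simp only [tsupport, Function.support_fun_neg]
    rw [this]
    exact h.tsupport_subset

lemma testFunctional_neg (u : ℝ → ℝ → ℝ) :
    testFunctional η G ω δ T u₀ u (fun x t => -φ x t) = -testFunctional η G ω δ T u₀ u φ := by
  have e : ∀ x t h : ℝ, ∀ a b : ℝ, (-φ (x + h) t - -φ x t) / h * a * b
      = -((φ (x + h) t - φ x t) / h * a * b) := fun x t h a b => by ring
  simp only [testFunctional, deriv.fun_neg, mul_neg, integral_neg, intervalIntegral.integral_neg, e]
  ring

lemma SchemeLimit.isWeakSolution (h : SchemeLimit g ω δ lam C B u₀ s σ U w)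
    (hm : Measurable u₀) (hT : 0 < T) : IsWeakSolution g ω δ T u₀ fun x t => w (x, t) where
  memLInfty := h.memLInfty
  weak_form φ hφ := by
    -- for an affine entropy both signs of the test function are allowed
    have key : ∀ φ, IsTestFunction T φ →
        0 ≤ testFunctional id g ω δ T u₀ (fun x t => w (x, t)) φ := fun φ hφ =>
      h.testFunctional_nonneg (Lη := 1) hm hT (fun a b => by simp) continuous_id (h.good 0).lip
        (h.good 0).lip_nonneg hφ fun m p hp => by
          rw [(h.good m).residual_id hp, ← abs_neg (localError _ _ _ _ _ _ _), ← abs_mul]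
          exact le_abs_self _
    have h1 := key φ hφ
    have h2 := key _ hφ.neg
    rw [testFunctional_neg] at h2
    exact le_antisymm (neg_nonneg.1 h2) h1

lemma SchemeLimit.isEntropySolution (h : SchemeLimit g ω δ lam C B u₀ s σ U w)
    (hm : Measurable u₀) (hT : 0 < T) : IsEntropySolution g ω δ T u₀ fun x t => w (x, t) where
  memLInfty := h.memLInfty
  entropy_ineq c φ hφ hφ0 := by
    have hC := (h.good 0).lip_nonneg
    refine h.testFunctional_nonneg (Lη := 1) hm hT (η := fun a => |a - c|) (fun a b => ?_)
      (by fun_prop) (FluxLip.entropyFlux hC (h.good 0).lip c) (by positivity) hφ fun m p hp => ?_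
    · rw [one_mul]
      refine (abs_abs_sub_abs_le _ _).trans (le_of_eq ?_)
      rw [sub_sub_sub_cancel_right]
    · rw [abs_of_nonneg (hφ0 _ _ hp)]
      exact mul_le_mul_of_nonneg_left ((h.good m).residual_abs_le c hp) (hφ0 _ _ hp)

end Limit

/-! ### Entropy solutions on the whole space-time -/

section Extension

variable {g G : ℝ → ℝ → ℝ} {η : ℝ → ℝ} {ω : ℝ → ℝ} {δ T C M Λ R : ℝ} {u₀ ū : ℝ → ℝ}
  {u v : ℝ → ℝ → ℝ} {w : ℝ × ℝ → ℝ} {φ : ℝ → ℝ → ℝ}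

lemma ae_ae_of_ae_strip {P : ℝ × ℝ → Prop}
    (h : ∀ᵐ p ∂(volume.restrict ((univ : Set ℝ) ×ˢ Ioo 0 T)), P p) :
    ∀ᵐ t ∂(volume.restrict (Ioc 0 T)), ∀ᵐ x, P (x, t) := by
  rw [Measure.volume_eq_prod, ← Measure.prod_restrict, Measure.restrict_univ] at h
  rw [← restrict_Ioo_eq_restrict_Ioc]
  exact Measure.ae_ae_of_ae_prod (Measure.measurePreserving_swap.quasiMeasurePreserving.ae h)

lemma testFunctional_congr (hT : 0 ≤ T) (hδ : 0 ≤ δ) (h0 : u₀ =ᵐ[volume] ū)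
    (h : ∀ᵐ t ∂(volume.restrict (Ioc 0 T)), ∀ᵐ x, u x t = v x t) :
    testFunctional η G ω δ T u₀ u φ = testFunctional η G ω δ T ū v φ := by
  unfold testFunctional
  simp only [intervalIntegral.integral_of_le hT, intervalIntegral.integral_of_le hδ]
  congr 1
  · congr 1
    · refine integral_congr_ae (h.mono fun t ht => integral_congr_ae ?_)
      filter_upwards [ht] with x hx
      rw [hx]
    · refine integral_congr_ae ?_
      filter_upwards [h0] with x hx
      rw [hx]
  · refine integral_congr_ae (h.mono fun t ht => integral_congr_ae ?_)
    filter_upwards [ht] with x hx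
    refine integral_congr_ae (ae_restrict_of_ae ?_)
    filter_upwards [(quasiMeasurePreserving_add_left volume x).ae ht] with h hh
    rw [hx, hh]

lemma MemLInfty.exists_bound (h : MemLInfty T v) :
    ∃ M, ∀ᵐ p : ℝ × ℝ ∂(volume.restrict (univ ×ˢ Ioo 0 T)), |v p.1 p.2| ≤ M := by
  have h2 := h.2
  rw [eLpNorm_exponent_top] at h2
  refine ⟨(eLpNormEssSup (fun p : ℝ × ℝ => v p.1 p.2) (volume.restrict (univ ×ˢ Ioo 0 T))).toReal,
    ?_⟩
  filter_upwards [ae_le_eLpNormEssSup (f := fun p : ℝ × ℝ => v p.1 p.2)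
    (μ := volume.restrict (univ ×ˢ Ioo 0 T))] with p hp
  have := ENNReal.toReal_mono h2.ne hp
  simpa using this

/-- A bounded function on the strip `ℝ × (0, T)` has a measurable, bounded representative, which is
continued to nonpositive times by given initial values. -/
lemma MemLInfty.exists_extension (h : MemLInfty T v)
    (hM : ∀ᵐ p : ℝ × ℝ ∂(volume.restrict (univ ×ˢ Ioo 0 T)), |v p.1 p.2| ≤ M)
    (hM0 : 0 ≤ M) (hū : Measurable ū) (hūM : ∀ x, |ū x| ≤ M) :
    ∃ w : ℝ × ℝ → ℝ, Measurable w ∧ (∀ p, |w p| ≤ M) ∧ (∀ x, ∀ t ≤ 0, w (x, t) = ū x) ∧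
      ∀ᵐ p : ℝ × ℝ ∂(volume.restrict (univ ×ˢ Ioo 0 T)), v p.1 p.2 = w p := by
  set V := h.1.mk with hV
  refine ⟨fun p => if p.2 ≤ 0 then ū p.1 else max (-M) (min M (V p)), ?_, fun p => ?_,
    fun x t ht => if_pos ht, ?_⟩
  · exact Measurable.ite (measurableSet_le measurable_snd measurable_const)
      (hū.comp measurable_fst)
      (measurable_const.max (measurable_const.min h.1.stronglyMeasurable_mk.measurable))
  · simp only
    split_ifs
    · exact hūM _
    · exact abs_le.2 ⟨le_max_left _ _, max_le (by linarith) (min_le_left _ _)⟩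
  · have hmem : ∀ᵐ p : ℝ × ℝ ∂(volume.restrict (univ ×ˢ Ioo 0 T)),
        p ∈ (univ : Set ℝ) ×ˢ Ioo 0 T :=
      ae_restrict_mem (MeasurableSet.univ.prod measurableSet_Ioo)
    filter_upwards [h.1.ae_eq_mk, hM, hmem] with p h1 h2 h3
    rw [if_neg (not_le.2 h3.2.1)]
    rw [h1] at h2 ⊢
    obtain ⟨h4, h5⟩ := abs_le.1 h2
    rw [min_eq_right h5, max_eq_right h4]

lemma TestBounds.integral_deriv_eq_zero (h : TestBounds T Λ R φ) :
    Integrable (fun p : ℝ × ℝ => deriv (fun s => φ p.1 s) p.2) ∧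
      ∫ p : ℝ × ℝ, deriv (fun s => φ p.1 s) p.2 = 0 := by
  have hint : Integrable fun p : ℝ × ℝ => deriv (fun s => φ p.1 s) p.2 :=
    integrable_of_box h.deriv_continuous.measurable (fun p => h.deriv_bound _ _) h.deriv_eq_zero
  refine ⟨hint, ?_⟩
  rw [Measure.volume_eq_prod, integral_prod _ hint]
  refine integral_eq_zero_of_ae (ae_of_all _ fun x => ?_)
  have hcx : HasCompactSupport fun s => φ x s :=
    HasCompactSupport.intro (isCompact_Icc (a := -R) (b := R)) fun s hs =>
      h.eq_zero (x, s) fun hb => hs hb.2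
  have hcont : Continuous fun s => φ x s := h.continuous.comp
    (Continuous.prodMk continuous_const continuous_id)
  have hcd : Continuous fun s => deriv (fun s => φ x s) s := h.deriv_continuous.comp
    (Continuous.prodMk continuous_const continuous_id)
  exact integral_eq_zero_of_hasDerivAt_of_integrable (fun t => h.hasDerivAt x t)
    (hcd.integrable_of_hasCompactSupport hcx.deriv) (hcont.integrable_of_hasCompactSupport hcx)

/-- Adding constants to the entropy and to the flux does not change the terms of the weak
formulation, written as integrals over the whole plane. -/
lemma weak_terms_add_const (h : TestBounds T Λ R φ)
    (hG : FluxLip C G) (hC : 0 ≤ C) (hw : Measurable w) (hwM : ∀ p, |w p| ≤ M) (a b : ℝ) :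
    (∫ p : ℝ × ℝ, deriv (fun s => φ p.1 s) p.2 * (w p + a))
        + (∫ h in Ioc 0 δ, interaction (cutoff fun p => φ p.1 p.2) (fun x y => G x y + b) w h * ω h)
      = (∫ p : ℝ × ℝ, deriv (fun s => φ p.1 s) p.2 * w p)
        + ∫ h in Ioc 0 δ, interaction (cutoff fun p => φ p.1 p.2) G w h * ω h := by
  obtain ⟨hi, h0⟩ := h.integral_deriv_eq_zero
  congr 1
  · have hi2 : Integrable fun p : ℝ × ℝ => deriv (fun s => φ p.1 s) p.2 * w p :=
      hi.mul_bdd hw.aestronglyMeasurable (ae_of_all _ hwM)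
    simp_rw [mul_add]
    rw [integral_add hi2 (hi.mul_const a), integral_mul_const, h0, zero_mul, add_zero]
  · refine integral_congr_ae (ae_of_all _ fun k => ?_)
    simp only
    congr 1
    have hΨ := h.spaceTest
    have i1 := integrable_interaction hΨ hG hC hw hwM k k
    have iΨ : Integrable (cutoff fun p => φ p.1 p.2) := by
      refine integrable_of_box hΨ.measurable (c := Λ) (fun p => ?_) hΨ.eq_zero
      unfold cutoff
      split_ifs
      · exact h.bound _ _
      · simpa using h.const_nonneg
    have es : ∀ p : ℝ × ℝ, p + (k, 0) = (p.1 + k, p.2) := fun p => by ext <;> simp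
    have i3 := iΨ.comp_add_right ((k, 0) : ℝ × ℝ)
    have i2 : Integrable (diffQuot (cutoff fun p => φ p.1 p.2) k) := by
      refine ((i3.sub iΨ).div_const k).congr (ae_of_all _ fun p => ?_)
      simp only [Pi.sub_apply, es, diffQuot]
    have z2 : ∫ p, diffQuot (cutoff fun p => φ p.1 p.2) k p = 0 := by
      have e1 : ∀ p, diffQuot (cutoff fun p => φ p.1 p.2) k p
          = (cutoff (fun p => φ p.1 p.2) (p + (k, 0)) - cutoff (fun p => φ p.1 p.2) p) / k :=
        fun p => by rw [es, diffQuot]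
      simp_rw [e1]
      rw [integral_div, integral_sub i3 iΨ, integral_add_right_eq_self, sub_self, zero_div]
    simp only [interaction, mul_add]
    rw [integral_add i1 (i2.mul_const b), integral_mul_const, z2, zero_mul, add_zero]

/-- The Kruzhkov inequalities with constants outside the range of a solution give the weak
formulation. -/
lemma IsEntropySolution.weak_eq (hg : FluxLip C g) (hC : 0 ≤ C) (hω : IsInteractionKernel δ ω)
    (hδ : 0 < δ) (hT : 0 < T) (hv : IsEntropySolution g ω δ T u₀ v) (hu : u₀ =ᵐ[volume] ū)
    (hw : Measurable w) (hwM : ∀ p, |w p| ≤ M) (hw0 : ∀ x, ∀ t ≤ 0, w (x, t) = ū x)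
    (hvw : ∀ᵐ p : ℝ × ℝ ∂(volume.restrict (univ ×ˢ Ioo 0 T)), v p.1 p.2 = w p)
    (hφ : IsTestFunction T φ) (hφ0 : ∀ x t, 0 ≤ φ x t) :
    (∫ p : ℝ × ℝ, deriv (fun s => φ p.1 s) p.2 * w p)
        + (∫ h in Ioc 0 δ, interaction (cutoff fun p => φ p.1 p.2) g w h * ω h) = 0 := by
  obtain ⟨Λ, R, hb⟩ := hφ.exists_bounds
  have key : ∀ c : ℝ, 0 ≤ (∫ p : ℝ × ℝ, deriv (fun s => φ p.1 s) p.2 * |w p - c|)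
      + ∫ h in Ioc 0 δ, interaction (cutoff fun p => φ p.1 p.2) (entropyFlux g c) w h * ω h := by
    intro c
    have h1 : 0 ≤ testFunctional (fun a => |a - c|) (entropyFlux g c) ω δ T u₀ v φ :=
      hv.entropy_ineq c φ hφ fun x t _ => hφ0 x t
    rw [testFunctional_congr (v := fun x t => w (x, t)) hT.le hδ.le hu (ae_ae_of_ae_strip hvw),
      testFunctional, interaction_term_eq hω hδ hT hb (FluxLip.entropyFlux hC hg c) (by positivity)
      hw hwM, ← time_term_eq (η := fun a => |a - c|) hT hb hφ (by fun_prop) hw hwM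
        fun t ht => ae_of_all _ fun x => hw0 x t ht] at h1
    exact h1
  have hwb : ∀ p, -M ≤ w p ∧ w p ≤ M := fun p => abs_le.1 (hwM p)
  refine le_antisymm ?_ ?_
  -- above the range the entropy is `M - w`, below the range it is `w + M`
  · have h1 := key M
    have e1 : ∀ p, |w p - M| = -(w p + -M) := fun p =>
      abs_of_nonpos (by linarith [(hwb p).2]) |>.trans (by ring)
    have e2 : ∀ h, interaction (cutoff fun p => φ p.1 p.2) (entropyFlux g M) w h
        = -interaction (cutoff fun p => φ p.1 p.2) (fun x y => g x y + -g M M) w h := fun h => by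
      simp only [interaction, entropyFlux, max_eq_right (hwb _).2, min_eq_left (hwb _).2]
      rw [← integral_neg]
      refine integral_congr_ae (ae_of_all _ fun p => ?_)
      simp only
      ring
    simp only [e1, e2, mul_neg, neg_mul, integral_neg] at h1
    rw [← neg_add, weak_terms_add_const hb hg hC hw hwM] at h1
    linarith
  · have h1 := key (-M)
    have e1 : ∀ p, |w p - -M| = w p + M := fun p =>
      abs_of_nonneg (by linarith [(hwb p).1]) |>.trans (by ring)
    have e2 : ∀ h, interaction (cutoff fun p => φ p.1 p.2) (entropyFlux g (-M)) w h
        = interaction (cutoff fun p => φ p.1 p.2) (fun x y => g x y + -g (-M) (-M)) w h :=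
      fun h => by
        simp only [interaction, entropyFlux, max_eq_left (hwb _).1, min_eq_right (hwb _).1]
        rfl
    simp only [e1, e2] at h1
    rwa [weak_terms_add_const hb hg hC hw hwM] at h1

end Extension

/-! ### Integrated form of a transport identity -/

section Transport

variable {d a ψ : ℝ × ℝ → ℝ} {T D K A : ℝ}

/-- Integrals over the forward time shifts by `0 < s ≤ T`. -/
noncomputable def forwardAverage (T : ℝ) (ψ : ℝ × ℝ → ℝ) (p : ℝ × ℝ) : ℝ :=
  ∫ s in Ioc 0 T, ψ (p.1, p.2 + s)

/-- Integrals over the backward time shifts by `0 < s ≤ T`. -/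
noncomputable def backwardAverage (T : ℝ) (a : ℝ × ℝ → ℝ) (p : ℝ × ℝ) : ℝ :=
  ∫ s in Ioc 0 T, a (p.1, p.2 - s)

/-- The forward average is the convolution with the uniform measure on a vertical segment. -/
lemma contDiff_forwardAverage (hψ : ContDiff ℝ ((⊤ : ℕ∞) : WithTop ℕ∞) ψ)
    (hc : HasCompactSupport ψ) : ContDiff ℝ ((⊤ : ℕ∞) : WithTop ℕ∞) (forwardAverage T ψ) := by
  set μ : Measure (ℝ × ℝ) := (volume.restrict (Ioc 0 T)).map fun s => ((0 : ℝ), -s) with hμ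
  have hm : Measurable fun s : ℝ => ((0 : ℝ), -s) := by fun_prop
  have hf : LocallyIntegrable (fun _ : ℝ × ℝ => (1 : ℝ)) μ :=
    (integrable_const (1 : ℝ)).locallyIntegrable
  have h := hc.contDiff_convolution_right (ContinuousLinearMap.lsmul ℝ ℝ) hf hψ
  convert h using 1
  ext p
  rw [convolution, hμ, integral_map hm.aemeasurable]
  · refine integral_congr_ae (ae_of_all _ fun s => ?_)
    have : p - (0, -s) = (p.1, p.2 + s) := by ext <;> simp
    simp [this]
  · have := hψ.continuous
    exact Continuous.aestronglyMeasurable (by simp only [ContinuousLinearMap.lsmul_apply]; fun_prop)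

lemma forwardAverage_eq_sub (hT : 0 < T) (hψ : Continuous ψ) (x t : ℝ) :
    forwardAverage T ψ (x, t)
      = (∫ r in (0 : ℝ)..(t + T), ψ (x, r)) - ∫ r in (0 : ℝ)..t, ψ (x, r) := by
  have hc : Continuous fun r => ψ (x, r) := by fun_prop
  rw [forwardAverage, ← intervalIntegral.integral_of_le hT.le,
    intervalIntegral.integral_comp_add_left (fun r => ψ (x, r)),
    intervalIntegral.integral_interval_sub_left (hc.intervalIntegrable _ _)
      (hc.intervalIntegrable _ _), add_zero]

lemma hasDerivAt_forwardAverage (hT : 0 < T) (hψ : Continuous ψ) (x t : ℝ) :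
    HasDerivAt (fun t => forwardAverage T ψ (x, t)) (ψ (x, t + T) - ψ (x, t)) t := by
  have hc : Continuous fun r => ψ (x, r) := by fun_prop
  have h1 : ∀ t, HasDerivAt (fun t => ∫ r in (0 : ℝ)..t, ψ (x, r)) (ψ (x, t)) t := fun t =>
    (hc.integral_hasStrictDerivAt 0 t).hasDerivAt
  have h2 := ((h1 (t + T)).comp_add_const t T).sub (h1 t)
  refine h2.congr_of_eventuallyEq (Eventually.of_forall fun t => ?_)
  exact forwardAverage_eq_sub hT hψ x t

lemma forwardAverage_nonneg (hψ : ∀ p, 0 ≤ ψ p) (p : ℝ × ℝ) : 0 ≤ forwardAverage T ψ p :=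
  integral_nonneg fun _ => hψ _

lemma exists_box_of_hasCompactSupport (hc : HasCompactSupport ψ) :
    ∃ R, 0 ≤ R ∧ ∀ p ∉ box R, ψ p = 0 := by
  obtain ⟨R, hR⟩ := hc.isCompact.isBounded.subset_closedBall 0
  refine ⟨max R 0, le_max_right _ _, fun p hp => image_eq_zero_of_notMem_tsupport fun hn => hp ?_⟩
  have := hR hn
  rw [Metric.mem_closedBall, dist_zero_right, Prod.norm_def, max_le_iff, Real.norm_eq_abs,
    Real.norm_eq_abs, abs_le, abs_le] at this
  exact box_mono (le_max_left _ _) this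

lemma exists_lt_of_tsupport_subset (hc : HasCompactSupport ψ)
    (hs : tsupport ψ ⊆ univ ×ˢ Iio T) : ∃ T' < T, ∀ p : ℝ × ℝ, T' < p.2 → ψ p = 0 := by
  rcases (tsupport ψ).eq_empty_or_nonempty with he | hne
  · exact ⟨T - 1, by linarith, fun p _ => image_eq_zero_of_notMem_tsupport (by simp [he])⟩
  · obtain ⟨q, hq, hmax⟩ := hc.isCompact.exists_isMaxOn hne continuous_snd.continuousOn
    exact ⟨q.2, (hs hq).2, fun p hp =>
      image_eq_zero_of_notMem_tsupport fun hn => absurd (hmax hn) (not_le.2 hp)⟩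

lemma isTestFunction_forwardAverage (hψ : ContDiff ℝ ((⊤ : ℕ∞) : WithTop ℕ∞) ψ)
    (hc : HasCompactSupport ψ) (hs : tsupport ψ ⊆ univ ×ˢ Iio T) :
    IsTestFunction T fun x t => forwardAverage T ψ (x, t) where
  smooth := contDiff_forwardAverage hψ hc
  compact_support := by
    obtain ⟨R, hR0, hR⟩ := exists_box_of_hasCompactSupport hc
    refine HasCompactSupport.intro (K := Icc (-R) R ×ˢ Icc (-R - T) R)
      (isCompact_Icc.prod isCompact_Icc) fun p hp => ?_
    refine setIntegral_eq_zero_of_forall_eq_zero fun s hs => hR _ fun hn => hp ?_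
    have h1 := hn.2.1
    have h2 := hn.2.2
    simp only at h1 h2
    exact ⟨hn.1, by linarith [hs.2], by linarith [hs.1]⟩
  tsupport_subset := by
    obtain ⟨T', hT', h0⟩ := exists_lt_of_tsupport_subset hc hs
    have hcl : IsClosed ((univ : Set ℝ) ×ˢ Iic T') := isClosed_univ.prod isClosed_Iic
    refine (closure_minimal (fun p hp => ?_) hcl).trans
      (prod_mono_right fun t (ht : t ≤ T') => ht.trans_lt hT')
    refine ⟨mem_univ _, mem_Iic.2 (not_lt.1 fun hlt => hp ?_)⟩
    refine setIntegral_eq_zero_of_forall_eq_zero fun s hs => h0 _ ?_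
    simp only
    linarith [hs.1]

lemma measurable_backwardAverage (ha : Measurable a) : Measurable (backwardAverage T a) := by
  have : Measurable fun q : (ℝ × ℝ) × ℝ => a (q.1.1, q.1.2 - q.2) := ha.comp (by fun_prop)
  exact this.stronglyMeasurable.integral_prod_right'.measurable

lemma abs_backwardAverage_le (hT : 0 < T) (hA : ∀ p, |a p| ≤ A) (p : ℝ × ℝ) :
    |backwardAverage T a p| ≤ A * T := by
  have := norm_setIntegral_le_of_norm_le_const (μ := volume) (s := Ioc 0 T) (C := A)
    (f := fun s => a (p.1, p.2 - s)) (by simp) fun s _ => hA _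
  rw [backwardAverage]
  simpa [hT.le] using this

/-- Forward and backward averages are adjoint to each other. -/
lemma integral_forwardAverage_mul (hψ : Continuous ψ)
    (hc : HasCompactSupport ψ) (ha : Measurable a) (hA : ∀ p, |a p| ≤ A) :
    ∫ p, forwardAverage T ψ p * a p = ∫ p, ψ p * backwardAverage T a p := by
  obtain ⟨R, hR0, hR⟩ := exists_box_of_hasCompactSupport hc
  obtain ⟨c, hcb⟩ := hc.exists_bound_of_continuous hψ
  have hA0 : 0 ≤ A := (abs_nonneg _).trans (hA 0)
  have i2 : Integrable (fun q : (ℝ × ℝ) × ℝ => ψ q.1 * a (q.1.1, q.1.2 - q.2))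
      (volume.prod (volume.restrict (Ioc 0 T))) := by
    have hb : Integrable (fun p => |ψ p|) := (hψ.integrable_of_hasCompactSupport hc).abs
    refine (hb.mul_prod (integrable_const (α := ℝ) (μ := volume.restrict (Ioc 0 T)) A)).mono'
      (Measurable.aestronglyMeasurable ?_) (ae_of_all _ fun q => ?_)
    · exact (hψ.measurable.comp measurable_fst).mul (ha.comp (by fun_prop))
    · rw [norm_mul]
      exact mul_le_mul_of_nonneg_left (hA _) (abs_nonneg _)
  have i1 : Integrable (fun q : (ℝ × ℝ) × ℝ => ψ (q.1.1, q.1.2 + q.2) * a q.1)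
      (volume.prod (volume.restrict (Ioc 0 T))) := by
    have hb : Integrable ((box (R + |T|)).indicator fun _ => c * A) :=
      (integrable_indicator_iff (measurableSet_box _)).2
        (integrableOn_const (volume_box_lt_top _).ne)
    refine (hb.mul_prod (integrable_const (α := ℝ) (μ := volume.restrict (Ioc 0 T)) 1)).mono'
      (Measurable.aestronglyMeasurable ?_) ?_
    · exact (hψ.measurable.comp (by fun_prop)).mul (ha.comp (by fun_prop))
    · have : ∀ᵐ q : (ℝ × ℝ) × ℝ ∂(volume.prod (volume.restrict (Ioc 0 T))), q.2 ∈ Ioc 0 T :=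
        Measure.quasiMeasurePreserving_snd.ae (ae_restrict_mem measurableSet_Ioc)
      filter_upwards [this] with q hq
      rw [mul_one]
      by_cases hp : q.1 ∈ box (R + |T|)
      · rw [indicator_of_mem hp, norm_mul]
        exact mul_le_mul (hcb _) (hA _) (abs_nonneg _) ((norm_nonneg _).trans (hcb 0))
      · rw [indicator_of_notMem hp, hR, zero_mul, norm_zero]
        rintro ⟨⟨h1, h2⟩, h3, h4⟩
        simp only at h1 h2 h3 h4
        have := le_abs_self T
        exact hp ⟨⟨by linarith [hq.1, hq.2], by linarith [hq.1, hq.2]⟩,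
          by linarith [hq.1, hq.2], by linarith [hq.1, hq.2]⟩
  calc ∫ p, forwardAverage T ψ p * a p
      = ∫ p : ℝ × ℝ, ∫ s in Ioc 0 T, ψ (p.1, p.2 + s) * a p := by
        simp_rw [integral_mul_const]; rfl
    _ = ∫ s in Ioc 0 T, ∫ p : ℝ × ℝ, ψ (p.1, p.2 + s) * a p := integral_integral_swap i1
    _ = ∫ s in Ioc 0 T, ∫ p : ℝ × ℝ, ψ p * a (p.1, p.2 - s) := by
        refine integral_congr_ae (ae_of_all _ fun s => ?_)
        simp only
        rw [← integral_add_right_eq_self (fun p : ℝ × ℝ => ψ p * a (p.1, p.2 - s)) (0, s)]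
        refine integral_congr_ae (ae_of_all _ fun p => ?_)
        have : p + (0, s) = (p.1, p.2 + s) := by ext <;> simp
        simp [this]
    _ = ∫ p : ℝ × ℝ, ∫ s in Ioc 0 T, ψ p * a (p.1, p.2 - s) := (integral_integral_swap i2).symm
    _ = _ := by simp_rw [integral_const_mul]; rfl

/-- A smooth compactly supported function below time `T` is a difference of two nonnegative ones. -/
lemma exists_nonneg_decomposition (hψ : ContDiff ℝ ((⊤ : ℕ∞) : WithTop ℕ∞) ψ)
    (hc : HasCompactSupport ψ) (hs : tsupport ψ ⊆ univ ×ˢ Iio T) :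
    ∃ χ : ℝ × ℝ → ℝ, ContDiff ℝ ((⊤ : ℕ∞) : WithTop ℕ∞) χ ∧ HasCompactSupport χ ∧
      tsupport χ ⊆ univ ×ˢ Iio T ∧ (∀ p, 0 ≤ χ p) ∧ ∀ p, 0 ≤ ψ p + χ p := by
  obtain ⟨R, hR0, hR⟩ := exists_box_of_hasCompactSupport hc
  obtain ⟨T', hT', h0⟩ := exists_lt_of_tsupport_subset hc hs
  obtain ⟨c, hcb⟩ := hc.exists_bound_of_continuous hψ.continuous
  have hc0 : 0 ≤ c := (norm_nonneg _).trans (hcb 0)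
  set ρ := R + |T'| + 1 with hρ
  have hρ0 : 0 < ρ := by positivity
  -- one bump function in space, and one in time that equals `1` on `[T' - 2 * ρ, T']`
  let b₁ : ContDiffBump (0 : ℝ) := ⟨R + 1, R + 2, by positivity, by linarith⟩
  let b₂ : ContDiffBump (T' - ρ) := ⟨ρ, ρ + (T - T') / 2, hρ0, by linarith⟩
  have hsub : tsupport (fun p : ℝ × ℝ => c * (b₁ p.1 * b₂ p.2))
      ⊆ Metric.closedBall 0 (R + 2) ×ˢ Metric.closedBall (T' - ρ) (ρ + (T - T') / 2) := by
    refine closure_minimal (fun p hp => ?_)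
      (Metric.isClosed_closedBall.prod Metric.isClosed_closedBall)
    have h1 : b₁ p.1 ≠ 0 := fun h => hp (by simp [h])
    have h2 : b₂ p.2 ≠ 0 := fun h => hp (by simp [h])
    have h1' : p.1 ∈ Function.support b₁ := h1
    have h2' : p.2 ∈ Function.support b₂ := h2
    rw [b₁.support_eq] at h1'
    rw [b₂.support_eq] at h2'
    exact ⟨Metric.ball_subset_closedBall h1', Metric.ball_subset_closedBall h2'⟩
  refine ⟨fun p => c * (b₁ p.1 * b₂ p.2), ?_, ?_, ?_, fun p => ?_, fun p => ?_⟩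
  · exact contDiff_const.mul ((b₁.contDiff.comp contDiff_fst).mul (b₂.contDiff.comp contDiff_snd))
  · exact HasCompactSupport.of_support_subset_isCompact
      ((isCompact_closedBall _ _).prod (isCompact_closedBall _ _))
      ((subset_tsupport _).trans hsub)
  · refine hsub.trans (prod_mono (subset_univ _) fun t ht => ?_)
    rw [Real.closedBall_eq_Icc] at ht
    have := ht.2
    simp only [mem_Iio]
    linarith
  · exact mul_nonneg hc0 (mul_nonneg b₁.nonneg b₂.nonneg)
  · by_cases hp : p ∈ box R ∧ p.2 ≤ T'
    · have e1 : b₁ p.1 = 1 := b₁.one_of_mem_closedBall (by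
        rw [Real.closedBall_eq_Icc]
        exact ⟨by linarith [hp.1.1.1], by linarith [hp.1.1.2]⟩)
      have e2 : b₂ p.2 = 1 := b₂.one_of_mem_closedBall (by
        rw [Real.closedBall_eq_Icc]
        have h1 := hp.1.2.1
        have h2 := le_abs_self T'
        exact ⟨by simp only [b₂]; linarith, by simp only [b₂]; linarith [hp.2]⟩)
      have := (abs_le.1 (hcb p)).1
      simp only [e1, e2]
      linarith
    · have : ψ p = 0 := by
        rcases not_and_or.1 hp with h | h
        · exact hR p h
        · exact h0 p (not_le.1 h)
      rw [this, zero_add]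
      exact mul_nonneg hc0 (mul_nonneg b₁.nonneg b₂.nonneg)

/-- The distributional equation `∂ₜ d = a` with vanishing data at `t = 0`, in integrated form:
testing with forward averages of `ψ` gives the difference of `d` and its integral representation
against `ψ`. The backward integral reaches beyond `t = 0`, where `a` will be zero in the
application. -/
lemma ae_eq_backwardAverage (hT : 0 < T) (hd : Measurable d) (hD : ∀ p, |d p| ≤ D)
    (ha : Measurable a) (hA : ∀ p, |a p| ≤ A) (hd0 : ∀ x, ∀ t ≤ 0, d (x, t) = 0)
    (h : ∀ φ : ℝ → ℝ → ℝ, IsTestFunction T φ → (∀ x t, 0 ≤ φ x t) →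
      (∫ p : ℝ × ℝ, deriv (fun s => φ p.1 s) p.2 * d p) + (∫ p : ℝ × ℝ, φ p.1 p.2 * a p) = 0) :
    ∀ᵐ p : ℝ × ℝ, p.2 < T → d p = backwardAverage T a p := by
  have hbm := measurable_backwardAverage (T := T) ha
  have hbb := abs_backwardAverage_le hT hA
  have hint : ∀ ψ : ℝ × ℝ → ℝ, Continuous ψ → HasCompactSupport ψ →
      Integrable (fun p => ψ p * d p) ∧ Integrable (fun p => ψ p * backwardAverage T a p) :=
    fun ψ hψ hc =>
      ⟨(hψ.integrable_of_hasCompactSupport hc).mul_bdd hd.aestronglyMeasurable (ae_of_all _ hD),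
        (hψ.integrable_of_hasCompactSupport hc).mul_bdd hbm.aestronglyMeasurable (ae_of_all _ hbb)⟩
  -- nonnegative test functions first, as only these are available
  have hpos : ∀ ψ : ℝ × ℝ → ℝ, ContDiff ℝ ((⊤ : ℕ∞) : WithTop ℕ∞) ψ → HasCompactSupport ψ →
      tsupport ψ ⊆ univ ×ˢ Iio T → (∀ p, 0 ≤ ψ p) →
      ∫ p, ψ p * (d p - backwardAverage T a p) = 0 := by
    intro ψ hψ hc hs hψ0
    have h1 := h _ (isTestFunction_forwardAverage hψ hc hs) fun x t => forwardAverage_nonneg hψ0 _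
    have e1 : ∫ p : ℝ × ℝ, deriv (fun s => forwardAverage T ψ (p.1, s)) p.2 * d p
        = ∫ p, -(ψ p * d p) := by
      refine integral_congr_ae (ae_of_all _ fun p => ?_)
      simp only
      rw [(hasDerivAt_forwardAverage hT hψ.continuous p.1 p.2).deriv]
      obtain ⟨x, t⟩ := p
      simp only
      rcases le_or_gt t 0 with ht | ht
      · rw [hd0 x t ht]; ring
      · have : ψ (x, t + T) = 0 := image_eq_zero_of_notMem_tsupport fun hn =>
          absurd (hs hn).2 (not_lt.2 (by linarith : T ≤ t + T))
        rw [this]; ring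
    rw [e1, integral_neg, integral_forwardAverage_mul hψ.continuous hc ha hA] at h1
    obtain ⟨i1, i2⟩ := hint ψ hψ.continuous hc
    simp_rw [mul_sub]
    rw [integral_sub i1 i2]
    linarith
  have hU : IsOpen ((univ : Set ℝ) ×ˢ Iio T) := isOpen_univ.prod isOpen_Iio
  have hloc : LocallyIntegrable (fun p => d p - backwardAverage T a p) := by
    refine LocallyIntegrable.mono (g := fun p => d p - backwardAverage T a p)
      (f := fun _ => D + A * T) (locallyIntegrable_const _) (hd.sub hbm).aestronglyMeasurable
      (ae_of_all _ fun p => ?_)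
    refine (norm_sub_le _ _).trans ((add_le_add (hD p) (hbb p)).trans (le_abs_self _))
  have := hU.ae_eq_zero_of_integral_contDiff_smul_eq_zero (hloc.locallyIntegrableOn _)
    fun ψ hψ hc hs => by
      obtain ⟨χ, h1, h2, h3, h4, h5⟩ := exists_nonneg_decomposition hψ hc hs
      have k1 := hpos χ h1 h2 h3 h4
      have k2 := hpos (fun p => ψ p + χ p) (hψ.add h1) (hc.add h2)
        ((tsupport_add ψ χ).trans (union_subset hs h3)) h5
      obtain ⟨i1, i2⟩ := hint ψ hψ.continuous hc
      obtain ⟨j1, j2⟩ := hint χ h1.continuous h2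
      have iψ : Integrable fun p => ψ p * (d p - backwardAverage T a p) := by
        simp_rw [mul_sub]; exact i1.sub i2
      have iχ : Integrable fun p => χ p * (d p - backwardAverage T a p) := by
        simp_rw [mul_sub]; exact j1.sub j2
      simp_rw [add_mul] at k2
      rw [integral_add iψ iχ, k1, add_zero] at k2
      exact k2
  filter_upwards [this] with p hp hpT
  exact sub_eq_zero.1 (hp ⟨mem_univ _, hpT⟩)

end Transport

/-! ### Uniqueness of entropy solutions -/

/-- Translating by a parameter-dependent vector preserves null sets, in the sense of Fubini. -/
lemma ae_ae_translate {μ : Measure ℝ} [SFinite μ] {P : ℝ × ℝ → Prop} (h : ∀ᵐ p : ℝ × ℝ, P p)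
    {F : ℝ → ℝ × ℝ} (hF : Measurable F) : ∀ᵐ p : ℝ × ℝ, ∀ᵐ s ∂μ, P (p + F s) := by
  obtain ⟨N, hN, hNm, hN0⟩ := exists_measurable_superset_of_null h
  have hm : MeasurableSet {q : (ℝ × ℝ) × ℝ | q.1 + F q.2 ∉ N} := by
    have : Measurable fun q : (ℝ × ℝ) × ℝ => q.1 + F q.2 :=
      measurable_fst.add (hF.comp measurable_snd)
    exact this hNm.compl
  have key : ∀ᵐ p : ℝ × ℝ, ∀ᵐ s ∂μ, p + F s ∉ N := by
    rw [Measure.ae_ae_comm hm]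
    refine ae_of_all _ fun s => ?_
    exact (quasiMeasurePreserving_add_right volume (F s)).ae (measure_eq_zero_iff_ae_notMem.1 hN0)
  filter_upwards [key] with p hp
  filter_upwards [hp] with s hs
  exact by_contra fun hn => hs (hN hn)

lemma integral_exp_mul_sub_le {κ T : ℝ} (hκ : 0 < κ) (hT : 0 < T) (t : ℝ) :
    ∫ s in Ioc 0 T, Real.exp (κ * (t - s)) ≤ Real.exp (κ * t) / κ := by
  have hd : ∀ s : ℝ, HasDerivAt (fun s => -Real.exp (κ * (t - s)) / κ) (Real.exp (κ * (t - s))) s :=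
    fun s => by
      have h1 : HasDerivAt (fun s => κ * (t - s)) (κ * (-1)) s :=
        ((hasDerivAt_id s).const_sub t).const_mul κ
      refine (h1.exp.neg.div_const κ).congr_deriv ?_
      field_simp
  rw [← intervalIntegral.integral_of_le hT.le,
    intervalIntegral.integral_eq_sub_of_hasDerivAt (fun s _ => hd s)
      (Continuous.intervalIntegrable (by fun_prop) _ _)]
  have := Real.exp_pos (κ * (t - T))
  have h2 : 0 ≤ Real.exp (κ * (t - T)) / κ := by positivity
  rw [sub_zero, neg_div, neg_div]
  linarith

/-- Gronwall's argument in an exponentially weighted supremum norm, for bounds that hold almost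
everywhere. -/
lemma ae_eq_zero_of_backwardAverage {d a : ℝ × ℝ → ℝ} {T D K : ℝ} (hT : 0 < T) (hK : 0 ≤ K)
    (hD : ∀ p, |d p| ≤ D) (hd0 : ∀ x, ∀ t ≤ 0, d (x, t) = 0)
    (h1 : ∀ᵐ p : ℝ × ℝ, p.2 < T → d p = backwardAverage T a p)
    (h2 : ∀ c κ : ℝ, 0 ≤ c → (∀ᵐ p : ℝ × ℝ, p.2 < T → |d p| ≤ c * Real.exp (κ * p.2)) →
      ∀ᵐ p : ℝ × ℝ, p.2 < T → |a p| ≤ K * (c * Real.exp (κ * p.2))) :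
    ∀ᵐ p : ℝ × ℝ, p.2 < T → d p = 0 := by
  -- with `κ ≥ 2 * K` the integral equation halves the weighted bound
  set κ := 2 * K + 1 with hκ
  have hκ0 : 0 < κ := by positivity
  have hD0 : 0 ≤ D := (abs_nonneg _).trans (hD 0)
  have key : ∀ n : ℕ, ∀ᵐ p : ℝ × ℝ, p.2 < T → |d p| ≤ D * (1 / 2) ^ n * Real.exp (κ * p.2) := by
    intro n
    induction n with
    | zero =>
      refine ae_of_all _ fun p _ => ?_
      rw [pow_zero, mul_one]
      rcases le_or_gt p.2 0 with hp | hp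
      · rw [show d p = 0 from hd0 p.1 p.2 hp, abs_zero]
        positivity
      · exact (hD p).trans (le_mul_of_one_le_right hD0 (Real.one_le_exp (by positivity)))
    | succ n ih =>
      have h3 := ae_ae_translate (μ := volume.restrict (Ioc 0 T)) (h2 _ κ (by positivity) ih)
        (F := fun s => (0, -s)) (by fun_prop)
      filter_upwards [h1, h3] with p hp1 hp3 hpT
      rw [hp1 hpT, backwardAverage]
      have hint : IntegrableOn (fun s => K * (D * (1 / 2) ^ n) * Real.exp (κ * (p.2 - s)))
          (Ioc 0 T) :=
        (Continuous.integrableOn_Icc (by fun_prop)).mono_set Ioc_subset_Icc_self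
      rw [← Real.norm_eq_abs]
      refine (norm_integral_le_of_norm_le hint ?_).trans ?_
      · filter_upwards [hp3, ae_restrict_mem measurableSet_Ioc] with s hs hs0
        have e : p + (0, -s) = (p.1, p.2 - s) := by ext <;> simp [sub_eq_add_neg]
        rw [e] at hs
        refine (hs ?_).trans (le_of_eq (by ring))
        simp only
        linarith [hs0.1]
      · rw [integral_const_mul]
        have h4 := integral_exp_mul_sub_le hκ0 hT p.2
        have hb : 0 ≤ K * (D * (1 / 2) ^ n) := by positivity
        refine (mul_le_mul_of_nonneg_left h4 hb).trans ?_
        rw [mul_div_assoc', div_le_iff₀ hκ0]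
        have e0 := Real.exp_pos (κ * p.2)
        have hD' : 0 ≤ D * (1 / 2) ^ n * Real.exp (κ * p.2) := by positivity
        rw [pow_succ, hκ]
        nlinarith
  filter_upwards [ae_all_iff.2 key] with p hp hpT
  have hl : Tendsto (fun n : ℕ => D * (1 / 2 : ℝ) ^ n * Real.exp (κ * p.2)) atTop (𝓝 0) := by
    have := ((tendsto_pow_atTop_nhds_zero_of_lt_one (r := (1 / 2 : ℝ)) (by norm_num)
      (by norm_num)).const_mul D).mul_const (Real.exp (κ * p.2))
    simpa using this
  exact abs_nonpos_iff.1 (ge_of_tendsto' hl fun n => hp n hpT)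

section Source

variable {g : ℝ → ℝ → ℝ} {ω ρ : ℝ → ℝ} {δ T C M Λ R : ℝ} {Ψ w w' : ℝ × ℝ → ℝ}

/-- The nonlocal flux balance `∫₀^δ (g (τ₋ₕ w, w) - g (w, τₕ w)) ρ h dh`, where `ρ h` stands for
`ω h / h`. -/
noncomputable def nonlocalSource (g : ℝ → ℝ → ℝ) (ρ : ℝ → ℝ) (δ : ℝ) (w : ℝ × ℝ → ℝ)
    (p : ℝ × ℝ) : ℝ :=
  ∫ h in Ioc 0 δ, (g (w (p.1 - h, p.2)) (w p) - g (w p) (w (p.1 + h, p.2))) * ρ h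

lemma measurable_source_integrand (hg : FluxLip C g) (hw : Measurable w) (hρ : Measurable ρ) :
    Measurable fun q : (ℝ × ℝ) × ℝ =>
      (g (w (q.1.1 - q.2, q.1.2)) (w q.1) - g (w q.1) (w (q.1.1 + q.2, q.1.2))) * ρ q.2 := by
  have hgm := hg.continuous.measurable
  have m0 : Measurable fun q : (ℝ × ℝ) × ℝ => w q.1 := hw.comp measurable_fst
  have m1 : Measurable fun q : (ℝ × ℝ) × ℝ => w (q.1.1 - q.2, q.1.2) := hw.comp (by fun_prop)
  have m2 : Measurable fun q : (ℝ × ℝ) × ℝ => w (q.1.1 + q.2, q.1.2) := hw.comp (by fun_prop)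
  exact ((hgm.comp (m1.prodMk m0)).sub (hgm.comp (m0.prodMk m2))).mul (hρ.comp measurable_snd)

lemma measurable_nonlocalSource (hg : FluxLip C g) (hw : Measurable w) (hρ : Measurable ρ) :
    Measurable (nonlocalSource g ρ δ w) :=
  (measurable_source_integrand hg hw hρ).stronglyMeasurable.integral_prod_right'.measurable

lemma abs_source_integrand_le (hg : FluxLip C g) (hC : 0 ≤ C) (hwM : ∀ p, |w p| ≤ M) (p : ℝ × ℝ)
    (h : ℝ) :
    |(g (w (p.1 - h, p.2)) (w p) - g (w p) (w (p.1 + h, p.2))) * ρ h|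
      ≤ 2 * (|g 0 0| + C * (M + M)) * |ρ h| := by
  rw [abs_mul]
  refine mul_le_mul_of_nonneg_right ((abs_sub _ _).trans ?_) (abs_nonneg _)
  linarith [hg.abs_le hC (hwM (p.1 - h, p.2)) (hwM p), hg.abs_le hC (hwM p) (hwM (p.1 + h, p.2))]

lemma abs_nonlocalSource_le (hg : FluxLip C g) (hC : 0 ≤ C) (hwM : ∀ p, |w p| ≤ M)
    (hρi : IntegrableOn ρ (Ioc 0 δ)) (p : ℝ × ℝ) :
    |nonlocalSource g ρ δ w p| ≤ ∫ h in Ioc 0 δ, 2 * (|g 0 0| + C * (M + M)) * |ρ h| := by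
  rw [nonlocalSource, ← Real.norm_eq_abs]
  exact norm_integral_le_of_norm_le (hρi.abs.const_mul _)
    (ae_of_all _ fun h => abs_source_integrand_le hg hC hwM p h)

lemma integrableOn_source_integrand (hg : FluxLip C g) (hC : 0 ≤ C) (hw : Measurable w)
    (hwM : ∀ p, |w p| ≤ M) (hρ : Measurable ρ) (hρi : IntegrableOn ρ (Ioc 0 δ)) (p : ℝ × ℝ) :
    IntegrableOn (fun h => (g (w (p.1 - h, p.2)) (w p) - g (w p) (w (p.1 + h, p.2))) * ρ h)
      (Ioc 0 δ) :=
  (hρi.abs.const_mul (2 * (|g 0 0| + C * (M + M)))).mono'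
    ((measurable_source_integrand hg hw hρ).comp measurable_prodMk_left).aestronglyMeasurable
    (ae_of_all _ fun h => abs_source_integrand_le hg hC hwM p h)

/-- For an integrable quotient `ω h / h` the difference quotients can be moved from the test
function to the solution. -/
lemma interaction_term_eq_source (hg : FluxLip C g) (hC : 0 ≤ C) (hw : Measurable w)
    (hwM : ∀ p, |w p| ≤ M) (hρ : Measurable ρ) (hρi : IntegrableOn ρ (Ioc 0 δ))
    (hωρ : ∀ᵐ h ∂(volume.restrict (Ioc 0 δ)), ω h = h * ρ h) (hΨ : SpaceTest Λ R Ψ)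
    (hΨb : ∀ p, |Ψ p| ≤ Λ) :
    ∫ h in Ioc 0 δ, interaction Ψ g w h * ω h = ∫ p, Ψ p * nonlocalSource g ρ δ w p := by
  have hgm := hg.continuous.measurable
  have hM1 : ∀ a b : ℝ, Measurable fun p : ℝ × ℝ => g (w (p.1 + a, p.2)) (w (p.1 + b, p.2)) :=
    fun a b => hgm.comp
      ((hw.comp (by fun_prop : Measurable fun p : ℝ × ℝ => (p.1 + a, p.2))).prodMk
        (hw.comp (by fun_prop : Measurable fun p : ℝ × ℝ => (p.1 + b, p.2))))
  have iΨ : Integrable Ψ := integrable_of_box hΨ.measurable hΨb hΨ.eq_zero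
  have hI : ∀ a b : ℝ, Integrable fun p : ℝ × ℝ => Ψ p * g (w (p.1 + a, p.2)) (w (p.1 + b, p.2)) :=
    fun a b => iΨ.mul_bdd (hM1 a b).aestronglyMeasurable
      (ae_of_all _ fun p => hg.abs_le hC (hwM _) (hwM _))
  have e1 : ∀ h : ℝ, h ≠ 0 → interaction Ψ g w h * (h * ρ h) = ∫ p : ℝ × ℝ,
      Ψ p * ((g (w (p.1 - h, p.2)) (w p) - g (w p) (w (p.1 + h, p.2))) * ρ h) := fun h hh => by
    have i0 : Integrable fun p : ℝ × ℝ => Ψ p * g (w p) (w (p.1 + h, p.2)) := by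
      simpa using hI 0 h
    have i1 : Integrable fun p : ℝ × ℝ => Ψ p * g (w (p.1 - h, p.2)) (w p) := by
      simpa [sub_eq_add_neg] using hI (-h) 0
    have es : ∀ p : ℝ × ℝ, p + (h, 0) = (p.1 + h, p.2) := fun p => by ext <;> simp
    have i2 : Integrable fun p : ℝ × ℝ => Ψ (p.1 + h, p.2) * g (w p) (w (p.1 + h, p.2)) := by
      refine (i1.comp_add_right ((h, 0) : ℝ × ℝ)).congr (ae_of_all _ fun p => ?_)
      simp [es]
    have e2 : ∫ p : ℝ × ℝ, Ψ p * g (w (p.1 - h, p.2)) (w p)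
        = ∫ p : ℝ × ℝ, Ψ (p.1 + h, p.2) * g (w p) (w (p.1 + h, p.2)) := by
      rw [← integral_add_right_eq_self (fun p : ℝ × ℝ => Ψ p * g (w (p.1 - h, p.2)) (w p)) (h, 0)]
      refine integral_congr_ae (ae_of_all _ fun p => ?_)
      simp [es]
    simp_rw [← mul_assoc, mul_sub]
    rw [integral_mul_const, integral_sub i1 i0, e2, ← integral_sub i2 i0, interaction]
    congr 1
    rw [← integral_mul_const]
    refine integral_congr_ae (ae_of_all _ fun p => ?_)
    simp only [diffQuot]
    field_simp
  have hprod : Integrable (fun q : (ℝ × ℝ) × ℝ => Ψ q.1 *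
      ((g (w (q.1.1 - q.2, q.1.2)) (w q.1) - g (w q.1) (w (q.1.1 + q.2, q.1.2))) * ρ q.2))
      (volume.prod (volume.restrict (Ioc 0 δ))) := by
    refine (iΨ.abs.mul_prod (hρi.abs.const_mul (2 * (|g 0 0| + C * (M + M))))).mono'
      ((hΨ.measurable.comp measurable_fst).mul
        (measurable_source_integrand hg hw hρ)).aestronglyMeasurable (ae_of_all _ fun q => ?_)
    rw [norm_mul]
    exact mul_le_mul_of_nonneg_left (abs_source_integrand_le hg hC hwM q.1 q.2) (abs_nonneg _)
  calc ∫ h in Ioc 0 δ, interaction Ψ g w h * ω h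
      = ∫ h in Ioc 0 δ, ∫ p : ℝ × ℝ,
          Ψ p * ((g (w (p.1 - h, p.2)) (w p) - g (w p) (w (p.1 + h, p.2))) * ρ h) := by
        refine integral_congr_ae ?_
        filter_upwards [hωρ, ae_restrict_mem measurableSet_Ioc] with h hh hh0
        rw [hh, e1 h hh0.1.ne']
    _ = ∫ p : ℝ × ℝ, ∫ h in Ioc 0 δ,
          Ψ p * ((g (w (p.1 - h, p.2)) (w p) - g (w p) (w (p.1 + h, p.2))) * ρ h) :=
        (integral_integral_swap hprod).symm
    _ = _ := by simp_rw [integral_const_mul]; rfl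

/-- The nonlocal flux balance is Lipschitz continuous in weighted supremum norms. -/
lemma ae_abs_nonlocalSource_sub_le (hg : FluxLip C g) (hC : 0 ≤ C) (hw : Measurable w)
    (hwM : ∀ p, |w p| ≤ M) (hw' : Measurable w') (hwM' : ∀ p, |w' p| ≤ M) (hρ : Measurable ρ)
    (hρi : IntegrableOn ρ (Ioc 0 δ)) {b : ℝ → ℝ}
    (h : ∀ᵐ p : ℝ × ℝ, p.2 < T → |w p - w' p| ≤ b p.2) :
    ∀ᵐ p : ℝ × ℝ, p.2 < T → |nonlocalSource g ρ δ w p - nonlocalSource g ρ δ w' p|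
      ≤ (∫ h in Ioc 0 δ, 4 * C * |ρ h|) * b p.2 := by
  have hp := ae_ae_translate (μ := volume.restrict (Ioc 0 δ)) h (F := fun s => (s, 0))
    (by fun_prop)
  have hm := ae_ae_translate (μ := volume.restrict (Ioc 0 δ)) h (F := fun s => (-s, 0))
    (by fun_prop)
  filter_upwards [h, hp, hm] with p h0 h1 h2 hpT
  rw [nonlocalSource, nonlocalSource, ← integral_sub
    (integrableOn_source_integrand hg hC hw hwM hρ hρi p)
    (integrableOn_source_integrand hg hC hw' hwM' hρ hρi p), ← integral_mul_const,
    ← Real.norm_eq_abs]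
  refine norm_integral_le_of_norm_le ((hρi.abs.const_mul _).mul_const _) ?_
  filter_upwards [h1, h2] with s k1 k2
  have e1 : p + (s, 0) = (p.1 + s, p.2) := by ext <;> simp
  have e2 : p + (-s, 0) = (p.1 - s, p.2) := by ext <;> simp [sub_eq_add_neg]
  rw [e1] at k1
  rw [e2] at k2
  have k0 := h0 hpT
  have k1' := k1 hpT
  have k2' := k2 hpT
  have f1 := hg (w (p.1 - s, p.2)) (w p) (w' (p.1 - s, p.2)) (w' p)
  have f2 := hg (w p) (w (p.1 + s, p.2)) (w' p) (w' (p.1 + s, p.2))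
  rw [← sub_mul, norm_mul, mul_right_comm]
  refine mul_le_mul_of_nonneg_right ?_ (abs_nonneg _)
  rw [sub_sub_sub_comm]
  refine (abs_sub _ _).trans ((add_le_add f1 f2).trans ?_)
  have := mul_le_mul_of_nonneg_left (add_le_add (add_le_add k2' k0) (add_le_add k0 k1')) hC
  simp only at this
  linarith

end Source

/-- Entropy solutions are unique when `ω h / h` is integrable. In that case the nonlocal operator is
Lipschitz continuous, so that uniqueness already holds for bounded weak solutions. -/
lemma IsEntropySolution.ae_eq {g : ℝ → ℝ → ℝ} {ω : ℝ → ℝ} {δ T C M₀ : ℝ} {u₀ : ℝ → ℝ}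
    {u v : ℝ → ℝ → ℝ} (hg : FluxLip C g) (hC : 0 ≤ C) (hω : IsInteractionKernel δ ω)
    (hδ : 0 < δ) (hT : 0 < T) (hint : IntegrableOn (fun h => ω h / h) (Ioo 0 δ))
    (hu₀ : Measurable u₀) (hu₀M : ∀ᵐ x, |u₀ x| ≤ M₀)
    (hu : IsEntropySolution g ω δ T u₀ u) (hv : IsEntropySolution g ω δ T u₀ v) :
    ∀ᵐ p : ℝ × ℝ ∂(volume.restrict (univ ×ˢ Ioo 0 T)), v p.1 p.2 = u p.1 p.2 := by
  obtain ⟨M₁, hM₁⟩ := hu.memLInfty.exists_bound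
  obtain ⟨M₂, hM₂⟩ := hv.memLInfty.exists_bound
  set M := max 0 (max M₀ (max M₁ M₂)) with hM
  have hM0 : 0 ≤ M := le_max_left _ _
  have l0 : M₀ ≤ M := (le_max_left _ _).trans (le_max_right _ _)
  have l1 : M₁ ≤ M := (le_max_left _ _).trans ((le_max_right _ _).trans (le_max_right _ _))
  have l2 : M₂ ≤ M := (le_max_right _ _).trans ((le_max_right _ _).trans (le_max_right _ _))
  set ū : ℝ → ℝ := fun x => max (-M) (min M (u₀ x)) with hū
  have hūm : Measurable ū := measurable_const.max (measurable_const.min hu₀)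
  have hūM : ∀ x, |ū x| ≤ M := fun x =>
    abs_le.2 ⟨le_max_left _ _, max_le (by linarith) (min_le_left _ _)⟩
  have hūe : u₀ =ᵐ[volume] ū := by
    filter_upwards [hu₀M] with x hx
    obtain ⟨h4, h5⟩ := abs_le.1 (hx.trans l0)
    rw [hū]
    simp only
    rw [min_eq_right h5, max_eq_right h4]
  obtain ⟨w, hw, hwM, hw0, huw⟩ := hu.memLInfty.exists_extension
    (hM₁.mono fun p hp => hp.trans l1) hM0 hūm hūM
  obtain ⟨w', hw', hwM', hw0', hvw⟩ := hv.memLInfty.exists_extension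
    (hM₂.mono fun p hp => hp.trans l2) hM0 hūm hūM
  have hi' : IntegrableOn (fun h => ω h / h) (Ioc 0 δ) := by
    rwa [integrableOn_Ioc_iff_integrableOn_Ioo]
  obtain ⟨ρ, hρ, hρe⟩ : ∃ ρ : ℝ → ℝ, Measurable ρ ∧
      (fun h => ω h / h) =ᵐ[volume.restrict (Ioc 0 δ)] ρ :=
    ⟨_, hi'.1.stronglyMeasurable_mk.measurable, hi'.1.ae_eq_mk⟩
  have hρi : IntegrableOn ρ (Ioc 0 δ) := Integrable.congr hi' hρe
  have hωρ : ∀ᵐ h ∂(volume.restrict (Ioc 0 δ)), ω h = h * ρ h := by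
    filter_upwards [hρe, ae_restrict_mem measurableSet_Ioc] with h hh hh0
    rw [← hh, mul_div_cancel₀ _ hh0.1.ne']
  set K := ∫ h in Ioc 0 δ, 4 * C * |ρ h| with hK
  have hK0 : 0 ≤ K := integral_nonneg fun h => by positivity
  set a : ℝ × ℝ → ℝ := fun p => nonlocalSource g ρ δ w p - nonlocalSource g ρ δ w' p with ha
  have hsm := measurable_nonlocalSource (δ := δ) hg hw hρ
  have hsm' := measurable_nonlocalSource (δ := δ) hg hw' hρ
  have hsb := abs_nonlocalSource_le hg hC hwM hρi
  have hsb' := abs_nonlocalSource_le hg hC hwM' hρi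
  have hd0 : ∀ x, ∀ t ≤ 0, w (x, t) - w' (x, t) = 0 := fun x t ht => by
    rw [hw0 x t ht, hw0' x t ht, sub_self]
  have ha0 : ∀ p : ℝ × ℝ, p.2 ≤ 0 → a p = 0 := fun p hp => by
    have : ∀ x, w (x, p.2) = w' (x, p.2) := fun x => sub_eq_zero.1 (hd0 x p.2 hp)
    simp only [ha, nonlocalSource, this, sub_self]
  have hweak : ∀ φ : ℝ → ℝ → ℝ, IsTestFunction T φ → (∀ x t, 0 ≤ φ x t) →
      (∫ p : ℝ × ℝ, deriv (fun s => φ p.1 s) p.2 * (w p - w' p))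
        + (∫ p : ℝ × ℝ, φ p.1 p.2 * a p) = 0 := fun φ hφ hφ0 => by
    obtain ⟨Λ, R, hb⟩ := hφ.exists_bounds
    have k1 := hu.weak_eq hg hC hω hδ hT hūe hw hwM hw0 huw hφ hφ0
    have k2 := hv.weak_eq hg hC hω hδ hT hūe hw' hwM' hw0' hvw hφ hφ0
    have hΨ := hb.spaceTest
    have hΨb : ∀ p, |cutoff (fun p => φ p.1 p.2) p| ≤ Λ := fun p => by
      unfold cutoff
      split_ifs
      · exact hb.bound _ _
      · simpa using hb.const_nonneg
    have iΨ : Integrable (cutoff fun p => φ p.1 p.2) :=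
      integrable_of_box hΨ.measurable hΨb hΨ.eq_zero
    rw [interaction_term_eq_source hg hC hw hwM hρ hρi hωρ hΨ hΨb] at k1
    rw [interaction_term_eq_source hg hC hw' hwM' hρ hρi hωρ hΨ hΨb] at k2
    have i0 := hb.integral_deriv_eq_zero.1
    have i1 := i0.mul_bdd hw.aestronglyMeasurable (ae_of_all _ hwM)
    have i2 := i0.mul_bdd hw'.aestronglyMeasurable (ae_of_all _ hwM')
    have i3 := iΨ.mul_bdd hsm.aestronglyMeasurable (ae_of_all _ hsb)
    have i4 := iΨ.mul_bdd hsm'.aestronglyMeasurable (ae_of_all _ hsb')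
    have e : ∫ p : ℝ × ℝ, φ p.1 p.2 * a p
        = ∫ p, (cutoff (fun p => φ p.1 p.2) p * nonlocalSource g ρ δ w p
          - cutoff (fun p => φ p.1 p.2) p * nonlocalSource g ρ δ w' p) := by
      refine integral_congr_ae (ae_of_all _ fun p => ?_)
      simp only
      rw [← mul_sub]
      by_cases hp : 0 ≤ p.2
      · rw [cutoff, if_pos hp]
      · have := ha0 p (not_le.1 hp).le
        rw [this, mul_zero, cutoff, if_neg hp, zero_mul]
    simp_rw [mul_sub]
    rw [e, integral_sub i1 i2, integral_sub i3 i4]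
    linarith
  have hav := ae_eq_backwardAverage hT (hw.sub hw') (fun p => (abs_sub _ _).trans
    (add_le_add (hwM p) (hwM' p))) (hsm.sub hsm') (fun p => (abs_sub _ _).trans
    (add_le_add (hsb p) (hsb' p))) hd0 hweak
  have hz := ae_eq_zero_of_backwardAverage hT hK0 (fun p => (abs_sub _ _).trans
    (add_le_add (hwM p) (hwM' p))) hd0 hav fun c κ _ h =>
      ae_abs_nonlocalSource_sub_le hg hC hw hwM hw' hwM' hρ hρi
        (b := fun t => c * Real.exp (κ * t)) h
  have hmem : ∀ᵐ p : ℝ × ℝ ∂(volume.restrict (univ ×ˢ Ioo 0 T)), p ∈ (univ : Set ℝ) ×ˢ Ioo 0 T :=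
    ae_restrict_mem (MeasurableSet.univ.prod measurableSet_Ioo)
  filter_upwards [huw, hvw, ae_restrict_of_ae hz, hmem] with p h1 h2 h3 h4
  rw [h1, h2]
  exact (sub_eq_zero.1 (h3 h4.2.2)).symm

/-! ### Convergence of the scheme -/

section Convergence

variable {f : ℝ → ℝ} {g : ℝ → ℝ → ℝ} {ω : ℝ → ℝ} {δ T lam dx dt C B : ℝ} {u₀ ū : ℝ → ℝ}
  {s s' : ℕ → ℝ} {σ U : ℝ → ℕ → ℤ → ℝ} {w w' : ℝ × ℝ → ℝ}

lemma IsSchemeSolution.congr_initial {σ u : ℕ → ℤ → ℝ}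
    (h : IsSchemeSolution g ω δ dx dt u₀ σ u) (h0 : u₀ =ᵐ[volume] ū) :
    IsSchemeSolution g ω δ dx dt ū σ u where
  initial j := by
    rw [h.initial j]
    congr 1
    exact intervalIntegral.integral_congr_ae (h0.mono fun x hx _ => hx)
  step := h.step
  slopes := h.slopes

lemma IsWeakSolution.congr_initial {u : ℝ → ℝ → ℝ} (h : IsWeakSolution g ω δ T u₀ u) (hT : 0 ≤ T)
    (hδ : 0 ≤ δ) (h0 : u₀ =ᵐ[volume] ū) : IsWeakSolution g ω δ T ū u where
  memLInfty := h.memLInfty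
  weak_form φ hφ := (testFunctional_congr (η := id) (G := g) (φ := φ) hT hδ h0
    (ae_of_all _ fun _ => ae_of_all _ fun _ => rfl)).symm.trans (h.weak_form φ hφ)

lemma IsEntropySolution.congr_initial {u : ℝ → ℝ → ℝ} (h : IsEntropySolution g ω δ T u₀ u)
    (hT : 0 ≤ T) (hδ : 0 ≤ δ) (h0 : u₀ =ᵐ[volume] ū) : IsEntropySolution g ω δ T ū u where
  memLInfty := h.memLInfty
  entropy_ineq c φ hφ hφ0 := (h.entropy_ineq c φ hφ hφ0).trans_eq
    (testFunctional_congr (η := fun a => |a - c|) (G := entropyFlux g c) (φ := φ) hT hδ h0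
      (ae_of_all _ fun _ => ae_of_all _ fun _ => rfl))

lemma FluxLip.nonneg (h : FluxLip C g) : 0 ≤ C := by
  have := (abs_nonneg _).trans (h 1 0 0 0)
  simpa using this

/-- All small time steps are admissible, because the coefficients of the scheme tend to zero. -/
lemma eventually_goodStep (hg : IsMonotoneFlux f g) (hC : FluxLip C g)
    (hω : IsInteractionKernel δ ω) (hδ : 0 < δ) (hlam : 0 < lam) (hu₀ : Integrable u₀) (hB : 0 ≤ B)
    (hvar : TranslationBound B u₀)
    (hU : ∀ dt : ℝ, 0 < dt → IsSchemeSolution g ω δ (dt / lam) dt u₀ (σ dt) (U dt)) :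
    ∀ᶠ dt in 𝓝[>] 0, GoodStep g ω δ lam dt C B u₀ (σ dt) (U dt) := by
  have h1 : Tendsto (fun dt : ℝ => dt / lam) (𝓝[>] 0) (𝓝[>] 0) := by
    refine tendsto_nhdsWithin_iff.2 ⟨?_, ?_⟩
    · have : Tendsto (fun dt : ℝ => dt / lam) (𝓝 0) (𝓝 (0 / lam)) :=
        (continuous_id.div_const lam).tendsto 0
      rw [zero_div] at this
      exact this.mono_left nhdsWithin_le_nhds
    · filter_upwards [self_mem_nhdsWithin] with dt hdt
      exact div_pos hdt hlam
  have h2 := ((tendsto_sum_coeff hω hδ lam).comp h1).const_mul (4 * C)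
  rw [mul_zero] at h2
  filter_upwards [h2.eventually (ge_mem_nhds one_pos), self_mem_nhdsWithin] with dt h3 hdt
  exact ⟨hdt, hlam, hC.nonneg, hC, ⟨f, hg⟩, hω, hδ, hU dt hdt, hB, hu₀, hvar, h3⟩

/-- The finitely many time steps that are not admissible are dropped before selecting a
subsequence. -/
lemma exists_schemeLimit_of_tendsto
    (h : ∀ᶠ dt in 𝓝[>] 0, GoodStep g ω δ lam dt C B u₀ (σ dt) (U dt))
    (hs : Tendsto s atTop (𝓝[>] 0)) :
    ∃ κ : ℕ → ℕ, StrictMono κ ∧ ∃ w, SchemeLimit g ω δ lam C B u₀ (s ∘ κ) σ U w := by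
  obtain ⟨N, hN⟩ := eventually_atTop.1 (hs.eventually h)
  obtain ⟨κ, hκ, w, hw⟩ := exists_schemeLimit (s := fun m => s (m + N))
    (fun m => hN _ (Nat.le_add_left _ _))
    ((tendsto_nhdsWithin_iff.1 hs).1.comp (tendsto_add_atTop_nat N))
  exact ⟨fun m => κ m + N, fun m n hmn => Nat.add_lt_add_right (hκ hmn) N, w, hw⟩

/-- Limits that agree almost everywhere on the strip agree at every time, by continuity in time. -/
lemma SchemeLimit.ae_eq_of_ae_eq_strip (h : SchemeLimit g ω δ lam C B u₀ s σ U w)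
    (h' : SchemeLimit g ω δ lam C B u₀ s' σ U w') (hT : 0 < T)
    (heq : ∀ᵐ p : ℝ × ℝ ∂(volume.restrict (univ ×ˢ Ioo 0 T)), w' p = w p) {t : ℝ}
    (ht : t ∈ Icc 0 T) : ∀ᵐ x, w' (x, t) = w (x, t) := by
  have hae := (ae_restrict_iff' measurableSet_Ioc).1 (ae_ae_of_ae_strip heq)
  have hm : ∀ r, Measurable fun x => w (x, r) := fun r => h.measurable.comp (by fun_prop)
  have hm' : ∀ r, Measurable fun x => w' (x, r) := fun r => h'.measurable.comp (by fun_prop)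
  set L := 4 * C * B with hL
  have key : ∀ ε > 0, ∫⁻ x, ‖w' (x, t) - w (x, t)‖ₑ
      ≤ ENNReal.ofReal (L * ε) + ENNReal.ofReal (L * ε) := by
    intro ε hε
    have hL0 : 0 ≤ L := by
      have := (h.good 0).lip_nonneg
      have := (h.good 0).var_nonneg
      positivity
    have hlt : max 0 (t - ε) < min T (t + ε) :=
      max_lt (lt_min hT (by linarith [ht.1])) (lt_min (by linarith [ht.2]) (by linarith))
    have hpos : volume (Ioo (max 0 (t - ε)) (min T (t + ε))) ≠ 0 := by
      rw [Real.volume_Ioo]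
      exact (ENNReal.ofReal_pos.2 (sub_pos.2 hlt)).ne'
    obtain ⟨r, hr1, hr2⟩ := ((frequently_ae_mem_iff.2 hpos).and_eventually hae).exists
    have hr : |t - r| ≤ ε := by
      rw [abs_le]
      exact ⟨by linarith [hr1.2.trans_le (min_le_right _ _)],
        by linarith [(le_max_right 0 (t - ε)).trans_lt hr1.1]⟩
    have hr3 := hr2 ⟨(le_max_left _ _).trans_lt hr1.1, (hr1.2.trans_le (min_le_left _ _)).le⟩
    have hmm : Measurable fun x => ‖w' (x, t) - w' (x, r)‖ₑ := ((hm' t).sub (hm' r)).enorm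
    calc ∫⁻ x, ‖w' (x, t) - w (x, t)‖ₑ
        ≤ ∫⁻ x, (‖w' (x, t) - w' (x, r)‖ₑ + ‖w (x, t) - w (x, r)‖ₑ) := by
          refine lintegral_mono_ae ?_
          filter_upwards [hr3] with x hx
          rw [← sub_add_sub_cancel (w' (x, t)) (w' (x, r)) (w (x, t)), hx,
            enorm_sub_rev (w (x, t)) (w (x, r))]
          exact enorm_add_le _ _
      _ = (∫⁻ x, ‖w' (x, t) - w' (x, r)‖ₑ) + ∫⁻ x, ‖w (x, t) - w (x, r)‖ₑ :=
          lintegral_add_left hmm _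
      _ ≤ _ := add_le_add
          ((h'.time r t).trans (ENNReal.ofReal_le_ofReal (mul_le_mul_of_nonneg_left hr hL0)))
          ((h.time r t).trans (ENNReal.ofReal_le_ofReal (mul_le_mul_of_nonneg_left hr hL0)))
  have hz : ∫⁻ x, ‖w' (x, t) - w (x, t)‖ₑ = 0 := by
    have hl : Tendsto (fun ε => ENNReal.ofReal (L * ε) + ENNReal.ofReal (L * ε)) (𝓝[>] (0 : ℝ))
        (𝓝 0) := by
      have hc : Continuous fun ε => ENNReal.ofReal (L * ε) + ENNReal.ofReal (L * ε) :=
        (ENNReal.continuous_ofReal.comp (by fun_prop)).add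
          (ENNReal.continuous_ofReal.comp (by fun_prop))
      have := (hc.tendsto 0).mono_left (nhdsWithin_le_nhds (s := Ioi 0))
      simpa using this
    refine le_antisymm (ge_of_tendsto hl ?_) zero_le
    filter_upwards [self_mem_nhdsWithin] with ε hε
    exact key ε hε
  have hmw : Measurable fun x => ‖w' (x, t) - w (x, t)‖ₑ := ((hm' t).sub (hm t)).enorm
  rw [lintegral_eq_zero_iff hmw] at hz
  filter_upwards [hz] with x hx
  exact sub_eq_zero.1 (enorm_eq_zero.1 hx)

lemma SchemeLimit.ae_eq_of_isEntropySolution (h : SchemeLimit g ω δ lam C B u₀ s σ U w)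
    (hm : Measurable u₀) (hT : 0 < T) (hint : IntegrableOn (fun h => ω h / h) (Ioo 0 δ))
    {v : ℝ → ℝ → ℝ} (hv : IsEntropySolution g ω δ T u₀ v) :
    ∀ᵐ p : ℝ × ℝ ∂(volume.restrict (univ ×ˢ Ioo 0 T)), v p.1 p.2 = w p := by
  have hb : ∀ᵐ x, |u₀ x| ≤ B := by
    filter_upwards [h.initial hm le_rfl] with x hx
    rw [← hx]
    exact h.bounded _
  exact IsEntropySolution.ae_eq (h.good 0).lip (h.good 0).lip_nonneg (h.good 0).kernel
    (h.good 0).horizon hT hint hm hb (h.isEntropySolution hm hT) hv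

/-- Since all limits of subsequences coincide, the whole family converges. -/
lemma SchemeLimit.tendsto_of_unique (h : SchemeLimit g ω δ lam C B u₀ s σ U w)
    (hm : Measurable u₀) (hT : 0 < T) (hint : IntegrableOn (fun h => ω h / h) (Ioo 0 δ))
    (hgood : ∀ᶠ dt in 𝓝[>] 0, GoodStep g ω δ lam dt C B u₀ (σ dt) (U dt)) {t : ℝ}
    (ht : t ∈ Icc 0 T) :
    Tendsto (fun dt => ∫⁻ x, ‖piecewiseConstant (dt / lam) dt (U dt) x t - w (x, t)‖ₑ ∂gauss)
      (𝓝[>] 0) (𝓝 0) := by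
  refine tendsto_of_subseq_tendsto fun s' hs' => ?_
  obtain ⟨κ, hκ, w', h'⟩ := exists_schemeLimit_of_tendsto hgood hs'
  refine ⟨κ, (h'.tendsto t).congr fun m => lintegral_congr_ae ?_⟩
  have hae := h.ae_eq_of_ae_eq_strip h' hT
    (h.ae_eq_of_isEntropySolution hm hT hint (h'.isEntropySolution hm hT)) ht
  filter_upwards [(Measure.absolutelyContinuous_of_le gauss_le_volume).ae_le hae] with x hx
  rw [hx]
  rfl

end Convergence

end PairInteraction

open PairInteraction
theorem mainTheorem1 (f : ℝ → ℝ) (g : ℝ → ℝ → ℝ) (hg : IsMonotoneFlux f g)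
    (δ T lam : ℝ) (hδ : 0 < δ) (hT : 0 < T) (hlam : 0 < lam)
    (ω : ℝ → ℝ) (hω : IsInteractionKernel δ ω)
    (u₀ : ℝ → ℝ) (hu₀ : MemL1BV u₀) (hCFL : CFLCondition lam g)
    (σ U : ℝ → ℕ → ℤ → ℝ)
    (hU : ∀ dt : ℝ, 0 < dt → IsSchemeSolution g ω δ (dt / lam) dt u₀ (σ dt) (U dt)) :
    (∀ s : ℕ → ℝ, (∀ m, 0 < s m) → Tendsto s atTop (𝓝 0) →
      ∃ κ : ℕ → ℕ, StrictMono κ ∧ ∃ u : ℝ → ℝ → ℝ,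
        ContinuousInL1 T u ∧
        (∀ t ∈ Icc 0 T,
          TendstoL1Loc
            (fun m x => piecewiseConstant (s (κ m) / lam) (s (κ m)) (U (s (κ m))) x t)
            atTop (fun x => u x t)) ∧
        IsWeakSolution g ω δ T u₀ u) ∧
    (IntegrableOn (fun h => ω h / h) (Ioo 0 δ) →
      ∃ u : ℝ → ℝ → ℝ,
        ContinuousInL1 T u ∧
        IsWeakSolution g ω δ T u₀ u ∧
        IsEntropySolution g ω δ T u₀ u ∧
        (∀ v : ℝ → ℝ → ℝ, IsEntropySolution g ω δ T u₀ v →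
          ∀ᵐ p : ℝ × ℝ ∂(volume.restrict (univ ×ˢ Ioo 0 T)), v p.1 p.2 = u p.1 p.2) ∧
        ∀ t ∈ Icc 0 T,
          TendstoL1Loc (fun dt x => piecewiseConstant (dt / lam) dt (U dt) x t)
            (𝓝[>] 0) (fun x => u x t)) := by
  obtain ⟨C, hC⟩ := hg.lipschitz
  obtain ⟨B, hB0, hB⟩ := hu₀.exists_translationBound
  -- the initial datum enters only through its class, so it may be taken measurable
  obtain ⟨ū, hūm, hūe⟩ : ∃ ū : ℝ → ℝ, Measurable ū ∧ u₀ =ᵐ[volume] ū :=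
    ⟨_, hu₀.1.1.stronglyMeasurable_mk.measurable, hu₀.1.1.ae_eq_mk⟩
  have hūB : TranslationBound B ū := fun h => by
    refine le_trans (le_of_eq (lintegral_congr_ae ?_)) (hB h)
    filter_upwards [hūe, (quasiMeasurePreserving_add_right volume h).ae hūe] with x h1 h2
    rw [h1, h2]
  have hgood := eventually_goodStep hg hC hω hδ hlam (hu₀.1.congr hūe) hB0 hūB
    fun dt hdt => (hU dt hdt).congr_initial hūe
  refine ⟨fun s hs hs0 => ?_, fun hint => ?_⟩
  · obtain ⟨κ, hκ, w, hw⟩ := exists_schemeLimit_of_tendsto hgood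
      (tendsto_nhdsWithin_iff.2 ⟨hs0, Eventually.of_forall hs⟩)
    exact ⟨κ, hκ, fun x t => w (x, t), hw.continuousInL1,
      fun t _ => tendstoL1Loc_of_gauss (hw.tendsto t),
      (hw.isWeakSolution hūm hT).congr_initial hT.le hδ.le hūe.symm⟩
  · obtain ⟨κ, -, w, hw⟩ := exists_schemeLimit_of_tendsto hgood
      (s := fun m : ℕ => 1 / ((m : ℝ) + 1))
      (tendsto_nhdsWithin_iff.2 ⟨tendsto_one_div_add_atTop_nhds_zero_nat,
        Eventually.of_forall fun m => mem_Ioi.2 (by positivity)⟩)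
    exact ⟨fun x t => w (x, t), hw.continuousInL1,
      (hw.isWeakSolution hūm hT).congr_initial hT.le hδ.le hūe.symm,
      (hw.isEntropySolution hūm hT).congr_initial hT.le hδ.le hūe.symm,
      fun v hv => hw.ae_eq_of_isEntropySolution hūm hT hint
        (hv.congr_initial hT.le hδ.le hūe),
      fun t ht => tendstoL1Loc_of_gauss (hw.tendsto_of_unique hūm hT hint hgood ht)⟩
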